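/- Let $\ell\ge 1$ and $d_1,\dots,d_\ell\ge 1$ be integers and $d=\sum_{j=1}^\ell d_j+\ell-2$. Let $P_1=\infty$, $P_2=0$, $P_3,\dots,P_\ell$ be distinct points of $\mathbb P^1(\bar{\mathbb Q})$. Let $\mathbb A$ be the space over $\mathbb Q$ of coefficient vectors $(a_{j,i})_{1\le j\le \ell,\,1\le i\le d_j}$ with $\prod_j a_{j,d_j}\ne 0$; its $\bar{\mathbb Q}$-points are identified with the functions $f=\sum_{i=1}^{d_1}a_{1,i}x^i+\sum_{j=2}^{\ell}\sum_{i=1}^{d_j}a_{j,i}(x-P_j)^{-i}$. Let $\mathrm{HP}(\mathbb A)$ be the graph over $[0,d]$ of the convex piecewise linear function that starts at $(0,0)$ and has on successive unit intervals the slopes, in increasing order, of the list consisting of $0$ ($\ell-1$ times), $1$ ($\ell-1$ times) and $i/d_j$ for $1\le j\le\ell$, $1\le i\le d_j-1$; a vertex is a non-smooth point over the open interval $(0,d)$. For a prime $p$ let $\mathrm{ord}_p$ be the order on $\mathbb C_p$ with $\mathrm{ord}_p\,p=1$, let $E(X)=\exp(\sum_{i\ge0}X^{p^i}/p^i)$ be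 the Artin–Hasse exponential, $\gamma\in\mathbb C_p$ a root of $\sum_{i\ge 0}X^{p^i}/p^i$ with $\mathrm{ord}_p\gamma=\frac1{p-1}$, and $\gamma^{1/d_j}$ a $d_j$-th root of $\gamma$. Given $f\in\mathbb A(\bar{\mathbb Q})$ and an embedding $\bar{\mathbb Q}\hookrightarrow\mathbb C_p$ under which the finite $P_j$ and the $a_{j,i}$ are integral, let $\hat P_j$ and $A_{j,i}$ be the Teichmüller lifts of their reductions, and put $X_1=X$, $X_j=(X-\hat P_j)^{-1}$ for $j\ge2$, $Z_j=\gamma^{1/d_j}X_j$, and $F=\prod_{j=1}^\ell\prod_{i=1}^{d_j}E(\gamma A_{j,i}X_j^i)$. Let $X_j^{(p)}$ and $Z_j^{(p)}$ be defined in the same way with $\hat P_j^{\,p}$ in place of $\hat P_j$, and let $(U_p\xi)(X)=\frac1p\sum_{Y^p=X}\xi(Y)$. Consider the basis elements $1$ and $Z_j^n$ ($1\le j\le\ell$, $n\ge1$), where the element $1$ is left out if $\ell=1$; order them as $e_1,e_2,\dots$ by nondecreasing weight $\phi$, where $\phi(1)=0$, $\phi(Z_j^n)=n/d_j$ for $j\le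 2$ and $\phi(Z_j^n)=(n-1)/d_j$ for $j\ge3$. The Frobenius matrix $\mathbf M(\hat f)$ has as its column indexed by a basis element $e$ the coefficients of the expansion of $U_p(F\cdot e)$ in $1$ and the $(Z_j^{(p)})^n$ (again without $1$ if $\ell=1$), valid on $\mathbb P^1$ minus the open discs of some radius $r<1$ about $\infty$ and the $\hat P_j^{\,p}$, $j\ge 2$. (So if $\tau$ is a lift of Frobenius fixing the $\gamma^{1/d_j}$, then $\tau^{-1}\mathbf M(\hat f)$ is the matrix of $\alpha_1=\tau^{-1}_*\circ U_p\circ F$.) Let $\mathbf M(\hat f)^{[k]}$ be the block of its first $k$ rows and columns. Let $1\le k\le d-\ell$ and let $(k,c_0)$ be a vertex of $\mathrm{HP}(\mathbb A)$. Then there is a Zariski dense open subset $\mathcal U_k$ of $\mathbb A$, defined over $\mathbb Q$, such that for every $f\in\mathcal U_k(\bar{\mathbb Q})$ $$\lim_{p\to\infty}\mathrm{ord}_p\det\bigl(\mathbf M(\hat f)^{[k]}\bigr)=c_0 ,$$ uniformly in the choice of the embeddings $\bar{\mathbb Q}\hookrightarrow\mathbb C_p$ (that is, of the primes over $p$), of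 $\gamma$ and of the roots $\gamma^{1/d_j}$; in particular, for all large $p$, the data are $p$-integral and the determinant is nonzero. -/

import Mathlib

noncomputable section

namespace DworkFamily

/-! ### The coefficient space

The poles are indexed by `Fin ℓ`: index `0` is the pole at infinity, index `1` (if present) is the
pole at the origin, the other indices are the remaining poles.  A pole vector is a function
`P : Fin ℓ → K` whose value at index `0` is never used. -/

/-- Index set of the coefficients: `⟨j, i⟩` stands for the coefficient `a_{j,i+1}` of the
`(i+1)`-st power of the local parameter at the `j`-th pole, `1 ≤ i+1 ≤ d_j`. -/
abbrev CoeffIdx {ℓ : ℕ} (d : Fin ℓ → ℕ) : Type := Σ j : Fin ℓ, Fin (d j)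

/-- The algebraic closure of the rationals. -/
abbrev QBar : Type := AlgebraicClosure ℚ

/-- Geometric points of the coefficient space: all leading coefficients `a_{j,d_j}` are nonzero. -/
def coeffSpace {ℓ : ℕ} (d : Fin ℓ → ℕ) : Set (CoeffIdx d → QBar) :=
  {a | ∀ (j : Fin ℓ) (i : Fin (d j)), i.val + 1 = d j → a ⟨j, i⟩ ≠ 0}

/-- `U` is the set of geometric points of a Zariski open subset of the coefficient space that is
defined over `ℚ`. -/
def IsZariskiOpenOverRat {ℓ : ℕ} (d : Fin ℓ → ℕ) (U : Set (CoeffIdx d → QBar)) : Prop :=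
  ∃ S : Set (MvPolynomial (CoeffIdx d) ℚ),
    U = {a | a ∈ coeffSpace d ∧ ∃ g ∈ S, MvPolynomial.aeval a g ≠ 0}

/-- `U` is Zariski dense in the coefficient space: it meets every nonempty basic open subset. -/
def IsZariskiDense {ℓ : ℕ} (d : Fin ℓ → ℕ) (U : Set (CoeffIdx d → QBar)) : Prop :=
  ∀ h : MvPolynomial (CoeffIdx d) QBar,
    (∃ a ∈ coeffSpace d, MvPolynomial.eval a h ≠ 0) → ∃ a ∈ U, MvPolynomial.eval a h ≠ 0

/-! ### The Hodge polygon -/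

/-- `d = ∑ d_j + ℓ - 2`. -/
def totalDegree {ℓ : ℕ} (d : Fin ℓ → ℕ) : ℕ := (∑ j, d j) + ℓ - 2

/-- The slopes `0` and `1`, each `ℓ - 1` times, and `i / d_j` for `1 ≤ i ≤ d_j - 1`, sorted. -/
def hodgeSlopes {ℓ : ℕ} (d : Fin ℓ → ℕ) : List ℚ :=
  (Multiset.replicate (ℓ - 1) (0 : ℚ) + Multiset.replicate (ℓ - 1) (1 : ℚ) +
    ∑ j : Fin ℓ, (Finset.Icc 1 (d j - 1)).val.map fun i : ℕ => (i : ℚ) / (d j : ℚ)).sort (· ≤ ·)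

/-- The convex piecewise linear function through the origin whose slope on `[i, i + 1]` is the
`i`-th entry of the sorted list of slopes. -/
def hodgePolygon {ℓ : ℕ} (d : Fin ℓ → ℕ) (x : ℝ) : ℝ :=
  ∑ i ∈ Finset.range (hodgeSlopes d).length,
    (((hodgeSlopes d).getD i 0 : ℚ) : ℝ) * max 0 (min 1 (x - i))

/-- `(x, y)` is a vertex: an interior point of the graph over `[0, d]` that is not smooth. -/
def IsHodgeVertex {ℓ : ℕ} (d : Fin ℓ → ℕ) (x y : ℝ) : Prop :=
  0 < x ∧ x < totalDegree d ∧ y = hodgePolygon d x ∧ ¬ DifferentiableAt ℝ (hodgePolygon d) x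

/-! ### The basis -/

/-- Index set of the basis: `(j, n)` with `n ≥ 1` stands for `Z_j ^ n`, and `(0, 0)` for the
constant function `1`.  With a single pole (at infinity) the operator preserves the functions
vanishing at the origin and the constant function is left out. -/
abbrev BasisIdx (ℓ : ℕ) : Type :=
  {b : Fin ℓ × ℕ // 1 ≤ b.2 ∨ (b.1.val = 0 ∧ 2 ≤ ℓ)}

/-- The weight: `n / d_j` at infinity and at the origin, `(n - 1) / d_j` at the other poles. -/
def basisWeight {ℓ : ℕ} (d : Fin ℓ → ℕ) (b : BasisIdx ℓ) : ℚ :=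
  if b.1.1.val ≤ 1 then (b.1.2 : ℚ) / d b.1.1 else ((b.1.2 : ℚ) - 1) / d b.1.1

/-! ### `p`-adic objects -/

section Padic

variable (p : ℕ) [Fact p.Prime]

/-- The `p`-adic order, normalized by `ord_p p = 1`; meaningful for nonzero arguments only. -/
def ordp (x : ℂ_[p]) : ℝ := -Real.logb p ‖x‖

/-- `y` is a Teichmüller element in the residue class of `x`. -/
def IsTeichmullerLift (x y : ℂ_[p]) : Prop :=
  (∃ a : ℕ, 1 ≤ a ∧ y ^ (p ^ a) = y) ∧ ‖y - x‖ < 1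

open Classical in
/-- The Teichmüller lift of the residue class of `x`. -/
def teichmuller (x : ℂ_[p]) : ℂ_[p] :=
  if h : ∃ y, IsTeichmullerLift p x y then h.choose else 0

open Classical in
/-- The power series `∑ i, X ^ (p ^ i) / p ^ i`, the logarithm of the Artin–Hasse exponential. -/
def artinHasseLog : PowerSeries ℚ :=
  PowerSeries.mk fun n => if ∃ i : ℕ, n = p ^ i then (1 : ℚ) / n else 0

/-- The Artin–Hasse exponential `E(X) = exp (∑ i, X ^ (p ^ i) / p ^ i)` as a formal power series. -/
def artinHasse : PowerSeries ℚ := (PowerSeries.exp ℚ).subst (artinHasseLog p)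

/-- The value `E(z)`, for `‖z‖ < 1`. -/
def artinHasseEval (z : ℂ_[p]) : ℂ_[p] :=
  ∑' m : ℕ, ((PowerSeries.coeff m (artinHasse p) : ℚ) : ℂ_[p]) * z ^ m

/-- `γ` is a root of `log E` of `p`-adic order `1 / (p - 1)`. -/
def IsArtinHasseRoot (γ : ℂ_[p]) : Prop :=
  HasSum (fun i : ℕ => γ ^ (p ^ i) / (p : ℂ_[p]) ^ i) 0 ∧ ordp p γ = 1 / ((p : ℝ) - 1)

variable {p} {ℓ : ℕ}

/-- The local parameter `X_j`: `x` at infinity, `(x - Q_j)⁻¹` at the other poles. -/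
def localParam (Q : Fin ℓ → ℂ_[p]) (j : Fin ℓ) (x : ℂ_[p]) : ℂ_[p] :=
  if j.val = 0 then x else (x - Q j)⁻¹

/-- The projective line without the open discs of radius `r` around `∞` and the `Q_j`. -/
def affinoid (Q : Fin ℓ → ℂ_[p]) (r : ℝ) : Set ℂ_[p] :=
  {x | ‖x‖ ≤ r⁻¹ ∧ ∀ j : Fin ℓ, j.val ≠ 0 → r ≤ ‖x - Q j‖}

/-- The basis function `Z_j ^ n = (γ^{1/d_j} X_j) ^ n`, where `δ j` is the chosen root
`γ^{1/d_j}`. -/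
def basisFun (δ Q : Fin ℓ → ℂ_[p]) (b : BasisIdx ℓ) (x : ℂ_[p]) : ℂ_[p] :=
  (δ b.1.1 * localParam Q b.1.1 x) ^ b.1.2

/-- `F(X) = ∏_j ∏_i E(γ A_{j,i} X_j ^ i)`. -/
def splittingFun (d : Fin ℓ → ℕ) (γ : ℂ_[p]) (A : CoeffIdx d → ℂ_[p]) (Q : Fin ℓ → ℂ_[p])
    (x : ℂ_[p]) : ℂ_[p] :=
  ∏ j : Fin ℓ, ∏ i : Fin (d j),
    artinHasseEval p (γ * A ⟨j, i⟩ * localParam Q j x ^ (i.val + 1))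

/-- The Dwork operator `(U_p g)(x) = (1/p) ∑_{y ^ p = x} g(y)`, the roots taken with
multiplicity. -/
def dworkU (g : ℂ_[p] → ℂ_[p]) (x : ℂ_[p]) : ℂ_[p] :=
  ((Polynomial.nthRoots p x).map g).sum / p

/-- `c` is the family of coordinates of the function `g` in the basis with poles `Q`, as an
analytic function on the affinoid of some radius `r < 1`. -/
def IsBasisExpansion (δ Q : Fin ℓ → ℂ_[p]) (g : ℂ_[p] → ℂ_[p]) (c : BasisIdx ℓ → ℂ_[p]) : Prop :=
  ∃ r : ℝ, 0 < r ∧ r < 1 ∧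
    ∀ x ∈ affinoid Q r, HasSum (fun b => c b * basisFun δ Q b x) (g x)

open Classical in
/-- The coordinates of `g` in the basis with poles `Q` (unique when they exist, by the
Mittag-Leffler decomposition). -/
def basisCoords (δ Q : Fin ℓ → ℂ_[p]) (g : ℂ_[p] → ℂ_[p]) : BasisIdx ℓ → ℂ_[p] :=
  if h : ∃ c, IsBasisExpansion δ Q g c then h.choose else 0

/-- The Frobenius matrix `M = (C_{J₁,J}^{n,i})`: its column `(J, i)` holds the coordinates of
`U_p (F · Z_J ^ i)`, a function with poles at the `Q_j ^ p`, in the basis with these poles.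
For Teichmüller points `Q_j` the Frobenius `τ` maps `Q_j` to `Q_j ^ p` and fixes the `δ j`, so the
matrix of `α₁ = τ⁻¹_* ∘ U_p ∘ F` in the basis with poles `Q_j` is `τ⁻¹ M`. -/
def frobeniusMatrix (d : Fin ℓ → ℕ) (γ : ℂ_[p]) (δ : Fin ℓ → ℂ_[p]) (A : CoeffIdx d → ℂ_[p])
    (Q : Fin ℓ → ℂ_[p]) : Matrix (BasisIdx ℓ) (BasisIdx ℓ) ℂ_[p] :=
  Matrix.of fun b' b =>
    basisCoords δ (fun j => Q j ^ p)
      (dworkU fun y => splittingFun d γ A Q y * basisFun δ Q b y) b'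

/-- The specialization `M(f̂)`: coefficients and poles of `f`, embedded by `ι`, are replaced by
the Teichmüller lifts of their reductions. -/
def frobeniusMatrixAt (d : Fin ℓ → ℕ) (P : Fin ℓ → QBar) (f : CoeffIdx d → QBar)
    (ι : QBar →+* ℂ_[p]) (γ : ℂ_[p]) (δ : Fin ℓ → ℂ_[p]) :
    Matrix (BasisIdx ℓ) (BasisIdx ℓ) ℂ_[p] :=
  frobeniusMatrix d γ δ (fun s => teichmuller p (ι (f s))) (fun j => teichmuller p (ι (P j)))

end Padic

/-- The upper left `k × k` block of an infinite matrix with respect to an enumeration `e` of its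
index set. -/
def principalBlock {I R : Type} (e : ℕ ≃ I) (k : ℕ) (M : Matrix I I R) :
    Matrix (Fin k) (Fin k) R :=
  M.submatrix (fun i => e i) (fun i => e i)

end DworkFamily

end

/-! Expand `F` in powers of `γ`: the part of degree `N` is a sum of monomials in the local
parameters, indexed by multi-indices of total degree `N`. Partial fractions (`prod_poleParam_pow`)
and an explicit formula for `U_p` on powers of one parameter (`sum_nthRoots_poleParam_pow`) turn a
column into a convergent expansion (`hasSum_column`). Such expansions are unique
(`poleParam_expansion_unique`), so this computes the matrix (`frobeniusMatrix_apply`). The factors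
`γ^{1/d_j}` amount to a diagonal conjugation and drop out of the determinant.

Consider a row at the pole `j` whose weight is `ν/d_j`. Up to `p`-adically small terms, the
coefficient sought arises only from monomials with a pole of order about `pν` at `P_j`, while a
monomial of degree `N` has order at most about `d_j N`. Hence the row is divisible by `γ^U`, `U =
⌊pν/d_j⌋`, up to a negligible error. Since `ord_p γ = 1/(p-1)` and `⌊pν/d_j⌋/(p-1)` tends to
`ν/d_j`, this gives the expected order as a lower bound. At a vertex the first `k` basis elements
are exactly those of weight below some `σ ≤ 1`, and their weights add up to `c_0`
(`exists_bound_of_isHodgeVertex`).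

For the converse it is enough that, after removal of these powers, the determinant is divisible only
by a bounded power of `γ`. Each row is therefore expanded to a fixed depth `L` beyond `γ^U`. Almost
all of a contributing multi-index sits on the leading coefficient `a_{j,d_j}`, so after division by
a unit the coefficients are given by a formula of bounded size (`mainCoeff_add`). Modulo `p` one has
`U ≡ -(pν mod d_j)/d_j`, so their reductions depend only on `f` and on the class of `p` modulo `∏
d_j` (`frobPairs_coeff_detPoly`). The determinant becomes the value at `γ` of a polynomial, up to
`γ^{L+1}`. The use of Teichmüller lifts makes each coefficient of that polynomial either a unit or
divisible by `p`, so one unit among the coefficients of degree at most `L` determines the norm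
(`exists_norm_eq_pow`).

It remains to see that for each residue class some such coefficient is a nonzero polynomial in the
`a_{j,i}` (`exists_coeff_detPoly_ne_zero`). Specialize to functions with only the lowest and the
highest term at each pole, and take lowest terms first for a weighted scaling of the coefficients,
then in `γ`. The resulting matrix is block triangular with respect to the poles, and its diagonal
blocks consist of inverse factorials of differences, which are Vandermonde determinants up to
nonzero factors. The open set is cut out by the product over the finitely many classes, replaced by
a rational multiple of it. -/

noncomputable section

namespace DworkFamily

open Finset

/-! ### Partial fractions -/

section PartialFractions

variable {K : Type*} [Field K] {ℓ : ℕ}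

/-- The local parameter at the `j`-th pole, over any field. -/
def poleParam (Q : Fin ℓ → K) (j : Fin ℓ) (x : K) : K :=
  if j.val = 0 then x else (x - Q j)⁻¹

/-- The expansion of the local parameter of the `i`-th pole in the inverse of the local parameter
of the `j`-th pole, for `i ≠ j`. -/
def locSeries (Q : Fin ℓ → K) (j i : Fin ℓ) : PowerSeries K :=
  if j.val = 0 then PowerSeries.mk fun n => if n = 0 then 0 else Q i ^ (n - 1)
  else if i.val = 0 then PowerSeries.C (Q j) + PowerSeries.X
  else PowerSeries.mk fun n => (-1) ^ n * (Q j - Q i)⁻¹ ^ (n + 1)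

/-- The expansion at the `j`-th pole of a monomial in the other local parameters. -/
def restSeries (Q : Fin ℓ → K) (j : Fin ℓ) (w : Fin ℓ → ℕ) : PowerSeries K :=
  ∏ i ∈ univ.erase j, locSeries Q j i ^ w i

/-- The coefficient of `X_j ^ n` in the partial fraction expansion of `∏ X_i ^ w_i`. -/
def pfCoeff (Q : Fin ℓ → K) (w : Fin ℓ → ℕ) (j : Fin ℓ) (n : ℕ) : K :=
  if (1 ≤ n ∨ j.val = 0) ∧ n ≤ w j then PowerSeries.coeff (w j - n) (restSeries Q j w) else 0

/-- In the coordinate `t = x - Q j` one has `X_i = 1 / (t + (Q j - Q i))`. -/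
theorem locSeries_of_ne_zero {Q : Fin ℓ → K} {j i : Fin ℓ} (hj : j.val ≠ 0) (hi : i.val ≠ 0)
    (h : Q j ≠ Q i) :
    locSeries Q j i * (PowerSeries.X + PowerSeries.C (Q j - Q i)) = 1 := by
  have h' : Q j - Q i ≠ 0 := sub_ne_zero.mpr h
  ext n
  rw [locSeries, if_neg hj, if_neg hi, mul_add, map_add, PowerSeries.coeff_mul_C]
  cases n with
  | zero => simp [h']
  | succ n =>
    rw [PowerSeries.coeff_succ_mul_X]
    simp only [PowerSeries.coeff_mk, PowerSeries.coeff_one]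
    simp only [Nat.add_eq_zero_iff, one_ne_zero, and_false, if_false]
    rw [pow_succ _ (n + 1), mul_assoc, mul_assoc, inv_mul_cancel₀ h', mul_one, pow_succ (-1 : K)]
    ring

/-- In the coordinate `t = 1/x` one has `X_i = t / (1 - Q_i t)`, here with the denominator cleared.
-/
theorem locSeries_of_zero {Q : Fin ℓ → K} {j i : Fin ℓ} (hj : j.val = 0) :
    locSeries Q j i = PowerSeries.X + PowerSeries.C (Q i) * (PowerSeries.X * locSeries Q j i) := by
  ext n
  rw [locSeries, if_pos hj, map_add, PowerSeries.coeff_C_mul]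
  cases n with
  | zero => simp
  | succ n =>
    rw [PowerSeries.coeff_succ_X_mul, PowerSeries.coeff_X]
    cases n with
    | zero => simp
    | succ n => simp [pow_succ']

theorem locSeries_to_zero {Q : Fin ℓ → K} {j i : Fin ℓ} (hj : j.val ≠ 0) (hi : i.val = 0) :
    locSeries Q j i = PowerSeries.C (Q j) + PowerSeries.X := by
  rw [locSeries, if_neg hj, if_pos hi]

theorem restSeries_add_single (Q : Fin ℓ → K) (j k : Fin ℓ) (u : Fin ℓ → ℕ) :
    restSeries Q j (u + Pi.single k 1) =
      restSeries Q j u * if k = j then 1 else locSeries Q j k := by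
  unfold restSeries
  simp only [Pi.add_apply, pow_add, prod_mul_distrib]
  congr 1
  split_ifs with h
  · subst h
    refine prod_eq_one fun i hi => ?_
    rw [Pi.single_eq_of_ne (ne_of_mem_erase hi), pow_zero]
  · rw [prod_eq_single k]
    · simp
    · intro i _ hik
      rw [Pi.single_eq_of_ne hik, pow_zero]
    · intro hk
      exact absurd (mem_erase.mpr ⟨h, mem_univ _⟩) hk

/-- The factor `X ^ (M - w j)` makes the index of the coefficient independent of `w`. Relations
between monomials of different order at `j` thereby become identities of power series. -/
theorem pfCoeff_eq_coeff (Q : Fin ℓ → K) (w : Fin ℓ → ℕ) (j : Fin ℓ) (n M : ℕ) (hM : w j ≤ M)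
    (hn : n ≤ M) (hb : 1 ≤ n ∨ j.val = 0) :
    pfCoeff Q w j n =
      PowerSeries.coeff (M - n) (PowerSeries.X ^ (M - w j) * restSeries Q j w) := by
  unfold pfCoeff
  rw [PowerSeries.coeff_X_pow_mul']
  by_cases h : n ≤ w j
  · rw [if_pos ⟨hb, h⟩, if_pos (by omega)]
    congr 2
    omega
  · rw [if_neg (by tauto), if_neg (by omega)]

theorem pfCoeff_of_lt (Q : Fin ℓ → K) {w : Fin ℓ → ℕ} {j : Fin ℓ} {n : ℕ} (h : w j < n) :
    pfCoeff Q w j n = 0 := by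
  rw [pfCoeff, if_neg (by omega)]

theorem pfCoeff_of_not {Q : Fin ℓ → K} {w : Fin ℓ → ℕ} {j : Fin ℓ} {n : ℕ}
    (h : ¬ (1 ≤ n ∨ j.val = 0)) : pfCoeff Q w j n = 0 := by
  rw [pfCoeff, if_neg (by tauto)]

/-- The identity `(Q_k - Q_l) X_k X_l = X_k - X_l` of functions, read off from the expansions at the
pole `j`. The cases `j = k`, `j = l` and `j` different from both need different forms of the local
expansions. -/
theorem pfCoeff_add_single_add_single {Q : Fin ℓ → K}
    {k l : Fin ℓ} (hkl : k ≠ l) (hk : k.val ≠ 0) (hl : l.val ≠ 0) (u : Fin ℓ → ℕ)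
    (hQ : ∀ i j : Fin ℓ, i.val ≠ 0 → j.val ≠ 0 → Q i = Q j → i = j) (j : Fin ℓ) (n : ℕ) :
    (Q k - Q l) * pfCoeff Q (u + Pi.single k 1 + Pi.single l 1 : Fin ℓ → ℕ) j n =
      pfCoeff Q (u + Pi.single k 1 : Fin ℓ → ℕ) j n - pfCoeff Q (u + Pi.single l 1 : Fin ℓ → ℕ) j n := by
  by_cases hb : 1 ≤ n ∨ j.val = 0
  swap
  · simp [pfCoeff_of_not hb]
  have key : ∀ {M : ℕ}, u j + 2 ≤ M → PowerSeries.C (Q k - Q l) * (PowerSeries.X ^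
        (M - (u + Pi.single k 1 + Pi.single l 1 : Fin ℓ → ℕ) j) *
        restSeries Q j (u + Pi.single k 1 + Pi.single l 1)) =
      PowerSeries.X ^ (M - (u + Pi.single k 1 : Fin ℓ → ℕ) j) * restSeries Q j (u + Pi.single k 1) -
      PowerSeries.X ^ (M - (u + Pi.single l 1 : Fin ℓ → ℕ) j) * restSeries Q j (u + Pi.single l 1) := by
    intro M hM
    rw [restSeries_add_single, restSeries_add_single, restSeries_add_single]
    by_cases hjk : k = j
    · subst hjk
      have h1 := locSeries_of_ne_zero hk hl (fun h => hkl (hQ _ _ hk hl h))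
      have e1 : M - (u + Pi.single k 1 + Pi.single l 1 : Fin ℓ → ℕ) k = M - u k - 1 := by
        simp [Pi.single_eq_of_ne hkl]; omega
      have e2 : M - (u + Pi.single k 1 : Fin ℓ → ℕ) k = M - u k - 1 := by simp; omega
      have e3 : M - (u + Pi.single l 1 : Fin ℓ → ℕ) k = M - u k - 1 + 1 := by
        simp [Pi.single_eq_of_ne hkl]; omega
      rw [e1, e2, e3, if_pos rfl, if_neg (Ne.symm hkl)]
      linear_combination (PowerSeries.X ^ (M - u k - 1) * restSeries Q k u) * h1
    by_cases hjl : l = j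
    · subst hjl
      have h1 := locSeries_of_ne_zero hl hk (fun h => hkl (hQ _ _ hl hk h).symm)
      have e1 : M - (u + Pi.single k 1 + Pi.single l 1 : Fin ℓ → ℕ) l = M - u l - 1 := by
        simp [Pi.single_eq_of_ne (Ne.symm hkl)]; omega
      have e2 : M - (u + Pi.single l 1 : Fin ℓ → ℕ) l = M - u l - 1 := by simp; omega
      have e3 : M - (u + Pi.single k 1 : Fin ℓ → ℕ) l = M - u l - 1 + 1 := by
        simp [Pi.single_eq_of_ne (Ne.symm hkl)]; omega
      rw [e1, e2, e3, if_pos rfl, if_neg hkl]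
      rw [map_sub] at h1 ⊢
      linear_combination -(PowerSeries.X ^ (M - u l - 1) * restSeries Q l u) * h1
    have e1 : M - (u + Pi.single k 1 + Pi.single l 1 : Fin ℓ → ℕ) j = M - u j := by
      simp [Pi.single_eq_of_ne (Ne.symm hjk), Pi.single_eq_of_ne (Ne.symm hjl)]
    have e2 : M - (u + Pi.single k 1 : Fin ℓ → ℕ) j = M - u j := by simp [Pi.single_eq_of_ne (Ne.symm hjk)]
    have e3 : M - (u + Pi.single l 1 : Fin ℓ → ℕ) j = M - u j := by simp [Pi.single_eq_of_ne (Ne.symm hjl)]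
    rw [e1, e2, e3, if_neg hjk, if_neg hjl]
    have h0 : PowerSeries.C (Q k - Q l) * (locSeries Q j k * locSeries Q j l) =
        locSeries Q j k - locSeries Q j l := by
      by_cases hj : j.val = 0
      · have h1 := locSeries_of_zero (Q := Q) (i := k) hj
        have h2 := locSeries_of_zero (Q := Q) (i := l) hj
        have hX : (PowerSeries.X : PowerSeries K) ≠ 0 := PowerSeries.X_ne_zero
        apply mul_left_cancel₀ hX
        rw [map_sub]
        linear_combination (-locSeries Q j l) * h1 + (locSeries Q j k) * h2
      · have h1 := locSeries_of_ne_zero hj hk (fun h => hjk (hQ _ _ hj hk h).symm)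
        have h2 := locSeries_of_ne_zero hj hl (fun h => hjl (hQ _ _ hj hl h).symm)
        rw [map_sub] at h1 h2 ⊢
        linear_combination (-locSeries Q j l) * h1 + (locSeries Q j k) * h2
    linear_combination (PowerSeries.X ^ (M - u j) * restSeries Q j u) * h0
  have hw : ∀ i : Fin ℓ, (Pi.single i 1 : Fin ℓ → ℕ) j ≤ 1 := by
    intro i
    by_cases h : j = i
    · subst h; simp
    · simp [Pi.single_eq_of_ne h]
  have hk' := hw k
  have hl' := hw l
  rw [pfCoeff_eq_coeff _ _ _ _ (u j + 2 + n) (by simp only [Pi.add_apply]; omega) (by omega) hb,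
    pfCoeff_eq_coeff _ _ _ _ (u j + 2 + n) (by simp only [Pi.add_apply]; omega) (by omega) hb,
    pfCoeff_eq_coeff _ _ _ _ (u j + 2 + n) (by simp only [Pi.add_apply]; omega) (by omega) hb,
    ← PowerSeries.coeff_C_mul, key (by omega), map_sub]

/-- The analogue for the pole at infinity: `x X_l = 1 + Q_l X_l`. -/
theorem pfCoeff_add_single_zero_add_single {Q : Fin ℓ → K}
    {k l : Fin ℓ} (hk : k.val = 0) (hl : l.val ≠ 0) (u : Fin ℓ → ℕ)
    (hQ : ∀ i j : Fin ℓ, i.val ≠ 0 → j.val ≠ 0 → Q i = Q j → i = j) (j : Fin ℓ) (n : ℕ) :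
    pfCoeff Q (u + Pi.single k 1 + Pi.single l 1 : Fin ℓ → ℕ) j n =
      pfCoeff Q u j n + Q l * pfCoeff Q (u + Pi.single l 1 : Fin ℓ → ℕ) j n := by
  have hkl : k ≠ l := by rintro rfl; exact hl hk
  by_cases hb : 1 ≤ n ∨ j.val = 0
  swap
  · simp [pfCoeff_of_not hb]
  have key : ∀ {M : ℕ}, u j + 2 ≤ M → (PowerSeries.X ^
        (M - (u + Pi.single k 1 + Pi.single l 1 : Fin ℓ → ℕ) j) *
        restSeries Q j (u + Pi.single k 1 + Pi.single l 1)) =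
      PowerSeries.X ^ (M - u j) * restSeries Q j u + PowerSeries.C (Q l) *
      (PowerSeries.X ^ (M - (u + Pi.single l 1 : Fin ℓ → ℕ) j) * restSeries Q j (u + Pi.single l 1)) := by
    intro M hM
    rw [restSeries_add_single, restSeries_add_single, restSeries_add_single]
    by_cases hjk : k = j
    · subst hjk
      have h1 := locSeries_of_zero (Q := Q) (i := l) hk
      have e1 : M - (u + Pi.single k 1 + Pi.single l 1 : Fin ℓ → ℕ) k = M - u k - 1 := by
        simp [Pi.single_eq_of_ne hkl]; omega
      have e2 : M - u k = M - u k - 1 + 1 := by omega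
      have e3 : M - (u + Pi.single l 1 : Fin ℓ → ℕ) k = M - u k - 1 + 1 := by
        simp [Pi.single_eq_of_ne hkl]; omega
      rw [e1, e3, if_pos rfl, if_neg (Ne.symm hkl), e2]
      simp only [Nat.add_sub_cancel]
      linear_combination (PowerSeries.X ^ (M - u k - 1) * restSeries Q k u) * h1
    by_cases hjl : l = j
    · subst hjl
      have h1 := locSeries_to_zero (Q := Q) hl hk
      have e1 : M - (u + Pi.single k 1 + Pi.single l 1 : Fin ℓ → ℕ) l = M - u l - 1 := by
        simp [Pi.single_eq_of_ne (Ne.symm hkl)]; omega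
      have e2 : M - (u + Pi.single l 1 : Fin ℓ → ℕ) l = M - u l - 1 := by simp; omega
      have e3 : M - u l = M - u l - 1 + 1 := by omega
      rw [e1, e2, if_pos rfl, if_neg hkl, e3]
      simp only [Nat.add_sub_cancel]
      linear_combination (PowerSeries.X ^ (M - u l - 1) * restSeries Q l u) * h1
    have e1 : M - (u + Pi.single k 1 + Pi.single l 1 : Fin ℓ → ℕ) j = M - u j := by
      simp [Pi.single_eq_of_ne (Ne.symm hjk), Pi.single_eq_of_ne (Ne.symm hjl)]
    have e3 : M - (u + Pi.single l 1 : Fin ℓ → ℕ) j = M - u j := by simp [Pi.single_eq_of_ne (Ne.symm hjl)]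
    rw [e1, e3, if_neg hjk, if_neg hjl]
    have hj : j.val ≠ 0 := fun h => hjk (Fin.ext (hk.trans h.symm))
    have h1 := locSeries_to_zero (Q := Q) hj hk
    have h2 := locSeries_of_ne_zero hj hl (fun h => hjl (hQ _ _ hj hl h).symm)
    rw [map_sub] at h2
    linear_combination (PowerSeries.X ^ (M - u j) * restSeries Q j u) * h2 +
      (PowerSeries.X ^ (M - u j) * restSeries Q j u * locSeries Q j l) * h1
  have hw : ∀ i : Fin ℓ, (Pi.single i 1 : Fin ℓ → ℕ) j ≤ 1 := by
    intro i
    by_cases h : j = i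
    · subst h; simp
    · simp [Pi.single_eq_of_ne h]
  have hk' := hw k
  have hl' := hw l
  rw [pfCoeff_eq_coeff _ _ _ _ (u j + 2 + n) (by simp only [Pi.add_apply]; omega) (by omega) hb,
    pfCoeff_eq_coeff _ _ _ _ (u j + 2 + n) (by omega) (by omega) hb,
    pfCoeff_eq_coeff _ _ _ _ (u j + 2 + n) (by simp only [Pi.add_apply]; omega) (by omega) hb,
    ← PowerSeries.coeff_C_mul, key (by omega), map_add]

theorem coeff_restSeries_single {Q : Fin ℓ → K} {j k : Fin ℓ} (hjk : j ≠ k) (hj : j.val = 0)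
    (a : ℕ) (ha : 1 ≤ a) : PowerSeries.coeff 0 (restSeries Q j (Pi.single k a)) = 0 := by
  rw [PowerSeries.coeff_zero_eq_constantCoeff_apply, restSeries, map_prod]
  apply prod_eq_zero (mem_erase.mpr ⟨Ne.symm hjk, mem_univ k⟩)
  rw [map_pow, locSeries, if_pos hj, ← PowerSeries.coeff_zero_eq_constantCoeff_apply,
    PowerSeries.coeff_mk, if_pos rfl, Pi.single_eq_same, zero_pow (by omega)]

theorem restSeries_single_self (Q : Fin ℓ → K) (k : Fin ℓ) (a : ℕ) :
    restSeries Q k (Pi.single k a) = 1 := by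
  refine prod_eq_one fun i hi => ?_
  rw [Pi.single_eq_of_ne (ne_of_mem_erase hi), pow_zero]

theorem pfCoeff_single {Q : Fin ℓ → K} (j k : Fin ℓ) (a n : ℕ) (ha : 1 ≤ a ∨ k.val = 0) :
    pfCoeff Q (Pi.single k a) j n = if j = k ∧ n = a then 1 else 0 := by
  unfold pfCoeff
  by_cases hjk : j = k
  · subst hjk
    rw [restSeries_single_self, Pi.single_eq_same, PowerSeries.coeff_one]
    by_cases hn : n = a
    · subst hn; simp [ha]
    · rw [if_neg (show ¬ (j = j ∧ n = a) by tauto)]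
      split_ifs <;> first | rfl | omega
  · rw [if_neg (show ¬ (j = k ∧ n = a) by tauto), Pi.single_eq_of_ne hjk]
    split_ifs with h
    · obtain ⟨h1, h2⟩ := h
      have hn : n = 0 := by omega
      subst hn
      have hj0 : j.val = 0 := by omega
      have hk0 : k.val ≠ 0 := fun h => hjk (Fin.ext (hj0.trans h.symm))
      exact coeff_restSeries_single hjk hj0 a (by omega)
    · rfl

theorem poleParam_mul {Q : Fin ℓ → K} {k l : Fin ℓ} {x : K} (hk : k.val ≠ 0) (hl : l.val ≠ 0)
    (hxk : x ≠ Q k) (hxl : x ≠ Q l) :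
    (Q k - Q l) * (poleParam Q k x * poleParam Q l x) = poleParam Q k x - poleParam Q l x := by
  have h1 : x - Q k ≠ 0 := sub_ne_zero.mpr hxk
  have h2 : x - Q l ≠ 0 := sub_ne_zero.mpr hxl
  rw [poleParam, if_neg hk, poleParam, if_neg hl]
  field_simp
  ring

theorem poleParam_zero_mul {Q : Fin ℓ → K} {k l : Fin ℓ} {x : K} (hk : k.val = 0)
    (hl : l.val ≠ 0) (hxl : x ≠ Q l) :
    poleParam Q k x * poleParam Q l x = 1 + Q l * poleParam Q l x := by
  have h2 : x - Q l ≠ 0 := sub_ne_zero.mpr hxl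
  rw [poleParam, if_pos hk, poleParam, if_neg hl]
  field_simp
  ring

theorem prod_pow_add_single (g : Fin ℓ → K) (u : Fin ℓ → ℕ) (k : Fin ℓ) :
    ∏ j, g j ^ (u + Pi.single k 1 : Fin ℓ → ℕ) j = (∏ j, g j ^ u j) * g k := by
  simp only [Pi.add_apply, pow_add, prod_mul_distrib]
  congr 1
  rw [prod_eq_single k] <;> simp +contextual [Pi.single_eq_of_ne]

/-- The partial fraction expansion of a monomial in the local parameters. -/
theorem prod_poleParam_pow {Q : Fin ℓ → K} (hℓ : 1 ≤ ℓ)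
    (hQ : ∀ i j : Fin ℓ, i.val ≠ 0 → j.val ≠ 0 → Q i = Q j → i = j) {x : K}
    (hx : ∀ j : Fin ℓ, j.val ≠ 0 → x ≠ Q j) (w : Fin ℓ → ℕ) (M : ℕ) (hM : ∀ j, w j < M) :
    ∏ j, poleParam Q j x ^ w j =
      ∑ j, ∑ n ∈ range M, pfCoeff Q w j n * poleParam Q j x ^ n := by
  induction hs : ∑ j, w j using Nat.strong_induction_on generalizing w with
  | _ s ih =>
  -- If two different parameters occur, one of the two product identities lowers the total degree.
  -- Otherwise the monomial is a power of a single parameter and is its own expansion.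
  by_cases h : ∃ k l : Fin ℓ, k ≠ l ∧ w k ≠ 0 ∧ w l ≠ 0
  · have h' : ∃ k l : Fin ℓ, k ≠ l ∧ w k ≠ 0 ∧ w l ≠ 0 ∧ l.val ≠ 0 := by
      obtain ⟨k, l, hkl, hk, hl⟩ := h
      by_cases hl0 : l.val = 0
      · exact ⟨l, k, hkl.symm, hl, hk, fun h => hkl (Fin.ext (h.trans hl0.symm))⟩
      · exact ⟨k, l, hkl, hk, hl, hl0⟩
    obtain ⟨k, l, hkl, hk, hl, hl0⟩ := h'
    obtain ⟨u, rfl⟩ : ∃ u : Fin ℓ → ℕ, w = u + Pi.single k 1 + Pi.single l 1 := by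
      refine ⟨w - Pi.single k 1 - Pi.single l 1, ?_⟩
      ext i
      simp only [Pi.add_apply, Pi.sub_apply]
      by_cases hik : i = k
      · subst hik
        rw [Pi.single_eq_same, Pi.single_eq_of_ne hkl]
        omega
      · rw [Pi.single_eq_of_ne hik]
        by_cases hil : i = l
        · subst hil
          rw [Pi.single_eq_same]
          omega
        · rw [Pi.single_eq_of_ne hil]
          omega
    have hsum : ∀ (v : Fin ℓ → ℕ) (i : Fin ℓ), ∑ j, (v + Pi.single i 1 : Fin ℓ → ℕ) j = (∑ j, v j) + 1 := by
      intro v i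
      simp [sum_add_distrib]
    rw [hsum, hsum] at hs
    have hu : ∀ j, u j < M := fun j => lt_of_le_of_lt (by simp only [Pi.add_apply]; omega) (hM j)
    have hul : ∀ j, (u + Pi.single l 1 : Fin ℓ → ℕ) j < M :=
      fun j => lt_of_le_of_lt (by simp only [Pi.add_apply]; omega) (hM j)
    have huk : ∀ j, (u + Pi.single k 1 : Fin ℓ → ℕ) j < M :=
      fun j => lt_of_le_of_lt (by simp only [Pi.add_apply]; omega) (hM j)
    have ihl := ih _ (by rw [← hs]; omega) (u + Pi.single l 1) hul (hsum u l)
    have ihk := ih _ (by rw [← hs]; omega) (u + Pi.single k 1) huk (hsum u k)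
    have ihu := ih _ (by rw [← hs]; omega) u hu rfl
    rw [prod_pow_add_single] at ihl ihk
    rw [prod_pow_add_single, prod_pow_add_single]
    by_cases hk0 : k.val = 0
    · simp_rw [pfCoeff_add_single_zero_add_single hk0 hl0 u hQ, add_mul, sum_add_distrib]
      rw [mul_assoc, poleParam_zero_mul hk0 hl0 (hx l hl0), mul_add, mul_one, ihu]
      congr 1
      rw [← ihu, mul_left_comm, ihl, mul_sum]
      refine sum_congr rfl fun j _ => ?_
      rw [mul_sum]
      exact sum_congr rfl fun n _ => by ring
    · have hne : Q k - Q l ≠ 0 := sub_ne_zero.mpr fun h => hkl (hQ _ _ hk0 hl0 h)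
      apply mul_left_cancel₀ hne
      have e1 : (Q k - Q l) * ((∏ j, poleParam Q j x ^ u j) * poleParam Q k x * poleParam Q l x) =
          (∏ j, poleParam Q j x ^ u j) * poleParam Q k x -
          (∏ j, poleParam Q j x ^ u j) * poleParam Q l x := by
        linear_combination (∏ j, poleParam Q j x ^ u j) *
          poleParam_mul hk0 hl0 (hx k hk0) (hx l hl0)
      rw [e1, ihk, ihl, mul_sum, ← sum_sub_distrib]
      refine sum_congr rfl fun j _ => ?_
      rw [mul_sum, ← sum_sub_distrib]
      refine sum_congr rfl fun n _ => ?_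
      rw [← mul_assoc, pfCoeff_add_single_add_single hkl hk0 hl0 u hQ, sub_mul]
  · push Not at h
    obtain ⟨k, a, ha, rfl⟩ : ∃ (k : Fin ℓ) (a : ℕ), (1 ≤ a ∨ k.val = 0) ∧ w = Pi.single k a := by
      by_cases h0 : ∃ k, w k ≠ 0
      · obtain ⟨k, hk⟩ := h0
        refine ⟨k, w k, Or.inl (by omega), ?_⟩
        ext i
        by_cases hik : i = k
        · subst hik; simp
        · rw [Pi.single_eq_of_ne hik]
          exact h k i (Ne.symm hik) hk
      · push Not at h0
        -- The constant monomial is counted as the zeroth power of the parameter at infinity.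
        exact ⟨⟨0, by omega⟩, 0, Or.inr rfl, by ext i; simp [h0]⟩
    rw [prod_eq_single k (fun j _ hj => by simp [Pi.single_eq_of_ne hj]) (by simp),
      sum_eq_single k]
    · rw [sum_eq_single a]
      · rw [pfCoeff_single _ _ _ _ ha, if_pos ⟨rfl, rfl⟩, Pi.single_eq_same, one_mul]
      · intro n _ hn
        rw [pfCoeff_single _ _ _ _ ha, if_neg (by tauto), zero_mul]
      · intro hn
        have := hM k
        rw [Pi.single_eq_same] at this
        exact absurd (mem_range.mpr this) hn
    · intro j _ hj
      refine sum_eq_zero fun n _ => ?_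
      rw [pfCoeff_single _ _ _ _ ha, if_neg (by tauto), zero_mul]
    · simp

end PartialFractions

/-! ### The Dwork operator on powers of local parameters -/

section DworkOperator

variable {K : Type*} [Field K] {ℓ : ℕ}

/-- The coefficient of `(x - Q ^ p)⁻¹ ^ m` in `U_p ((x - Q)⁻¹ ^ n)`, for `m, n ≥ 1`. -/
def dworkCoeff (p : ℕ) (Q : K) (m n : ℕ) : K :=
  PowerSeries.coeff (n - 1) ((PowerSeries.C Q + PowerSeries.X) ^ (p - 1) *
    ((PowerSeries.C Q + PowerSeries.X) ^ p - PowerSeries.C (Q ^ p)) ^ (m - 1))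

theorem X_dvd_shift (p : ℕ) (Q : K) :
    (PowerSeries.X : PowerSeries K) ∣
      (PowerSeries.C Q + PowerSeries.X) ^ p - PowerSeries.C (Q ^ p) := by
  rw [PowerSeries.X_dvd_iff]
  simp

theorem dworkCoeff_of_lt (p : ℕ) (Q : K) {m n : ℕ} (hn : 1 ≤ n) (h : n < m) :
    dworkCoeff p Q m n = 0 := by
  have h1 : (PowerSeries.X : PowerSeries K) ^ (m - 1) ∣
      (PowerSeries.C Q + PowerSeries.X) ^ (p - 1) *
      ((PowerSeries.C Q + PowerSeries.X) ^ p - PowerSeries.C (Q ^ p)) ^ (m - 1) :=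
    Dvd.dvd.mul_left (pow_dvd_pow_of_dvd (X_dvd_shift p Q) _) _
  exact PowerSeries.X_pow_dvd_iff.mp h1 (n - 1) (by omega)

theorem sum_nthRoots_pow [IsAlgClosed K] [CharZero K] {p : ℕ} (hp : 0 < p) (x : K) (n : ℕ) :
    ((Polynomial.nthRoots p x).map fun y => y ^ n).sum / p =
      if p ∣ n then x ^ (n / p) else 0 := by
  have hp0 : (p : K) ≠ 0 := Nat.cast_ne_zero.mpr hp.ne'
  have : NeZero (p : K) := ⟨hp0⟩
  have : NeZero p := ⟨hp.ne'⟩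
  obtain ⟨ζ, hζ⟩ := HasEnoughRootsOfUnity.exists_primitiveRoot K p
  obtain ⟨α, hα⟩ := IsAlgClosed.exists_pow_nat_eq x hp
  rw [hζ.nthRoots_eq hα, Multiset.map_map]
  have e1 : (Multiset.map ((fun y => y ^ n) ∘ fun i => ζ ^ i * α) (Multiset.range p)).sum =
      ∑ i ∈ range p, (ζ ^ n) ^ i * α ^ n := by
    rw [Finset.sum, Finset.range_val]
    congr 1
    refine Multiset.map_congr rfl fun i _ => ?_
    simp only [Function.comp]
    rw [mul_pow, ← pow_mul, ← pow_mul, mul_comm i n]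
  rw [e1, ← sum_mul]
  split_ifs with h
  · obtain ⟨m, rfl⟩ := h
    rw [pow_mul, hζ.pow_eq_one, one_pow]
    simp only [one_pow, sum_const, card_range, nsmul_eq_mul, mul_one]
    rw [mul_div_cancel_left₀ _ hp0, Nat.mul_div_cancel_left m hp, pow_mul, hα]
  · have hne : ζ ^ n ≠ 1 := fun h1 => h ((hζ.pow_eq_one_iff_dvd n).mp h1)
    rw [geom_sum_eq hne, ← pow_mul, mul_comm n p, pow_mul, hζ.pow_eq_one, one_pow, sub_self,
      zero_div, zero_mul, zero_div]

/-- With `t = Q + X`, the generating series of the `(y - Q)⁻¹ ^ n` is `-1/(t - y)`. Its sum over the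
roots `y` is minus the logarithmic derivative `p t^{p-1} / (t^p - x)`. Write `t^p - x = h - (x -
Q^p)` with `X` dividing `h` and expand geometrically in `h / (x - Q^p)`; the terms from `h^n` on do
not reach degree `n - 1`. -/
theorem sum_nthRoots_inv_pow [IsAlgClosed K] [CharZero K] {p : ℕ} (hp : 0 < p) (x Q : K)
    (hx : x ≠ Q ^ p) (n : ℕ) (hn : 1 ≤ n) :
    ((Polynomial.nthRoots p x).map fun y => (y - Q)⁻¹ ^ n).sum / p =
      ∑ m ∈ Icc 1 n, dworkCoeff p Q m n * (x - Q ^ p)⁻¹ ^ m := by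
  classical
  have hp0 : (p : K) ≠ 0 := Nat.cast_ne_zero.mpr hp.ne'
  set s := Polynomial.nthRoots p x with hs
  set t : PowerSeries K := PowerSeries.C Q + PowerSeries.X with ht
  set h : PowerSeries K := t ^ p - PowerSeries.C (Q ^ p) with hh
  have hc : x - Q ^ p ≠ 0 := sub_ne_zero.mpr hx
  set c := (x - Q ^ p)⁻¹ with hcdef
  have hmem : ∀ y ∈ s, y - Q ≠ 0 := by
    intro y hy
    rw [hs, Polynomial.mem_nthRoots hp] at hy
    refine sub_ne_zero.mpr ?_
    rintro rfl
    exact hx hy.symm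
  have hprod : (s.map fun y => Polynomial.X - Polynomial.C y).prod =
      Polynomial.X ^ p - Polynomial.C x := by
    have := (IsAlgClosed.splits (Polynomial.X ^ p - Polynomial.C x)).eq_prod_roots_of_monic
      (Polynomial.monic_X_pow_sub_C x hp.ne')
    rw [hs, Polynomial.nthRoots, ← this]
  have hder := congrArg Polynomial.derivative hprod
  rw [Polynomial.derivative_prod] at hder
  simp only [Polynomial.derivative_X, mul_one, Polynomial.derivative_sub,
    Polynomial.derivative_C, sub_zero, Polynomial.derivative_X_pow] at hder
  have hder' := congrArg (Polynomial.aeval t) hder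
  set iv : K → PowerSeries K := fun y => PowerSeries.mk fun n => (y - Q)⁻¹ ^ (n + 1) with hiv
  have hivm : ∀ y ∈ s, Polynomial.aeval t (Polynomial.X - Polynomial.C y) * iv y = -1 := by
    intro y hy
    have hy' := hmem y hy
    have e : Polynomial.aeval t (Polynomial.X - Polynomial.C y) =
        PowerSeries.X - PowerSeries.C (y - Q) := by
      rw [map_sub, Polynomial.aeval_X, Polynomial.aeval_C, ht, PowerSeries.algebraMap_apply]
      simp only [Algebra.algebraMap_self, RingHom.id_apply, map_sub]
      ring
    rw [e, sub_mul]
    ext m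
    rw [map_sub, PowerSeries.coeff_C_mul]
    cases m with
    | zero => simp [hiv, hy']
    | succ m =>
      rw [PowerSeries.coeff_succ_X_mul]
      simp only [hiv, PowerSeries.coeff_mk]
      rw [pow_succ _ (m + 1), mul_comm (y - Q), mul_assoc, inv_mul_cancel₀ hy', mul_one, sub_self]
      simp [PowerSeries.coeff_one]
  have hlhs : Polynomial.aeval t (Multiset.map (fun i => (Multiset.map
      (fun y => Polynomial.X - Polynomial.C y) (s.erase i)).prod) s).sum =
      -(Polynomial.aeval t (Polynomial.X ^ p - Polynomial.C x) * (s.map iv).sum) := by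
    rw [map_multiset_sum, Multiset.map_map, ← Multiset.sum_map_mul_left, ← Multiset.sum_map_neg',
      Multiset.map_map]
    congr 1
    refine Multiset.map_congr rfl fun y hy => ?_
    simp only [Function.comp]
    rw [← hprod, ← Multiset.cons_erase hy, Multiset.map_cons, Multiset.prod_cons, map_mul,
      Multiset.cons_erase hy]
    linear_combination ((Polynomial.aeval t) (Multiset.map
      (fun y => Polynomial.X - Polynomial.C y) (s.erase y)).prod) * hivm y hy
  rw [hlhs] at hder'
  have hg : Polynomial.aeval t (Polynomial.X ^ p - Polynomial.C x) =
      h - PowerSeries.C (x - Q ^ p) := by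
    rw [map_sub, map_pow, Polynomial.aeval_X, Polynomial.aeval_C, hh,
      PowerSeries.algebraMap_apply]
    simp only [Algebra.algebraMap_self, RingHom.id_apply, map_sub]
    ring
  have hr : Polynomial.aeval t ((Polynomial.C (p : K) * Polynomial.X ^ (p - 1))) =
      PowerSeries.C (p : K) * t ^ (p - 1) := by
    rw [map_mul, map_pow, Polynomial.aeval_X, Polynomial.aeval_C, PowerSeries.algebraMap_apply]
    rfl
  rw [hg, hr] at hder'
  set geo : PowerSeries K := ∑ m ∈ range n, PowerSeries.C (c ^ (m + 1)) * h ^ m with hgeo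
  have hgeo' : (PowerSeries.C (x - Q ^ p) - h) * geo = 1 - (PowerSeries.C c * h) ^ n := by
    have h1 := mul_neg_geom_sum (PowerSeries.C c * h) n
    have h2 : PowerSeries.C (x - Q ^ p) * PowerSeries.C c = 1 := by
      rw [← map_mul, hcdef, mul_inv_cancel₀ hc, map_one]
    have h3 : geo = PowerSeries.C c * ∑ i ∈ range n, (PowerSeries.C c * h) ^ i := by
      rw [hgeo, mul_sum]
      refine sum_congr rfl fun m _ => ?_
      rw [mul_pow, ← mul_assoc, ← pow_succ', map_pow]
    rw [h3, ← h1]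
    linear_combination (∑ i ∈ range n, (PowerSeries.C c * h) ^ i) * h2
  have hfin : (s.map iv).sum = PowerSeries.C (p : K) * t ^ (p - 1) * geo +
      (PowerSeries.C c * h) ^ n * (s.map iv).sum := by
    linear_combination (-(s.map iv).sum) * hgeo' + geo * hder'
  have hcoef := congrArg (PowerSeries.coeff (n - 1)) hfin
  have hz : PowerSeries.coeff (n - 1) ((PowerSeries.C c * h) ^ n * (s.map iv).sum) = 0 := by
    have h1 : (PowerSeries.X : PowerSeries K) ^ n ∣ (PowerSeries.C c * h) ^ n * (s.map iv).sum :=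
      Dvd.dvd.mul_right (pow_dvd_pow_of_dvd (Dvd.dvd.mul_left (X_dvd_shift p Q) _) _) _
    exact PowerSeries.X_pow_dvd_iff.mp h1 (n - 1) (by omega)
  rw [map_add, hz, add_zero, map_multiset_sum, Multiset.map_map] at hcoef
  have e1 : (Multiset.map ((PowerSeries.coeff (n - 1)) ∘ iv) s) =
      s.map fun y => (y - Q)⁻¹ ^ n := by
    refine Multiset.map_congr rfl fun y _ => ?_
    simp only [Function.comp, hiv, PowerSeries.coeff_mk]
    rw [Nat.sub_add_cancel hn]
  rw [e1] at hcoef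
  rw [hcoef, mul_assoc, PowerSeries.coeff_C_mul, mul_div_cancel_left₀ _ hp0, hgeo, mul_sum,
    map_sum, ← Finset.Ico_add_one_right_eq_Icc, Finset.sum_Ico_eq_sum_range, Nat.add_sub_cancel]
  refine sum_congr rfl fun m _ => ?_
  rw [dworkCoeff, add_comm 1 m, Nat.add_sub_cancel, mul_left_comm, PowerSeries.coeff_C_mul,
    mul_comm]

/-- The coefficient of `X_j ^ m` in `U_p (X_j ^ n)`. -/
def uCoeff (p : ℕ) (Q : Fin ℓ → K) (j : Fin ℓ) (m n : ℕ) : K :=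
  if j.val = 0 then (if n = p * m then 1 else 0)
  else if m = 0 then 0 else dworkCoeff p (Q j) m n

theorem uCoeff_of_lt {p : ℕ} (hp : 0 < p) (Q : Fin ℓ → K) {j : Fin ℓ} {m n : ℕ}
    (hn : 1 ≤ n ∨ j.val = 0) (h : n < m) : uCoeff p Q j m n = 0 := by
  unfold uCoeff
  split_ifs with h1 h2 h3
  · have := Nat.le_mul_of_pos_left m hp
    omega
  · rfl
  · rfl
  · exact dworkCoeff_of_lt p (Q j) (by omega) h

theorem sum_nthRoots_poleParam_pow [IsAlgClosed K] [CharZero K] {p : ℕ} (hp : 0 < p) {x : K}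
    {Q : Fin ℓ → K} (j : Fin ℓ) (hx : j.val ≠ 0 → x ≠ Q j ^ p) (n : ℕ)
    (hn : 1 ≤ n ∨ j.val = 0) (M : ℕ) (hM : n < M) :
    ((Polynomial.nthRoots p x).map fun y => poleParam Q j y ^ n).sum / p =
      ∑ m ∈ range M, uCoeff p Q j m n * poleParam (fun i => Q i ^ p) j x ^ m := by
  by_cases hj : j.val = 0
  · simp only [poleParam, uCoeff, if_pos hj]
    rw [sum_nthRoots_pow hp]
    split_ifs with h
    · obtain ⟨m, rfl⟩ := h
      rw [Nat.mul_div_cancel_left m hp, sum_eq_single m]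
      · simp
      · intro i _ hi
        rw [if_neg, zero_mul]
        intro h
        exact hi (Nat.eq_of_mul_eq_mul_left hp h).symm
      · intro h
        have := Nat.le_mul_of_pos_left m hp
        exact absurd (mem_range.mpr (by omega)) h
    · symm
      refine sum_eq_zero fun m _ => ?_
      rw [if_neg, zero_mul]
      rintro rfl
      exact h (dvd_mul_right _ _)
  · have hn1 : 1 ≤ n := by tauto
    simp only [poleParam, if_neg hj]
    rw [sum_nthRoots_inv_pow hp x (Q j) (hx hj) n hn1]
    have hsub : Icc 1 n ⊆ range M := fun i hi => by
      rw [mem_Icc] at hi; rw [mem_range]; omega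
    rw [← sum_subset hsub]
    · refine sum_congr rfl fun m hm => ?_
      rw [mem_Icc] at hm
      rw [uCoeff, if_neg hj, if_neg (by omega)]
    · intro m _ hm
      rw [mem_Icc] at hm
      by_cases hm0 : m = 0
      · rw [uCoeff, if_neg hj, if_pos hm0, zero_mul]
      · rw [uCoeff_of_lt hp Q hn (by omega), zero_mul]

theorem multiset_sum_map_sum {α ι : Type*} (s : Multiset α) (t : Finset ι) (f : ι → α → K) :
    (s.map fun y => ∑ i ∈ t, f i y).sum = ∑ i ∈ t, (s.map (f i)).sum := by
  induction s using Multiset.induction_on with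
  | empty => simp
  | cons a s ih => simp [ih, sum_add_distrib]

/-- The coefficient of `X_j ^ m` in `U_p (∏ X_i ^ w_i)`. -/
def rowCoeff (p : ℕ) (Q : Fin ℓ → K) (w : Fin ℓ → ℕ) (j : Fin ℓ) (m : ℕ) : K :=
  ∑ n ∈ range (w j + 1), uCoeff p Q j m n * pfCoeff Q w j n

theorem rowCoeff_eq_sum_range {p : ℕ} (Q : Fin ℓ → K) (w : Fin ℓ → ℕ) (j : Fin ℓ) (m : ℕ) {M : ℕ}
    (hM : w j < M) :
    rowCoeff p Q w j m = ∑ n ∈ range M, uCoeff p Q j m n * pfCoeff Q w j n := by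
  unfold rowCoeff
  refine sum_subset (range_subset_range.mpr hM) fun n _ hn => ?_
  rw [mem_range] at hn
  rw [pfCoeff_of_lt Q (by omega), mul_zero]

theorem rowCoeff_of_lt {p : ℕ} (hp : 0 < p) (Q : Fin ℓ → K) {w : Fin ℓ → ℕ} {j : Fin ℓ} {m : ℕ}
    (h : w j < m) : rowCoeff p Q w j m = 0 := by
  refine sum_eq_zero fun n hn => ?_
  rw [mem_range] at hn
  by_cases hb : 1 ≤ n ∨ j.val = 0
  · rw [uCoeff_of_lt hp Q hb (by omega), zero_mul]
  · rw [pfCoeff_of_not hb, mul_zero]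

theorem rowCoeff_of_not {p : ℕ} (Q : Fin ℓ → K) {w : Fin ℓ → ℕ} {j : Fin ℓ} {m : ℕ}
    (h : ¬ (1 ≤ m ∨ j.val = 0)) : rowCoeff p Q w j m = 0 := by
  refine sum_eq_zero fun n _ => ?_
  rw [uCoeff, if_neg (by tauto), if_pos (by omega), zero_mul]

theorem sum_nthRoots_prod_poleParam_pow [IsAlgClosed K] [CharZero K] {p : ℕ} (hp : 0 < p)
    (hℓ : 1 ≤ ℓ) {x : K} {Q : Fin ℓ → K}
    (hQ : ∀ i j : Fin ℓ, i.val ≠ 0 → j.val ≠ 0 → Q i = Q j → i = j)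
    (hx : ∀ j : Fin ℓ, j.val ≠ 0 → x ≠ Q j ^ p) (w : Fin ℓ → ℕ) (M : ℕ) (hM : ∀ j, w j < M) :
    ((Polynomial.nthRoots p x).map fun y => ∏ j, poleParam Q j y ^ w j).sum / p =
      ∑ j, ∑ m ∈ range M, rowCoeff p Q w j m * poleParam (fun i => Q i ^ p) j x ^ m := by
  have h1 : ((Polynomial.nthRoots p x).map fun y => ∏ j, poleParam Q j y ^ w j) =
      (Polynomial.nthRoots p x).map fun y =>
        ∑ j, ∑ n ∈ range M, pfCoeff Q w j n * poleParam Q j y ^ n := by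
    refine Multiset.map_congr rfl fun y hy => ?_
    rw [Polynomial.mem_nthRoots hp] at hy
    refine prod_poleParam_pow hℓ hQ (fun j hj => ?_) w M hM
    rintro rfl
    exact hx j hj hy.symm
  rw [h1, multiset_sum_map_sum, sum_div]
  refine sum_congr rfl fun j _ => ?_
  rw [multiset_sum_map_sum, sum_div]
  have h2 : ∀ n ∈ range M, (Multiset.map (fun y => pfCoeff Q w j n * poleParam Q j y ^ n)
      (Polynomial.nthRoots p x)).sum / p = ∑ m ∈ range M, pfCoeff Q w j n *
        (uCoeff p Q j m n * poleParam (fun i => Q i ^ p) j x ^ m) := by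
    intro n hn
    by_cases hb : 1 ≤ n ∨ j.val = 0
    · rw [Multiset.sum_map_mul_left, mul_div_assoc,
        sum_nthRoots_poleParam_pow hp j (hx j) n hb M (mem_range.mp hn), mul_sum]
    · simp [pfCoeff_of_not hb]
  rw [sum_congr rfl h2, sum_comm]
  refine sum_congr rfl fun m _ => ?_
  rw [rowCoeff_eq_sum_range Q w j m (hM j), sum_mul]
  exact sum_congr rfl fun n _ => by ring

end DworkOperator

/-! ### Integral elements of ultrametric fields -/

section Ultrametric

variable {K : Type*} [NormedField K] [IsUltrametricDist K]

theorem norm_sub_le_max' (x y : K) : ‖x - y‖ ≤ max ‖x‖ ‖y‖ := by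
  rw [sub_eq_add_neg, ← norm_neg y]
  exact IsUltrametricDist.norm_add_le_max _ _

theorem norm_sub_comm_lt {x y : K} {r : ℝ} (h : ‖x - y‖ < r) : ‖y - x‖ < r := by
  rwa [norm_sub_rev]

theorem norm_eq_of_norm_sub_lt {x y : K} (h : ‖x - y‖ < ‖y‖) : ‖x‖ = ‖y‖ := by
  have h1 := IsUltrametricDist.norm_add_eq_max_of_norm_ne_norm (ne_of_lt h)
  rwa [sub_add_cancel, max_eq_right h.le] at h1

variable (K) in
/-- The subring of elements of norm at most one. -/
def unitBall : Subring K where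
  carrier := {x | ‖x‖ ≤ 1}
  mul_mem' := by
    intro a b ha hb
    simp only [Set.mem_ofPred_eq] at *
    rw [norm_mul]
    exact mul_le_one₀ ha (norm_nonneg _) hb
  one_mem' := by simp
  add_mem' := by
    intro a b ha hb
    exact (IsUltrametricDist.norm_add_le_max _ _).trans (max_le ha hb)
  zero_mem' := by simp
  neg_mem' := by
    intro a ha
    simpa using ha

theorem mem_unitBall {x : K} : x ∈ unitBall K ↔ ‖x‖ ≤ 1 := Iff.rfl

theorem exists_integral_add_pow {p : ℕ} (hp : p.Prime) {x y : K} (hx : ‖x‖ ≤ 1) (hy : ‖y‖ ≤ 1)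
    (n : ℕ) : ∃ r : K, ‖r‖ ≤ 1 ∧ (x + y) ^ p ^ n = x ^ p ^ n + y ^ p ^ n + p * x * y * r := by
  obtain ⟨r, hr⟩ := exists_add_pow_prime_pow_eq hp (⟨x, hx⟩ : unitBall K) ⟨y, hy⟩ n
  refine ⟨r, r.2, ?_⟩
  have := congrArg (Subring.subtype (unitBall K)) hr
  simpa using this

/-- Expanding `((x - y) + y) ^ p ^ n` leaves `(x - y) ^ p ^ n` and a multiple of `p (x - y)`. This
contraction makes the iterates of Frobenius converge. -/
theorem norm_pow_sub_pow_le {p : ℕ} (hp : p.Prime) {x y : K} (hx : ‖x‖ ≤ 1) (hy : ‖y‖ ≤ 1)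
    {n : ℕ} (hn : 1 ≤ n) :
    ‖x ^ p ^ n - y ^ p ^ n‖ ≤ ‖x - y‖ * max ‖(p : K)‖ ‖x - y‖ := by
  have hxy : ‖x - y‖ ≤ 1 := (norm_sub_le_max' x y).trans (max_le hx hy)
  obtain ⟨r, hr, h⟩ := exists_integral_add_pow hp hxy hy n
  rw [sub_add_cancel] at h
  have e : x ^ p ^ n - y ^ p ^ n = (x - y) ^ p ^ n + p * (x - y) * y * r := by
    rw [h]; ring
  rw [e]
  refine (IsUltrametricDist.norm_add_le_max _ _).trans (max_le ?_ ?_)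
  · rw [norm_pow]
    have h2 : 2 ≤ p ^ n := hp.two_le.trans (Nat.le_self_pow (by omega) p)
    calc ‖x - y‖ ^ p ^ n ≤ ‖x - y‖ ^ 2 := pow_le_pow_of_le_one (norm_nonneg _) hxy h2
      _ = ‖x - y‖ * ‖x - y‖ := sq _
      _ ≤ _ := by gcongr; exact le_max_right _ _
  · rw [norm_mul, norm_mul, norm_mul]
    calc ‖(p : K)‖ * ‖x - y‖ * ‖y‖ * ‖r‖ ≤ ‖(p : K)‖ * ‖x - y‖ * 1 * 1 := by gcongr
      _ = ‖x - y‖ * ‖(p : K)‖ := by ring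
      _ ≤ _ := by gcongr; exact le_max_left _ _

theorem norm_pow_sub_pow_le_norm {p : ℕ} (hp : p.Prime) {x y : K} (hx : ‖x‖ ≤ 1) (hy : ‖y‖ ≤ 1)
    (n : ℕ) : ‖x ^ p ^ n - y ^ p ^ n‖ ≤ ‖x - y‖ := by
  rcases Nat.eq_zero_or_pos n with rfl | hn
  · simp
  · refine (norm_pow_sub_pow_le hp hx hy hn).trans ?_
    have hxy : ‖x - y‖ ≤ 1 := (norm_sub_le_max' x y).trans (max_le hx hy)
    exact mul_le_of_le_one_right (norm_nonneg _)
      (max_le (IsUltrametricDist.norm_natCast_le_one K p) hxy)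

theorem norm_pow_iterate_sub_le {p : ℕ} (hp : p.Prime) {x : K} {a : ℕ} {c : ℝ} (hc : 0 ≤ c)
    (hx : ‖x‖ ≤ 1) (h : ‖x ^ p ^ a - x‖ ≤ c) (m : ℕ) : ‖x ^ p ^ (a * m) - x‖ ≤ c := by
  induction m with
  | zero => simpa using hc
  | succ m ih =>
    have e : x ^ p ^ (a * (m + 1)) - x = ((x ^ p ^ (a * m)) ^ p ^ a - x ^ p ^ a) +
        (x ^ p ^ a - x) := by
      rw [← pow_mul, ← pow_add, mul_add, mul_one]; ring
    rw [e]
    refine (IsUltrametricDist.norm_add_le_max _ _).trans (max_le ?_ h)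
    refine (norm_pow_sub_pow_le_norm hp ?_ hx a).trans ih
    rw [norm_pow]
    exact pow_le_one₀ (norm_nonneg _) hx

/-- A residue class fixed by a power of Frobenius contains a fixed point of that power. -/
theorem exists_teichmuller_point [CompleteSpace K] {p : ℕ} (hp : p.Prime) (hpK : ‖(p : K)‖ < 1)
    {x : K} (hx : ‖x‖ ≤ 1) {a : ℕ} (ha : 1 ≤ a) (h : ‖x ^ p ^ a - x‖ < 1) :
    ∃ y : K, y ^ p ^ a = y ∧ ‖y - x‖ < 1 := by
  set c := max ‖(p : K)‖ ‖x ^ p ^ a - x‖ with hc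
  have hc1 : c < 1 := max_lt hpK h
  have hc0 : 0 ≤ c := le_max_of_le_left (norm_nonneg _)
  -- The iterates of the `a`-th power of Frobenius; consecutive differences shrink by the factor `c`
  -- at each step.
  set u : ℕ → K := fun n => x ^ p ^ (a * n) with hu
  have hu1 : ∀ n, ‖u n‖ ≤ 1 := fun n => by
    simp only [hu, norm_pow]
    exact pow_le_one₀ (norm_nonneg _) hx
  have husucc : ∀ n, u (n + 1) = (u n) ^ p ^ a := fun n => by
    simp only [hu]
    rw [← pow_mul, ← pow_add, mul_add, mul_one]
  have hstep : ∀ n, ‖u (n + 1) - u n‖ ≤ c * c ^ n := by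
    intro n
    induction n with
    | zero =>
      simp only [hu, mul_zero, pow_zero, pow_one, mul_one, zero_add]
      exact le_max_right _ _
    | succ n ih =>
      rw [husucc (n + 1), husucc n]
      have h1 := norm_pow_sub_pow_le hp (hu1 (n + 1)) (hu1 n) ha
      rw [husucc n] at h1 ih
      refine h1.trans ?_
      have h2 : max ‖(p : K)‖ ‖u n ^ p ^ a - u n‖ ≤ c := by
        refine max_le (le_max_left _ _) (ih.trans ?_)
        exact mul_le_of_le_one_right hc0 (pow_le_one₀ hc0 hc1.le)
      calc _ ≤ (c * c ^ n) * c := by gcongr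
        _ = c * c ^ (n + 1) := by ring
  have hcauchy : CauchySeq u := by
    refine cauchySeq_of_le_geometric c c hc1 fun n => ?_
    rw [dist_comm, dist_eq_norm]
    exact hstep n
  obtain ⟨y, hy⟩ := cauchySeq_tendsto_of_complete hcauchy
  refine ⟨y, ?_, ?_⟩
  · have h1 : Filter.Tendsto (fun n => u (n + 1)) Filter.atTop (nhds y) :=
      hy.comp (Filter.tendsto_add_atTop_nat 1)
    have h2 : Filter.Tendsto (fun n => u (n + 1)) Filter.atTop (nhds (y ^ p ^ a)) := by
      simp_rw [husucc]
      exact hy.pow _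
    exact tendsto_nhds_unique h2 h1
  · have h1 : ∀ n, ‖u n - x‖ ≤ c := by
      intro n
      induction n with
      | zero => simp [hu, hc0]
      | succ n ih =>
        have e : u (n + 1) - x = (u (n + 1) - u n) + (u n - x) := by ring
        rw [e]
        refine (IsUltrametricDist.norm_add_le_max _ _).trans (max_le ((hstep n).trans ?_) ih)
        exact mul_le_of_le_one_right hc0 (pow_le_one₀ hc0 hc1.le)
    have h2 : Filter.Tendsto (fun n => ‖u n - x‖) Filter.atTop (nhds ‖y - x‖) :=
      (hy.sub_const x).norm
    exact (le_of_tendsto' h2 h1).trans_lt hc1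

/-- Pairs `(x, y)` of integral elements in the same residue class such that `x` is fixed modulo `p`
by some power of Frobenius. -/
def frobPairs (K : Type*) [NormedField K] [IsUltrametricDist K] (p : ℕ) [hp : Fact p.Prime] :
    Subring (K × K) where
  carrier := {z | ‖z.1‖ ≤ 1 ∧ (∃ a : ℕ, 1 ≤ a ∧ ‖z.1 ^ p ^ a - z.1‖ ≤ ‖(p : K)‖) ∧
    ‖z.2‖ ≤ 1 ∧ ‖z.1 - z.2‖ < 1}
  mul_mem' := by
    rintro ⟨x, y⟩ ⟨x', y'⟩ ⟨h1, ⟨a, ha, h2⟩, h3, h4⟩ ⟨h1', ⟨a', ha', h2'⟩, h3', h4'⟩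
    -- The condition for `a` implies the one for every multiple of `a`, so `a * a'` serves both
    -- elements.
    refine ⟨(unitBall K).mul_mem h1 h1', ⟨a * a', Nat.mul_pos ha ha', ?_⟩,
      (unitBall K).mul_mem h3 h3', ?_⟩
    · have g1 := norm_pow_iterate_sub_le hp.out (norm_nonneg _) h1 h2 a'
      have g2 := norm_pow_iterate_sub_le hp.out (norm_nonneg _) h1' h2' a
      rw [mul_comm a' a] at g2
      simp only [Prod.mk_mul_mk]
      rw [mul_pow]
      have e : x ^ p ^ (a * a') * x' ^ p ^ (a * a') - x * x' =
          (x ^ p ^ (a * a') - x) * x' ^ p ^ (a * a') + x * (x' ^ p ^ (a * a') - x') := by ring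
      rw [e]
      refine (IsUltrametricDist.norm_add_le_max _ _).trans (max_le ?_ ?_)
      · rw [norm_mul, norm_pow]
        exact (mul_le_of_le_one_right (norm_nonneg _) (pow_le_one₀ (norm_nonneg _) h1')).trans g1
      · rw [norm_mul]
        exact (mul_le_of_le_one_left (norm_nonneg _) h1).trans g2
    · simp only [Prod.mk_mul_mk] at *
      have e : x * x' - y * y' = (x - y) * x' + y * (x' - y') := by ring
      rw [e]
      refine (IsUltrametricDist.norm_add_le_max _ _).trans_lt (max_lt ?_ ?_)
      · rw [norm_mul]
        exact (mul_le_of_le_one_right (norm_nonneg _) h1').trans_lt h4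
      · rw [norm_mul]
        exact (mul_le_of_le_one_left (norm_nonneg _) h3).trans_lt h4'
  one_mem' := ⟨by simp, ⟨1, le_rfl, by simp⟩, by simp, by simp⟩
  add_mem' := by
    rintro ⟨x, y⟩ ⟨x', y'⟩ ⟨h1, ⟨a, ha, h2⟩, h3, h4⟩ ⟨h1', ⟨a', ha', h2'⟩, h3', h4'⟩
    refine ⟨(unitBall K).add_mem h1 h1', ⟨a * a', Nat.mul_pos ha ha', ?_⟩,
      (unitBall K).add_mem h3 h3', ?_⟩
    · have g1 := norm_pow_iterate_sub_le hp.out (norm_nonneg _) h1 h2 a'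
      have g2 := norm_pow_iterate_sub_le hp.out (norm_nonneg _) h1' h2' a
      rw [mul_comm a' a] at g2
      simp only [Prod.mk_add_mk] at *
      -- Powers of Frobenius are additive modulo `p`; this is why the condition is imposed modulo
      -- `p` and not as an equality.
      obtain ⟨r, hr, h⟩ := exists_integral_add_pow hp.out h1 h1' (a * a')
      rw [h]
      have e : x ^ p ^ (a * a') + x' ^ p ^ (a * a') + p * x * x' * r - (x + x') =
          ((x ^ p ^ (a * a') - x) + (x' ^ p ^ (a * a') - x')) + p * x * x' * r := by ring
      rw [e]
      refine (IsUltrametricDist.norm_add_le_max _ _).trans (max_le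
        ((IsUltrametricDist.norm_add_le_max _ _).trans (max_le g1 g2)) ?_)
      rw [norm_mul, norm_mul, norm_mul]
      calc ‖(p : K)‖ * ‖x‖ * ‖x'‖ * ‖r‖ ≤ ‖(p : K)‖ * 1 * 1 * 1 := by gcongr
        _ = ‖(p : K)‖ := by ring
    · simp only [Prod.mk_add_mk] at *
      have e : x + x' - (y + y') = (x - y) + (x' - y') := by ring
      rw [e]
      exact (IsUltrametricDist.norm_add_le_max _ _).trans_lt (max_lt h4 h4')
  zero_mem' := ⟨by simp, ⟨1, le_rfl, by simp [hp.out.ne_zero]⟩, by simp, by simp⟩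
  neg_mem' := by
    rintro ⟨x, y⟩ ⟨h1, ⟨a, ha, h2⟩, h3, h4⟩
    refine ⟨by simpa using h1, ⟨a, ha, ?_⟩, by simpa using h3, ?_⟩
    · simp only [Prod.neg_mk] at *
      rcases hp.out.eq_two_or_odd' with h | h
      · subst h
        have ha' : Even (2 ^ a) := (even_two.pow_of_ne_zero (by omega))
        have e : (-x) ^ 2 ^ a - -x = (x ^ 2 ^ a - x) + (2 : ℕ) * x := by
          rw [ha'.neg_pow]; push_cast; ring
        rw [e]
        refine (IsUltrametricDist.norm_add_le_max _ _).trans (max_le h2 ?_)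
        rw [norm_mul]
        exact mul_le_of_le_one_right (norm_nonneg _) h1
      · have e : (-x) ^ p ^ a - -x = -(x ^ p ^ a - x) := by
          rw [(h.pow : Odd (p ^ a)).neg_pow]; ring
        rw [e, norm_neg]
        exact h2
    · simp only [Prod.neg_mk] at *
      rw [neg_sub_neg]
      exact norm_sub_comm_lt h4

/-! ### Congruent pairs: the dichotomy between units and multiples of `p`, and inverses -/

section FrobPairs

variable {p : ℕ} [hp : Fact p.Prime]

theorem mem_frobPairs {x y : K} : (x, y) ∈ frobPairs K p ↔ ‖x‖ ≤ 1 ∧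
    (∃ a : ℕ, 1 ≤ a ∧ ‖x ^ p ^ a - x‖ ≤ ‖(p : K)‖) ∧ ‖y‖ ≤ 1 ∧ ‖x - y‖ < 1 := Iff.rfl

theorem frobPairs_norm_le {x y : K} (h : (x, y) ∈ frobPairs K p) : ‖x‖ ≤ 1 := h.1

theorem frobPairs_norm_eq_one {x y : K} (h : (x, y) ∈ frobPairs K p) (hy : ‖y‖ = 1) :
    ‖x‖ = 1 := by
  rw [← hy]
  exact norm_eq_of_norm_sub_lt (by rw [hy]; exact h.2.2.2)

/-- An element fixed modulo `p` by a power of Frobenius is a unit or divisible by `p`. -/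
theorem frobPairs_norm_le_of_lt {x y : K} (h : (x, y) ∈ frobPairs K p) (hx : ‖x‖ < 1) :
    ‖x‖ ≤ ‖(p : K)‖ := by
  obtain ⟨-, ⟨a, ha, h2⟩, -, -⟩ := h
  simp only at h2
  -- For `‖p‖ < ‖x‖ < 1` the power `x ^ p ^ a` is strictly smaller than `x`, so its difference from
  -- `x` would have norm `‖x‖ > ‖p‖`.
  by_contra! hlt
  have h0 : 0 < ‖x‖ := (norm_nonneg _).trans_lt hlt
  have h3 : ‖x‖ ≤ max ‖x ^ p ^ a‖ ‖x ^ p ^ a - x‖ := by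
    have := norm_sub_le_max' (x ^ p ^ a) (x ^ p ^ a - x)
    rwa [sub_sub_cancel] at this
  rcases le_max_iff.mp h3 with h4 | h4
  · rw [norm_pow] at h4
    have h5 : ‖x‖ ^ p ^ a < ‖x‖ := by
      have : ‖x‖ ^ p ^ a ≤ ‖x‖ ^ 2 := pow_le_pow_of_le_one h0.le hx.le
        (hp.out.two_le.trans (Nat.le_self_pow (by omega) p))
      nlinarith
    linarith
  · linarith

theorem frobPairs_inv {x y : K} (h : (x, y) ∈ frobPairs K p) (hy : ‖y‖ = 1) :
    (x⁻¹, y⁻¹) ∈ frobPairs K p := by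
  have hx := frobPairs_norm_eq_one h hy
  obtain ⟨h1, ⟨a, ha, h2⟩, h3, h4⟩ := h
  simp only at h1 h2 h3 h4
  have hx0 : x ≠ 0 := norm_ne_zero_iff.mp (by rw [hx]; norm_num)
  have hy0 : y ≠ 0 := norm_ne_zero_iff.mp (by rw [hy]; norm_num)
  refine ⟨by simp [hx], ⟨a, ha, ?_⟩, by simp [hy], ?_⟩
  · simp only
    have e : x⁻¹ ^ p ^ a - x⁻¹ = -(x ^ p ^ a - x) * (x⁻¹ ^ p ^ a * x⁻¹) := by
      rw [inv_pow]
      field_simp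
      ring
    rw [e, norm_mul, norm_neg, norm_mul, norm_pow, norm_inv, hx]
    simpa using h2
  · simp only
    have e : x⁻¹ - y⁻¹ = -(x - y) * (x⁻¹ * y⁻¹) := by
      field_simp
      ring
    rw [e, norm_mul, norm_neg, norm_mul, norm_inv, norm_inv, hx, hy]
    simpa using h4

theorem frobPairs_natCast (n : ℕ) : ((n : K), (n : K)) ∈ frobPairs K p := by
  have := natCast_mem (frobPairs K p) n
  exact this

theorem norm_intCast_eq_one (hpK : ‖(p : K)‖ < 1) {n : ℤ} (hn : ¬ (p : ℤ) ∣ n) :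
    ‖(n : K)‖ = 1 := by
  refine le_antisymm (IsUltrametricDist.norm_intCast_le_one K n) ?_
  have hc : IsCoprime (p : ℤ) n :=
    (Nat.prime_iff_prime_int.mp hp.out).irreducible.coprime_iff_not_dvd.mpr hn
  obtain ⟨u, v, huv⟩ := hc
  have h1 : ((u : K) * (p : K) + v * n) = 1 := by exact_mod_cast congrArg (Int.cast (R := K)) huv
  by_contra! hlt
  have h2 : ‖(u : K) * (p : K) + v * n‖ < 1 := by
    refine (IsUltrametricDist.norm_add_le_max _ _).trans_lt (max_lt ?_ ?_)
    · rw [norm_mul]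
      exact (mul_le_of_le_one_left (norm_nonneg _)
        (IsUltrametricDist.norm_intCast_le_one K u)).trans_lt hpK
    · rw [norm_mul]
      exact (mul_le_of_le_one_left (norm_nonneg _)
        (IsUltrametricDist.norm_intCast_le_one K v)).trans_lt hlt
  rw [h1, norm_one] at h2
  exact lt_irrefl _ h2

theorem norm_natCast_eq_one (hpK : ‖(p : K)‖ < 1) {n : ℕ} (hn : ¬ p ∣ n) : ‖(n : K)‖ = 1 := by
  have := norm_intCast_eq_one (K := K) hpK (n := n) (by exact_mod_cast hn)
  simpa using this

end FrobPairs

/-! ### Reductions of algebraic numbers at large primes -/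

theorem norm_le_one_of_isIntegral {x : K} (h : IsIntegral ℤ x) : ‖x‖ ≤ 1 := by
  obtain ⟨f, hf, hx⟩ := h
  by_contra! hlt
  have h1 : x ^ f.natDegree = -∑ i ∈ range f.natDegree, (f.coeff i : K) * x ^ i := by
    rw [Polynomial.eval₂_eq_sum_range, sum_range_succ, hf.coeff_natDegree, map_one, one_mul] at hx
    rw [eq_neg_iff_add_eq_zero, add_comm]
    simpa using hx
  have h0 : f.natDegree ≠ 0 := by
    intro h0
    rw [h0] at h1
    simp at h1
  have h2 : ‖x ^ f.natDegree‖ ≤ ‖x‖ ^ (f.natDegree - 1) := by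
    rw [h1, norm_neg]
    refine IsUltrametricDist.norm_sum_le_of_forall_le_of_nonneg (by positivity) fun i hi => ?_
    rw [mem_range] at hi
    rw [norm_mul, norm_pow]
    refine (mul_le_of_le_one_left (by positivity)
      (IsUltrametricDist.norm_intCast_le_one K _)).trans ?_
    exact pow_le_pow_right₀ hlt.le (by omega)
  rw [norm_pow] at h2
  have h3 : ‖x‖ ^ (f.natDegree - 1) < ‖x‖ ^ f.natDegree := pow_lt_pow_right₀ hlt (by omega)
  linarith

/-- Some nonzero integer multiple `y α` is integral, and `y` is a unit as soon as `p > |y|`. The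
residue of `ι α` is then algebraic over the prime field, so it lies in a finite field, on which a
power of Frobenius is the identity. The bound depends on `α` alone; the uniformity in the embedding
comes from here. -/
theorem exists_norm_le_one (α : QBar) : ∃ N : ℕ, ∀ (p : ℕ) [Fact p.Prime], N ≤ p →
    ∀ (K : Type) [NormedField K] [IsUltrametricDist K], ‖(p : K)‖ < 1 → ∀ ι : QBar →+* K,
      ‖ι α‖ ≤ 1 ∧ ∃ a : ℕ, 1 ≤ a ∧ ‖ι α ^ p ^ a - ι α‖ < 1 := by
  have halg : IsAlgebraic ℤ α := by
    rw [IsFractionRing.isAlgebraic_iff ℤ ℚ QBar]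
    exact (AlgebraicClosure.isAlgebraic ℚ).isAlgebraic α
  obtain ⟨y, hy0, hy⟩ := halg.exists_integral_multiple
  refine ⟨y.natAbs + 1, fun p hp hN K _ _ hpK ι => ?_⟩
  have hpy : ¬ (p : ℤ) ∣ y := fun h => by
    have := Int.natAbs_le_of_dvd_ne_zero h hy0
    simp at this
    omega
  have hy1 := norm_intCast_eq_one (K := K) hpK hpy
  have hint : IsIntegral ℤ ((y : K) * ι α) := by
    have := hy.map (ι.toIntAlgHom)
    simpa using this
  have hα : ‖ι α‖ ≤ 1 := by
    have := norm_le_one_of_isIntegral hint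
    rwa [norm_mul, hy1, one_mul] at this
  refine ⟨hα, ?_⟩
  set O := (NormedField.valuation (K := K)).valuationSubring with hO
  have hmem : ∀ x : K, x ∈ O ↔ ‖x‖ ≤ 1 := by
    intro x
    rw [hO, Valuation.mem_valuationSubring_iff, NormedField.valuation_apply]
    exact Iff.rfl
  set k := IsLocalRing.ResidueField O with hk
  have hres : ∀ x : O, IsLocalRing.residue O x = 0 ↔ ‖(x : K)‖ < 1 := by
    intro x
    rw [IsLocalRing.residue_eq_zero_iff, IsLocalRing.mem_maximalIdeal, mem_nonunits_iff]
    have hx1 : ‖(x : K)‖ ≤ 1 := (hmem _).mp x.2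
    constructor
    · intro h
      refine lt_of_le_of_ne hx1 fun h1 => h ?_
      have hx0 : (x : K) ≠ 0 := norm_ne_zero_iff.mp (by rw [h1]; norm_num)
      refine IsUnit.of_mul_eq_one ⟨(x : K)⁻¹, (hmem _).mpr (by simp [h1])⟩ ?_
      ext
      simp [hx0]
    · rintro h ⟨u, hu⟩
      have h1 : (x : K) * ((u⁻¹ : Oˣ) : O) = 1 := by
        rw [← hu]
        exact_mod_cast congrArg (Subtype.val) u.mul_inv
      have h2 : ‖(((u⁻¹ : Oˣ) : O) : K)‖ ≤ 1 := (hmem _).mp (Subtype.prop _)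
      have h3 := congrArg norm h1
      rw [norm_mul, norm_one] at h3
      nlinarith [norm_nonneg (x : K)]
  have hchar : CharP k p := by
    rw [CharP.charP_iff_prime_eq_zero hp.out]
    have := (hres (p : O)).mpr (by simpa using hpK)
    simpa using this
  let _ : Algebra (ZMod p) k := ZMod.algebra k p
  set b : O := ⟨ι α, (hmem _).mpr hα⟩ with hb
  have hbint : IsIntegral ℤ ((y : O) * b) := by
    have h1 : IsIntegral ℤ (algebraMap O K ((y : O) * b)) := by
      have e : algebraMap O K ((y : O) * b) = (y : K) * ι α := by
        rw [map_mul, map_intCast]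
        rfl
      rw [e]
      exact hint
    exact (isIntegral_algebraMap_iff (FaithfulSMul.algebraMap_injective O K)).mp h1
  have h2 : IsIntegral (ZMod p) ((y : k) * IsLocalRing.residue O b) := by
    obtain ⟨f, hf, hf0⟩ := hbint
    refine ⟨f.map (Int.castRingHom (ZMod p)), hf.map _, ?_⟩
    rw [Polynomial.eval₂_map]
    have h1 := congrArg (IsLocalRing.residue O) hf0
    rw [Polynomial.hom_eval₂, map_zero, map_mul, map_intCast] at h1
    rw [← h1]
    congr 1
    exact Subsingleton.elim _ _
  have hyk : (y : k) ≠ 0 := by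
    intro h
    have h1 := (hres (y : O)).mp (by simpa using h)
    rw [show ((y : O) : K) = (y : K) by simp, hy1] at h1
    exact lt_irrefl _ h1
  have h3 : IsIntegral (ZMod p) (IsLocalRing.residue O b) := by
    have e : IsLocalRing.residue O b = algebraMap (ZMod p) k ((y : ZMod p)⁻¹) *
        ((y : k) * IsLocalRing.residue O b) := by
      rw [map_inv₀, map_intCast, inv_mul_cancel_left₀ hyk]
    rw [e]
    exact isIntegral_algebraMap.mul h2
  have hfd := IntermediateField.adjoin.finiteDimensional h3
  set F := IntermediateField.adjoin (ZMod p) {IsLocalRing.residue O b} with hF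
  have hfin : Finite F := Module.finite_of_finite (ZMod p)
  have _ := Fintype.ofFinite F
  refine ⟨Module.finrank (ZMod p) F, Module.finrank_pos, ?_⟩
  have h4 := FiniteField.pow_card (⟨IsLocalRing.residue O b,
    IntermediateField.mem_adjoin_simple_self _ _⟩ : F)
  rw [Module.card_eq_pow_finrank (K := ZMod p), ZMod.card] at h4
  have h5 := congrArg (Subtype.val) h4
  rw [← sub_eq_zero] at h5
  have h6 := (hres (b ^ p ^ Module.finrank (ZMod p) F - b)).mp (by
    rw [map_sub, map_pow]
    exact h5)
  exact h6

theorem exists_norm_eq_one {α : QBar} (hα : α ≠ 0) : ∃ N : ℕ, ∀ (p : ℕ) [Fact p.Prime], N ≤ p →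
    ∀ (K : Type) [NormedField K] [IsUltrametricDist K], ‖(p : K)‖ < 1 → ∀ ι : QBar →+* K,
      ‖ι α‖ = 1 := by
  obtain ⟨N, hN⟩ := exists_norm_le_one α
  obtain ⟨N', hN'⟩ := exists_norm_le_one α⁻¹
  refine ⟨max N N', fun p _ hp K _ _ hpK ι => le_antisymm ?_ ?_⟩
  · exact (hN p (le_of_max_le_left hp) K hpK ι).1
  · have h := (hN' p (le_of_max_le_right hp) K hpK ι).1
    rw [map_inv₀, norm_inv] at h
    have h0 : 0 < ‖ι α‖ := norm_pos_iff.mpr ((map_ne_zero ι).mpr hα)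
    exact (inv_le_one₀ h0).mp h

end Ultrametric

/-! ### The Artin–Hasse exponential -/

section ArtinHasse

/-- Both series solve the same linear differential equation, so their quotient has derivative zero.
-/
theorem powerSeries_eq_of_derivative_eq_mul {f g h : PowerSeries ℚ}
    (hf : PowerSeries.derivative ℚ f = f * h) (hg : PowerSeries.derivative ℚ g = g * h)
    (hf0 : PowerSeries.constantCoeff f = 1) (hg0 : PowerSeries.constantCoeff g = 1) : f = g := by
  have hgi : g * g⁻¹ = 1 := PowerSeries.mul_inv_cancel g (by rw [hg0]; exact one_ne_zero)
  have h1 : f * g⁻¹ = 1 := by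
    apply PowerSeries.derivative.ext
    · rw [Derivation.leibniz, PowerSeries.derivative_inv', hf, hg, PowerSeries.derivative_one,
        smul_eq_mul, smul_eq_mul]
      linear_combination (-f * g⁻¹ * h) * hgi
    · rw [map_mul, PowerSeries.constantCoeff_inv, hf0, hg0]
      simp
  calc f = f * g⁻¹ * g := by rw [mul_assoc, mul_comm g⁻¹, hgi, mul_one]
    _ = g := by rw [h1, one_mul]

variable (p : ℕ) [hp : Fact p.Prime]

theorem constantCoeff_artinHasseLog : PowerSeries.constantCoeff (artinHasseLog p) = 0 := by
  rw [← PowerSeries.coeff_zero_eq_constantCoeff_apply, artinHasseLog, PowerSeries.coeff_mk,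
    if_neg]
  rintro ⟨i, hi⟩
  exact (pow_ne_zero i hp.out.ne_zero) hi.symm

theorem hasSubst_artinHasseLog : PowerSeries.HasSubst (artinHasseLog p) :=
  PowerSeries.HasSubst.of_constantCoeff_zero' (constantCoeff_artinHasseLog p)

theorem derivative_artinHasse : PowerSeries.derivative ℚ (artinHasse p) =
    artinHasse p * PowerSeries.derivative ℚ (artinHasseLog p) := by
  rw [artinHasse, PowerSeries.derivative_subst (hasSubst_artinHasseLog p),
    PowerSeries.derivative_exp]

theorem constantCoeff_artinHasse : PowerSeries.constantCoeff (artinHasse p) = 1 := by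
  have h := PowerSeries.constantCoeff_subst_eq_zero (constantCoeff_artinHasseLog p)
    (PowerSeries.exp ℚ - 1) (by simp)
  have e : PowerSeries.exp ℚ = (PowerSeries.exp ℚ - 1) + 1 := by ring
  rw [artinHasse, e, PowerSeries.subst_add (hasSubst_artinHasseLog p), map_add]
  have h1 : (1 : PowerSeries ℚ).subst (artinHasseLog p) = (1 : PowerSeries ℚ) := by
    rw [← PowerSeries.coe_substAlgHom (hasSubst_artinHasseLog p), map_one]
  rw [h1, map_one]
  have h2 : PowerSeries.constantCoeff ((PowerSeries.exp ℚ - 1).subst (artinHasseLog p)) = 0 := h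
  rw [h2, zero_add]

open Classical in
theorem coeff_derivative_artinHasseLog (n : ℕ) :
    PowerSeries.coeff n (PowerSeries.derivative ℚ (artinHasseLog p)) =
      if ∃ i : ℕ, n + 1 = p ^ i then 1 else 0 := by
  rw [PowerSeries.coeff_derivative, artinHasseLog, PowerSeries.coeff_mk]
  split_ifs
  · have : (n : ℚ) + 1 ≠ 0 := by positivity
    push_cast
    field_simp
  · ring

/-- In `E' = E L'` the factor `L'` has constant term `1` and no terms in degrees `1` to `p - 2`, so
below degree `p` the recurrence is that of the exponential. -/
theorem coeff_artinHasse_of_lt {n : ℕ} (hn : n < p) :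
    PowerSeries.coeff n (artinHasse p) = 1 / (n.factorial : ℚ) := by
  classical
  induction n with
  | zero => simp [constantCoeff_artinHasse]
  | succ n ih =>
    have h := congrArg (PowerSeries.coeff n) (derivative_artinHasse p)
    rw [PowerSeries.coeff_derivative, PowerSeries.coeff_mul,
      Finset.sum_eq_single (n, 0)] at h
    · rw [coeff_derivative_artinHasseLog, if_pos ⟨0, by simp⟩, mul_one, ih (by omega)] at h
      rw [Nat.factorial_succ]
      push_cast
      have h0 : (n.factorial : ℚ) ≠ 0 := by exact_mod_cast Nat.factorial_ne_zero n
      have h1 : (n : ℚ) + 1 ≠ 0 := by positivity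
      rw [eq_div_iff (by positivity)]
      rw [eq_div_iff h0] at h
      linear_combination h
    · rintro ⟨a, b⟩ hab hne
      rw [Finset.HasAntidiagonal.mem_antidiagonal] at hab
      simp only at hab
      rw [coeff_derivative_artinHasseLog, if_neg, mul_zero]
      rintro ⟨i, hi⟩
      have hb : b ≠ 0 := by
        rintro rfl
        exact hne (by simp_all)
      rcases Nat.eq_zero_or_pos i with rfl | hi0
      · simp at hi
        omega
      · have : p ≤ p ^ i := Nat.le_self_pow (by omega) p
        omega
    · intro h
      exact absurd (Finset.HasAntidiagonal.mem_antidiagonal.mpr (by simp)) h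

theorem derivative_expand (f : PowerSeries ℚ) :
    PowerSeries.derivative ℚ (PowerSeries.expand p hp.out.ne_zero f) =
      PowerSeries.expand p hp.out.ne_zero (PowerSeries.derivative ℚ f) *
        ((p : PowerSeries ℚ) * PowerSeries.X ^ (p - 1)) := by
  rw [PowerSeries.expand_apply,
    PowerSeries.derivative_subst (PowerSeries.HasSubst.X_pow hp.out.ne_zero),
    PowerSeries.expand_apply, PowerSeries.derivative_pow, PowerSeries.derivative_X, mul_one]

/-- The derivative of `p L(X) = p X + L(X^p)`, divided by `p`. -/
theorem derivative_artinHasseLog_eq : PowerSeries.derivative ℚ (artinHasseLog p) =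
    1 + PowerSeries.expand p hp.out.ne_zero (PowerSeries.derivative ℚ (artinHasseLog p)) *
      PowerSeries.X ^ (p - 1) := by
  classical
  have hp1 := hp.out.one_lt
  ext n
  rw [map_add, PowerSeries.coeff_mul_X_pow', coeff_derivative_artinHasseLog,
    PowerSeries.coeff_one]
  by_cases hn : p - 1 ≤ n
  · rw [if_pos hn, if_neg (by omega : n ≠ 0), zero_add, PowerSeries.coeff_expand]
    by_cases hd : p ∣ n - (p - 1)
    · obtain ⟨m, hm⟩ := hd
      rw [hm, if_pos (dvd_mul_right p m), Nat.mul_div_cancel_left m hp.out.pos,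
        coeff_derivative_artinHasseLog]
      have hnm : n + 1 = p * (m + 1) := by
        rw [mul_add, ← hm]; omega
      congr 1
      rw [hnm]
      apply propext
      constructor
      · rintro ⟨i, hi⟩
        rcases Nat.eq_zero_or_pos i with rfl | hi0
        · rw [pow_zero] at hi
          have := Nat.eq_one_of_mul_eq_one_right hi
          omega
        · refine ⟨i - 1, Nat.eq_of_mul_eq_mul_left hp.out.pos ?_⟩
          rw [hi, ← pow_succ']
          congr 1
          omega
      · rintro ⟨i, hi⟩
        exact ⟨i + 1, by rw [hi, pow_succ']⟩
    · rw [if_neg hd, if_neg]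
      rintro ⟨i, hi⟩
      rcases Nat.eq_zero_or_pos i with rfl | hi0
      · rw [pow_zero] at hi
        omega
      · apply hd
        have h1 : p ∣ n + 1 := hi ▸ dvd_pow_self p (by omega)
        have h2 : n - (p - 1) = n + 1 - p := by omega
        rw [h2]
        exact Nat.dvd_sub h1 dvd_rfl
  · rw [if_neg hn, add_zero]
    congr 1
    apply propext
    constructor
    · rintro ⟨i, hi⟩
      rcases Nat.eq_zero_or_pos i with rfl | hi0
      · simpa using hi
      · have : p ≤ p ^ i := Nat.le_self_pow (by omega) p
        omega
    · rintro rfl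
      exact ⟨0, by simp⟩

/-- The functional equation of the Artin–Hasse exponential. -/
theorem artinHasse_pow : artinHasse p ^ p =
    PowerSeries.expand p hp.out.ne_zero (artinHasse p) * PowerSeries.exp ℚ ^ p := by
  apply powerSeries_eq_of_derivative_eq_mul
    (h := (p : PowerSeries ℚ) * PowerSeries.derivative ℚ (artinHasseLog p))
  · rw [PowerSeries.derivative_pow, derivative_artinHasse]
    have e : artinHasse p ^ p = artinHasse p ^ (p - 1) * artinHasse p := by
      rw [← pow_succ, Nat.sub_add_cancel hp.out.one_le]
    rw [e]
    ring
  · rw [Derivation.leibniz, derivative_expand, derivative_artinHasse, map_mul,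
      PowerSeries.derivative_pow, PowerSeries.derivative_exp, smul_eq_mul, smul_eq_mul]
    have e : PowerSeries.exp ℚ ^ p = PowerSeries.exp ℚ ^ (p - 1) * PowerSeries.exp ℚ := by
      rw [← pow_succ, Nat.sub_add_cancel hp.out.one_le]
    have e2 := derivative_artinHasseLog_eq p
    set D := PowerSeries.expand p hp.out.ne_zero (PowerSeries.derivative ℚ (artinHasseLog p))
    rw [e2, e]
    ring
  · rw [map_pow, constantCoeff_artinHasse, one_pow]
  · rw [map_mul, map_pow, PowerSeries.constantCoeff_expand, constantCoeff_artinHasse,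
      PowerSeries.constantCoeff_exp, one_pow, one_mul]

/-- By Legendre, `(p - 1) v_p(b!) < b`, hence `v_p(b!) ≤ b - 1`. -/
theorem norm_pow_div_factorial_le {b : ℕ} (hb : b ≠ 0) :
    ‖((p : ℚ_[p]) ^ b / (b.factorial : ℚ_[p]))‖ ≤ ‖(p : ℚ_[p])‖ := by
  obtain ⟨v, c, hc, hv⟩ := Nat.exists_eq_pow_mul_and_not_dvd (Nat.factorial_ne_zero b) p
    hp.out.ne_one
  have hval : padicValNat p b.factorial = v := by
    rw [hv, padicValNat.mul (pow_ne_zero _ hp.out.ne_zero) (by rintro rfl; simp at hc),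
      padicValNat.prime_pow, padicValNat.eq_zero_of_not_dvd hc, add_zero]
  have h1 := sub_one_mul_padicValNat_factorial_lt_of_ne_zero p hb
  rw [hval] at h1
  have h2 : v < b := by
    have := hp.out.two_le
    have h3 : 1 * v ≤ (p - 1) * v := Nat.mul_le_mul_right v (by omega)
    omega
  have hc1 : ‖(c : ℚ_[p])‖ = 1 := by
    rw [Padic.norm_natCast_eq_one_iff]
    exact (Nat.Prime.coprime_iff_not_dvd hp.out).mpr hc
  have hp1 : ‖(p : ℚ_[p])‖ ≤ 1 := IsUltrametricDist.norm_natCast_le_one _ p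
  have hp0 : 0 < ‖(p : ℚ_[p])‖ := norm_pos_iff.mpr (by exact_mod_cast hp.out.ne_zero)
  rw [hv]
  push_cast
  rw [norm_div, norm_mul, hc1, mul_one, norm_pow, norm_pow, div_le_iff₀ (by positivity),
    ← pow_succ']
  exact pow_le_pow_of_le_one hp0.le hp1 h2

/-- Dwork's lemma for the Artin–Hasse exponential: its coefficients are `p`-integral. -/
theorem norm_coeff_artinHasse_le (n : ℕ) :
    ‖((PowerSeries.coeff n (artinHasse p) : ℚ) : ℚ_[p])‖ ≤ 1 := by
  induction n using Nat.strong_induction_on with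
  | _ n ih =>
  rcases Nat.eq_zero_or_pos n with rfl | hn
  · simp [constantCoeff_artinHasse]
  set u : ℕ → ℚ := fun m => PowerSeries.coeff m (artinHasse p) with hu
  have hu0 : u 0 = 1 := by simp [hu, constantCoeff_artinHasse]
  obtain ⟨v, hvu⟩ : ∃ v : ℕ → ℤ_[p], ∀ m < n, ((v m : ℤ_[p]) : ℚ_[p]) = u m := by
    have h : ∀ m, ∃ w : ℤ_[p], m < n → (w : ℚ_[p]) = u m := by
      intro m
      by_cases hm : m < n
      · exact ⟨⟨u m, ih m hm⟩, fun _ => rfl⟩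
      · exact ⟨0, fun h => absurd h hm⟩
    choose v hv using h
    exact ⟨v, hv⟩
  -- The truncation of `E` below degree `n`, whose coefficients are `p`-integral by induction.
  set T : Polynomial ℤ_[p] := ∑ m ∈ range n, Polynomial.monomial m (v m) with hT
  have hTc : ∀ m, T.coeff m = if m < n then v m else 0 := by
    intro m
    rw [hT, Polynomial.finsetSum_coeff]
    simp only [Polynomial.coeff_monomial]
    rw [Finset.sum_ite_eq']
    simp
  -- Frobenius modulo `p`: `T(X)^p ≡ T(X^p)`.
  have hTp : ∃ s : ℤ_[p], (T ^ p).coeff n = (Polynomial.expand ℤ_[p] p T).coeff n + p * s := by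
    have h1 : (T ^ p - Polynomial.expand ℤ_[p] p T).map PadicInt.toZMod = 0 := by
      rw [Polynomial.map_sub, Polynomial.map_pow, Polynomial.map_expand, ZMod.expand_card, sub_self]
    have h2 := congrArg (fun q => Polynomial.coeff q n) h1
    simp only [Polynomial.coeff_map, Polynomial.coeff_zero] at h2
    have h3 : (T ^ p - Polynomial.expand ℤ_[p] p T).coeff n ∈ RingHom.ker (PadicInt.toZMod (p := p)) := h2
    rw [PadicInt.ker_toZMod, PadicInt.maximalIdeal_eq_span_p, Ideal.mem_span_singleton] at h3
    obtain ⟨s, hs⟩ := h3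
    refine ⟨s, ?_⟩
    rw [Polynomial.coeff_sub] at hs
    linear_combination hs
  obtain ⟨s, hs⟩ := hTp
  set φ : ℚ →+* ℚ_[p] := Rat.castHom ℚ_[p] with hφ
  set E : PowerSeries ℚ_[p] := PowerSeries.map φ (artinHasse p) with hE
  have hEc : ∀ m, PowerSeries.coeff m E = u m := fun m => by
    rw [hE, PowerSeries.coeff_map]; rfl
  set A : PowerSeries ℚ_[p] := ((T.map PadicInt.Coe.ringHom : Polynomial ℚ_[p]) :
    PowerSeries ℚ_[p]) with hA
  have hAc : ∀ m, PowerSeries.coeff m A = if m < n then (u m : ℚ_[p]) else 0 := by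
    intro m
    rw [hA, Polynomial.coeff_coe, Polynomial.coeff_map, hTc]
    split_ifs with h
    · exact hvu m h
    · simp
  have hB : (PowerSeries.X : PowerSeries ℚ_[p]) ^ n ∣ E - A := by
    rw [PowerSeries.X_pow_dvd_iff]
    intro m hm
    rw [map_sub, hEc, hAc, if_pos hm, sub_self]
  obtain ⟨B, hB⟩ := hB
  have hB0 : PowerSeries.constantCoeff B = u n := by
    have h1 := congrArg (PowerSeries.coeff n) hB
    rw [map_sub, hEc, hAc, if_neg (lt_irrefl n), sub_zero, PowerSeries.coeff_X_pow_mul',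
      if_pos le_rfl, Nat.sub_self] at h1
    rw [h1, PowerSeries.coeff_zero_eq_constantCoeff_apply]
  have hA0 : PowerSeries.constantCoeff A = 1 := by
    rw [← PowerSeries.coeff_zero_eq_constantCoeff_apply, hAc, if_pos hn, hu0, Rat.cast_one]
  obtain ⟨k, hk⟩ := Polynomial.powAddExpansion A (PowerSeries.X ^ n * B) p
  -- Write `E = A + X^n B` with `B(0) = u n` and `A(0) = 1`. In degree `n` only the linear term of
  -- the binomial expansion of `E^p` adds to `A^p`, and it adds `p * u n`; integrality of `u n`
  -- therefore amounts to divisibility by `p` of the rest.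
  have hlhs : PowerSeries.coeff n (E ^ p) = PowerSeries.coeff n (A ^ p) + p * u n := by
    have e : E = A + PowerSeries.X ^ n * B := by rw [← hB]; ring
    rw [e, hk]
    have e2 : A ^ p + (p : PowerSeries ℚ_[p]) * A ^ (p - 1) * (PowerSeries.X ^ n * B) +
        k * (PowerSeries.X ^ n * B) ^ 2 = A ^ p + PowerSeries.X ^ n *
        ((p : PowerSeries ℚ_[p]) * A ^ (p - 1) * B + k * B ^ 2 * PowerSeries.X ^ n) := by ring
    rw [e2, map_add, PowerSeries.coeff_X_pow_mul', if_pos le_rfl, Nat.sub_self,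
      PowerSeries.coeff_zero_eq_constantCoeff_apply]
    simp only [map_add, map_mul, map_pow, map_natCast, hA0, hB0, PowerSeries.constantCoeff_X]
    rw [zero_pow (by omega)]
    ring
  have hAp : PowerSeries.coeff n (A ^ p) = (((T ^ p).coeff n : ℤ_[p]) : ℚ_[p]) := by
    rw [hA, ← Polynomial.coe_pow, Polynomial.coeff_coe, ← Polynomial.map_pow,
      Polynomial.coeff_map]
    rfl
  have hfe : E ^ p = PowerSeries.expand p hp.out.ne_zero E * PowerSeries.exp ℚ_[p] ^ p := by
    have h1 := congrArg (PowerSeries.map φ) (artinHasse_pow p)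
    rwa [map_pow, map_mul, map_pow, PowerSeries.map_expand, PowerSeries.map_exp] at h1
  have hexpc : PowerSeries.coeff n (PowerSeries.expand p hp.out.ne_zero E) =
      (((Polynomial.expand ℤ_[p] p T).coeff n : ℤ_[p]) : ℚ_[p]) := by
    rw [PowerSeries.coeff_expand, Polynomial.coeff_expand hp.out.pos]
    split_ifs with h
    · have hlt : n / p < n := Nat.div_lt_self hn hp.out.one_lt
      rw [hEc, hTc, if_pos hlt, hvu _ hlt]
    · simp
  -- The functional equation reads `E(X)^p = E(X^p) exp(pX)`, and the coefficients of `exp(pX)` in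
  -- positive degree are divisible by `p`. The factor `E(X^p)` enters only through coefficients
  -- already known to be integral.
  have hrhs : ‖PowerSeries.coeff n (E ^ p) -
      PowerSeries.coeff n (PowerSeries.expand p hp.out.ne_zero E)‖ ≤ ‖(p : ℚ_[p])‖ := by
    rw [hfe, PowerSeries.exp_pow_eq_rescale_exp, PowerSeries.coeff_mul,
      ← Finset.sum_erase_add _ _ (Finset.HasAntidiagonal.mem_antidiagonal.mpr (add_zero n) :
        (n, 0) ∈ Finset.HasAntidiagonal.antidiagonal n)]
    simp only [PowerSeries.coeff_rescale, PowerSeries.coeff_exp, pow_zero, Nat.factorial_zero,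
      Nat.cast_one, div_one, map_one, mul_one]
    rw [add_sub_cancel_right]
    refine IsUltrametricDist.norm_sum_le_of_forall_le_of_nonneg (norm_nonneg _) ?_
    rintro ⟨a, b⟩ hab
    rw [Finset.mem_erase, Finset.HasAntidiagonal.mem_antidiagonal] at hab
    simp only at hab ⊢
    have hb : b ≠ 0 := by
      rintro rfl
      exact hab.1 (by rw [← hab.2, add_zero])
    rw [norm_mul]
    have h1 : ‖PowerSeries.coeff a (PowerSeries.expand p hp.out.ne_zero E)‖ ≤ 1 := by
      rw [PowerSeries.coeff_expand]
      split_ifs with h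
      · rw [hEc]
        exact ih _ (lt_of_le_of_lt (Nat.div_le_self a p) (by omega))
      · simp
    have h2 : (p : ℚ_[p]) ^ b * (algebraMap ℚ ℚ_[p]) (1 / (b.factorial : ℚ)) =
        (p : ℚ_[p]) ^ b / (b.factorial : ℚ_[p]) := by
      simp [div_eq_mul_inv]
    rw [h2]
    exact (mul_le_of_le_one_left (norm_nonneg _) h1).trans (norm_pow_div_factorial_le p hb)
  have hp0 : 0 < ‖(p : ℚ_[p])‖ := norm_pos_iff.mpr (by exact_mod_cast hp.out.ne_zero)
  have hfinal : (p : ℚ_[p]) * u n = (PowerSeries.coeff n (E ^ p) -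
      PowerSeries.coeff n (PowerSeries.expand p hp.out.ne_zero E)) - p * (s : ℚ_[p]) := by
    rw [hlhs, hAp, hexpc, hs]
    push_cast
    ring
  have h3 : ‖(p : ℚ_[p]) * u n‖ ≤ ‖(p : ℚ_[p])‖ := by
    rw [hfinal]
    refine (norm_sub_le_max' _ _).trans (max_le hrhs ?_)
    rw [norm_mul]
    exact mul_le_of_le_one_right (norm_nonneg _) s.2
  rw [norm_mul] at h3
  exact le_of_mul_le_mul_left (by simpa using h3) hp0

end ArtinHasse

open Filter

/-! ### Uniqueness of expansions in powers of local parameters -/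

section Uniqueness

variable {K : Type*} [NormedField K] [IsUltrametricDist K]

/-- A term strictly dominating all the others would fix the norm of every partial sum containing it.
-/
theorem norm_le_of_hasSum_zero {ι : Type*} {f : ι → K} (hf : HasSum f 0) {b : ι} {ε : ℝ}
    (hε : 0 ≤ ε) (h : ∀ i, i ≠ b → ‖f i‖ ≤ ε) : ‖f b‖ ≤ ε := by
  classical
  by_contra! hlt
  have h0 : 0 < ‖f b‖ := hε.trans_lt hlt
  have h1 : ∀ s : Finset ι, b ∈ s → ‖∑ i ∈ s, f i‖ = ‖f b‖ := by
    intro s hs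
    apply norm_eq_of_norm_sub_lt
    rw [← Finset.sum_erase_add _ _ hs, add_sub_cancel_right]
    refine (IsUltrametricDist.norm_sum_le_of_forall_le_of_nonneg hε fun i hi => ?_).trans_lt hlt
    exact h i (Finset.ne_of_mem_erase hi)
  have h2 : Tendsto (fun s : Finset ι => ‖∑ i ∈ s, f i‖) atTop (nhds ‖(0 : K)‖) := hf.norm
  have h3 : Tendsto (fun s : Finset ι => ‖∑ i ∈ s, f i‖) atTop (nhds ‖f b‖) := by
    refine tendsto_const_nhds.congr' ?_
    filter_upwards [eventually_ge_atTop {b}] with s hs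
    exact (h1 s (Finset.singleton_subset_iff.mp hs)).symm
  have h4 := tendsto_nhds_unique h2 h3
  rw [norm_zero] at h4
  linarith

theorem sum_pow_primitiveRoot {ω : K} {M : ℕ} (hω : IsPrimitiveRoot ω M) (n : ℕ) :
    ∑ i ∈ range M, (ω ^ i) ^ n = if M ∣ n then (M : K) else 0 := by
  have e : ∀ i ∈ range M, (ω ^ i) ^ n = (ω ^ n) ^ i := fun i _ => by
    rw [← pow_mul, ← pow_mul, mul_comm]
  rw [sum_congr rfl e]
  split_ifs with h
  · rw [(hω.pow_eq_one_iff_dvd n).mpr h]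
    simp
  · have hne : ω ^ n ≠ 1 := fun h1 => h ((hω.pow_eq_one_iff_dvd n).mp h1)
    rw [geom_sum_eq hne, ← pow_mul, mul_comm n M, pow_mul, hω.pow_eq_one, one_pow, sub_self,
      zero_div]

/-- Summation over the roots of unity keeps only the monomials of degree `t` with `M ∣ n + t`. As `n
≥ 1`, these have `t ≥ M - n` and carry the factor `π ^ t`. -/
theorem norm_sum_primitiveRoot_eval_le {ω π : K} {M n : ℕ} (hω : IsPrimitiveRoot ω M)
    (hn : 1 ≤ n) (hπ : ‖π‖ ≤ 1) (R : Polynomial (unitBall K)) :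
    ‖∑ i ∈ range M, (ω ^ i) ^ n * Polynomial.eval₂ (unitBall K).subtype (π * ω ^ i) R‖ ≤
      ‖π‖ ^ (M - n) := by
  simp_rw [Polynomial.eval₂_eq_sum_range, mul_sum]
  rw [sum_comm]
  refine IsUltrametricDist.norm_sum_le_of_forall_le_of_nonneg (by positivity) fun t _ => ?_
  have e : ∀ i ∈ range M, (ω ^ i) ^ n * ((unitBall K).subtype (R.coeff t) * (π * ω ^ i) ^ t) =
      ((unitBall K).subtype (R.coeff t) * π ^ t) * (ω ^ i) ^ (n + t) := fun i _ => by
    rw [mul_pow, pow_add]; ring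
  rw [sum_congr rfl e, ← mul_sum, sum_pow_primitiveRoot hω, norm_mul, norm_mul, norm_pow]
  have h1 : ‖(unitBall K).subtype (R.coeff t)‖ ≤ 1 := (R.coeff t).2
  split_ifs with h
  · have h2 : M - n ≤ t := by
      have := Nat.le_of_dvd (by omega) h
      omega
    calc ‖(unitBall K).subtype (R.coeff t)‖ * ‖π‖ ^ t * ‖(M : K)‖ ≤ 1 * ‖π‖ ^ (M - n) * 1 := by
          gcongr ?_ * ?_ * ?_
          · exact pow_le_pow_of_le_one (norm_nonneg _) hπ h2
          · exact IsUltrametricDist.norm_natCast_le_one K M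
      _ = _ := by ring
  · rw [norm_zero, mul_zero]
    positivity

variable {ℓ : ℕ}

/-- The point of the circle around the `j`-th pole with local coordinate `z`. -/
def circlePoint (Q : Fin ℓ → K) (j : Fin ℓ) (z : K) : K := if j.val = 0 then z⁻¹ else Q j + z

theorem poleParam_circlePoint_self (Q : Fin ℓ → K) (j : Fin ℓ) (z : K) :
    poleParam Q j (circlePoint Q j z) = z⁻¹ := by
  unfold poleParam circlePoint
  split_ifs <;> simp

/-- On the finite set `z ^ M = π ^ M` the geometric series of a parameter at another pole closes up:
`1/(1 - Qz)` equals `∑_{t<M} (Qz)^t` divided by the constant `1 - Q^M π^M`, a unit. Being a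
polynomial with integral coefficients there, it is controlled by averages over roots of unity. -/
theorem exists_polynomial_poleParam {Q : Fin ℓ → K} (hQ1 : ∀ j : Fin ℓ, j.val ≠ 0 → ‖Q j‖ ≤ 1)
    (hQ : ∀ i j : Fin ℓ, i.val ≠ 0 → j.val ≠ 0 → i ≠ j → ‖Q i - Q j‖ = 1) {π : K}
    (hπ : ‖π‖ < 1) (hπ0 : π ≠ 0) {M : ℕ} (hM : 1 ≤ M) {i j : Fin ℓ} (hij : i ≠ j) :
    ∃ R : Polynomial (unitBall K), ∀ z : K, z ^ M = π ^ M →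
      poleParam Q i (circlePoint Q j z) = Polynomial.eval₂ (unitBall K).subtype z R := by
  have hz0 : ∀ z : K, z ^ M = π ^ M → z ≠ 0 := by
    rintro z hz rfl
    rw [zero_pow (by omega)] at hz
    exact pow_ne_zero M hπ0 hz.symm
  have hz1 : ∀ z : K, z ^ M = π ^ M → ‖z‖ < 1 := by
    intro z hz
    have h := congrArg norm hz
    rw [norm_pow, norm_pow] at h
    rwa [(pow_left_inj₀ (norm_nonneg _) (norm_nonneg _) (by omega : M ≠ 0)).mp h]
  have hsmall : ∀ c : K, ‖c‖ ≤ 1 → ‖c * π ^ M‖ < 1 := by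
    intro c hc
    rw [norm_mul, norm_pow]
    exact (mul_le_of_le_one_left (by positivity) hc).trans_lt
      (pow_lt_one₀ (norm_nonneg _) hπ (by omega))
  have hunit : ∀ a c : K, ‖a‖ = 1 → ‖c‖ ≤ 1 → ‖a - c * π ^ M‖ = 1 := by
    intro a c ha hc
    rw [← ha]
    apply norm_eq_of_norm_sub_lt
    rw [sub_sub_cancel_left, norm_neg, ha]
    exact hsmall c hc
  by_cases hj : j.val = 0
  · have hi : i.val ≠ 0 := fun h => hij (Fin.ext (h.trans hj.symm))
    have hden := hunit 1 (Q i ^ M) (by simp) (by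
      rw [norm_pow]; exact pow_le_one₀ (norm_nonneg _) (hQ1 i hi))
    have hden0 : (1 : K) - Q i ^ M * π ^ M ≠ 0 := norm_ne_zero_iff.mp (by rw [hden]; norm_num)
    refine ⟨Polynomial.C ⟨(1 - Q i ^ M * π ^ M)⁻¹, by rw [mem_unitBall, norm_inv, hden, inv_one]⟩ *
      (Polynomial.X * ∑ t ∈ range M, (Polynomial.C ⟨Q i, hQ1 i hi⟩ * Polynomial.X) ^ t),
      fun z hz => ?_⟩
    rw [Polynomial.eval₂_mul, Polynomial.eval₂_C, Polynomial.eval₂_mul, Polynomial.eval₂_X,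
      Polynomial.eval₂_finsetSum]
    simp only [Polynomial.eval₂_pow, Polynomial.eval₂_mul, Polynomial.eval₂_C, Polynomial.eval₂_X,
      Subring.subtype_apply]
    have hg := mul_neg_geom_sum (Q i * z) M
    rw [mul_pow, hz] at hg
    have hz' := hz0 z hz
    have h1 : 1 - Q i * z ≠ 0 := by
      intro h
      rw [h, zero_mul] at hg
      exact hden0 hg.symm
    rw [poleParam, if_neg hi, circlePoint, if_pos hj]
    have h2 : z⁻¹ - Q i = z⁻¹ * (1 - Q i * z) := by field_simp
    rw [h2, mul_inv, inv_inv]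
    have h3 : ∑ t ∈ range M, (Q i * z) ^ t = (1 - Q i * z)⁻¹ * (1 - Q i ^ M * π ^ M) := by
      rw [← hg, inv_mul_cancel_left₀ h1]
    rw [h3]
    field_simp
  by_cases hi : i.val = 0
  · refine ⟨Polynomial.C ⟨Q j, hQ1 j hj⟩ + Polynomial.X, fun z hz => ?_⟩
    rw [poleParam, if_pos hi, circlePoint, if_neg hj]
    simp
  · have ha := hQ j i hj hi (Ne.symm hij)
    set a := Q j - Q i with hadef
    have hden := hunit (a ^ M) ((-1) ^ M) (by rw [norm_pow, ha, one_pow]) (by simp)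
    have hden0 : a ^ M - (-1) ^ M * π ^ M ≠ 0 := norm_ne_zero_iff.mp (by rw [hden]; norm_num)
    refine ⟨Polynomial.C ⟨(a ^ M - (-1) ^ M * π ^ M)⁻¹, by
        rw [mem_unitBall, norm_inv, hden, inv_one]⟩ *
      ∑ t ∈ range M, Polynomial.C ⟨a, ha.le⟩ ^ t * (-Polynomial.X) ^ (M - 1 - t),
      fun z hz => ?_⟩
    rw [Polynomial.eval₂_mul, Polynomial.eval₂_C, Polynomial.eval₂_finsetSum]
    simp only [Polynomial.eval₂_pow, Polynomial.eval₂_mul, Polynomial.eval₂_C, Polynomial.eval₂_X,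
      Subring.subtype_apply, Polynomial.eval₂_neg]
    have hg := (Commute.all a (-z)).geom_sum₂_mul M
    rw [neg_pow, hz] at hg
    have h1 : a - -z ≠ 0 := by
      intro h
      rw [h, mul_zero] at hg
      exact hden0 hg.symm
    rw [poleParam, if_neg hi, circlePoint, if_neg hj]
    have h2 : Q j + z - Q i = a - -z := by rw [hadef]; ring
    rw [h2, ← hg]
    rw [← hg] at hden0
    have h4 : ∑ i ∈ range M, a ^ i * (-z) ^ (M - 1 - i) ≠ 0 := left_ne_zero_of_mul hden0
    rw [mul_inv, mul_comm, mul_inv_cancel_left₀ h4]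

theorem exists_norm_lt_one_ge [IsAlgClosed K] {c : K} (hc : ‖c‖ < 1) (hc0 : c ≠ 0) {r : ℝ}
    (hr : r < 1) : ∃ π : K, r ≤ ‖π‖ ∧ ‖π‖ < 1 ∧ π ≠ 0 := by
  obtain ⟨n, hn⟩ := exists_pow_lt_of_lt_one (norm_pos_iff.mpr hc0) hr
  have hn0 : n ≠ 0 := by
    rintro rfl
    rw [pow_zero] at hn
    linarith
  obtain ⟨π, hπ⟩ := IsAlgClosed.exists_pow_nat_eq c (Nat.pos_of_ne_zero hn0)
  have h1 : ‖π‖ ^ n = ‖c‖ := by rw [← norm_pow, hπ]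
  refine ⟨π, ?_, ?_, ?_⟩
  · by_contra! h
    have := pow_lt_pow_left₀ h (norm_nonneg _) hn0
    linarith
  · by_contra! h
    have := one_le_pow₀ h (n := n)
    linarith
  · rintro rfl
    rw [zero_pow hn0] at hπ
    exact hc0 hπ.symm

/-- The affinoid on which expansions are compared, over any normed field. -/
def poleAffinoid (Q : Fin ℓ → K) (r : ℝ) : Set K :=
  {x | ‖x‖ ≤ r⁻¹ ∧ ∀ j : Fin ℓ, j.val ≠ 0 → r ≤ ‖x - Q j‖}

theorem circlePoint_mem {Q : Fin ℓ → K} (hQ1 : ∀ j : Fin ℓ, j.val ≠ 0 → ‖Q j‖ ≤ 1)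
    (hQ : ∀ i j : Fin ℓ, i.val ≠ 0 → j.val ≠ 0 → i ≠ j → ‖Q i - Q j‖ = 1) {r : ℝ}
    (hr0 : 0 < r) (hr1 : r < 1) {z : K} (hz : r ≤ ‖z‖) (hz1 : ‖z‖ < 1) (j : Fin ℓ) :
    circlePoint Q j z ∈ poleAffinoid Q r := by
  have hr1' : 1 < r⁻¹ := (one_lt_inv₀ hr0).mpr hr1
  have hz0 : 0 < ‖z‖ := hr0.trans_le hz
  unfold circlePoint
  split_ifs with hj
  · have h1 : 1 < ‖z‖⁻¹ := (one_lt_inv₀ hz0).mpr hz1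
    refine ⟨?_, fun i hi => ?_⟩
    · rw [norm_inv]
      exact inv_anti₀ hr0 hz
    · have h2 : ‖z⁻¹ - Q i‖ = ‖z⁻¹‖ := by
        apply norm_eq_of_norm_sub_lt
        rw [sub_sub_cancel_left, norm_neg, norm_inv]
        exact (hQ1 i hi).trans_lt h1
      rw [h2, norm_inv]
      linarith
  · refine ⟨?_, fun i hi => ?_⟩
    · exact ((IsUltrametricDist.norm_add_le_max _ _).trans
        (max_le (hQ1 j hj) hz1.le)).trans hr1'.le
    · by_cases hij : i = j
      · subst hij
        rwa [add_sub_cancel_left]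
      · have h1 := hQ j i hj hi (Ne.symm hij)
        have h2 : ‖Q j + z - Q i‖ = ‖Q j - Q i‖ := by
          apply norm_eq_of_norm_sub_lt
          rw [h1]
          convert hz1 using 2
          ring
        rw [h2, h1]
        exact hr1.le

/-- The vanishing sum is evaluated at `M` equidistributed points of the circle of radius `‖π‖`
around the pole `j` and averaged against a character. This isolates the coefficient of `X_j ^ n`:
other powers of `X_j` cancel or lie in the tail, and the other poles contribute at most `B ‖π‖ ^ (M
- n)`. For large `M` everything else is below `ε`. The constant term is left for the end, when it is
the only surviving term. -/
theorem poleParam_expansion_unique [IsAlgClosed K] [CharZero K] {p : ℕ} [hp : Fact p.Prime]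
    (hpK : ‖(p : K)‖ < 1) {Q : Fin ℓ → K} (hQ1 : ∀ j : Fin ℓ, j.val ≠ 0 → ‖Q j‖ ≤ 1)
    (hQ : ∀ i j : Fin ℓ, i.val ≠ 0 → j.val ≠ 0 → i ≠ j → ‖Q i - Q j‖ = 1) {r : ℝ}
    (hr0 : 0 < r) (hr1 : r < 1) {c : BasisIdx ℓ → K}
    (hc : ∀ x ∈ poleAffinoid Q r,
      HasSum (fun b : BasisIdx ℓ => c b * poleParam Q b.1.1 x ^ b.1.2) 0) : c = 0 := by
  have hp0 : (p : K) ≠ 0 := Nat.cast_ne_zero.mpr hp.out.ne_zero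
  obtain ⟨π, hπr, hπ1, hπ0⟩ := exists_norm_lt_one_ge hpK hp0 hr1
  have hπpos : 0 < ‖π‖ := norm_pos_iff.mpr hπ0
  have hpow1 : ∀ n : ℕ, ‖π‖ ^ n ≤ 1 := fun n => pow_le_one₀ hπpos.le hπ1.le
  have htend : ∀ j : Fin ℓ, Tendsto (fun b : BasisIdx ℓ => c b *
      poleParam Q b.1.1 (circlePoint Q j π) ^ b.1.2) cofinite (nhds 0) := fun j =>
    (hc _ (circlePoint_mem hQ1 hQ hr0 hr1 hπr hπ1 j)).summable.tendsto_cofinite_zero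
  have hfin : ∀ (j : Fin ℓ) (ε : ℝ), 0 < ε → {b : BasisIdx ℓ | b.1.1 = j ∧
      ε ≤ ‖c b‖ * (‖π‖ ^ b.1.2)⁻¹}.Finite := by
    intro j ε hε
    have h1 := (htend j).eventually (Metric.ball_mem_nhds 0 hε)
    rw [Filter.eventually_cofinite] at h1
    refine h1.subset ?_
    rintro b ⟨hb, hle⟩
    simp only [Set.mem_ofPred_eq, dist_zero_right, not_lt]
    rw [← hb, poleParam_circlePoint_self, norm_mul, norm_pow, norm_inv, inv_pow]
    exact hle
  have hbdd : ∃ B : ℝ, 0 < B ∧ ∀ b : BasisIdx ℓ, ‖c b‖ ≤ B := by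
    have h1 : (⋃ j : Fin ℓ, {b : BasisIdx ℓ | b.1.1 = j ∧ 1 ≤ ‖c b‖ * (‖π‖ ^ b.1.2)⁻¹}).Finite :=
      Set.finite_iUnion fun j => hfin j 1 one_pos
    obtain ⟨B, hB⟩ := (h1.image fun b => ‖c b‖).bddAbove
    refine ⟨max B 1, lt_max_of_lt_right one_pos, fun b => ?_⟩
    by_cases hb : 1 ≤ ‖c b‖ * (‖π‖ ^ b.1.2)⁻¹
    · exact le_max_of_le_left (hB ⟨b, Set.mem_iUnion.mpr ⟨b.1.1, rfl, hb⟩, rfl⟩)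
    · push Not at hb
      refine le_max_of_le_right (le_trans ?_ hb.le)
      exact le_mul_of_one_le_right (norm_nonneg _)
        ((one_le_inv₀ (pow_pos hπpos _)).mpr (hpow1 _))
  obtain ⟨B, hB0, hB⟩ := hbdd
  have hmain : ∀ b : BasisIdx ℓ, 1 ≤ b.1.2 → c b = 0 := by
    intro b₀ hb₀
    set j := b₀.1.1 with hj
    set n := b₀.1.2 with hn
    suffices hε : ∀ ε : ℝ, 0 < ε → ‖c b₀‖ * (‖π‖ ^ n)⁻¹ ≤ ε by
      have h1 : ‖c b₀‖ * (‖π‖ ^ n)⁻¹ ≤ 0 := le_of_forall_pos_le_add fun ε hε0 => by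
        rw [zero_add]; exact hε ε hε0
      have h2 : ‖c b₀‖ ≤ 0 := by
        by_contra! h
        have : 0 < ‖c b₀‖ * (‖π‖ ^ n)⁻¹ := by positivity
        linarith
      exact norm_le_zero_iff.mp h2
    intro ε hε
    obtain ⟨N₁, hN₁⟩ : ∃ N₁ : ℕ, ∀ b : BasisIdx ℓ, b.1.1 = j → N₁ ≤ b.1.2 →
        ‖c b‖ * (‖π‖ ^ b.1.2)⁻¹ ≤ ε := by
      obtain ⟨N, hN⟩ := ((hfin j ε hε).image fun b => b.1.2).bddAbove
      refine ⟨N + 1, fun b hb hbn => ?_⟩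
      by_contra! hlt
      have := hN ⟨b, ⟨hb, hlt.le⟩, rfl⟩
      simp only at this
      omega
    obtain ⟨N₂, hN₂⟩ := exists_pow_lt_of_lt_one (div_pos hε hB0) hπ1
    -- Congruent to `1` modulo `p`, so that `M` is a unit. Exceeding `N₁` separates the powers of
    -- `X_j` before the tail; exceeding `n + N₂` makes the other poles negligible.
    set M := p * (n + N₁ + N₂) + 1 with hM
    have hMge : n + N₁ + N₂ ≤ M := by
      have := Nat.le_mul_of_pos_left (n + N₁ + N₂) hp.out.pos
      omega
    have hMn : n < M := by
      have := Nat.le_mul_of_pos_left (n + N₁ + N₂) hp.out.pos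
      omega
    have hM1 : ‖(M : K)‖ = 1 := by
      apply norm_natCast_eq_one hpK
      rw [hM]
      intro h
      have := (Nat.dvd_add_right (dvd_mul_right p _)).mp h
      exact hp.out.one_lt.ne' (Nat.dvd_one.mp this)
    have hMK : (M : K) ≠ 0 := norm_ne_zero_iff.mp (by rw [hM1]; norm_num)
    have _ : NeZero (M : K) := ⟨hMK⟩
    have _ : NeZero M := ⟨by omega⟩
    obtain ⟨ω, hω⟩ := HasEnoughRootsOfUnity.exists_primitiveRoot K M
    have hω1 : ‖ω‖ = 1 := by
      have h := congrArg norm hω.pow_eq_one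
      rw [norm_pow, norm_one] at h
      exact (pow_eq_one_iff_of_nonneg (norm_nonneg _) (by omega)).mp h
    have hzn : ∀ i, ‖π * ω ^ i‖ = ‖π‖ := fun i => by rw [norm_mul, norm_pow, hω1]; simp
    have hzM : ∀ i, (π * ω ^ i) ^ M = π ^ M := fun i => by
      rw [mul_pow, ← pow_mul, mul_comm i M, pow_mul, hω.pow_eq_one, one_pow, mul_one]
    set A : BasisIdx ℓ → K := fun b => ∑ i ∈ range M, (ω ^ i) ^ n *
      poleParam Q b.1.1 (circlePoint Q j (π * ω ^ i)) ^ b.1.2 with hA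
    have hsum : HasSum (fun b => c b * A b) 0 := by
      have h1 : HasSum (fun b : BasisIdx ℓ => ∑ i ∈ range M, (ω ^ i) ^ n *
          (c b * poleParam Q b.1.1 (circlePoint Q j (π * ω ^ i)) ^ b.1.2))
          (∑ i ∈ range M, (ω ^ i) ^ n * 0) :=
        hasSum_sum fun i _ => (hc _ (circlePoint_mem hQ1 hQ hr0 hr1 (by rwa [hzn])
          (by rwa [hzn]) j)).mul_left _
      simp only [mul_zero, sum_const_zero] at h1
      convert h1 using 2 with b
      rw [hA, mul_sum]
      exact sum_congr rfl fun i _ => by ring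
    have hAj : ∀ b : BasisIdx ℓ, b.1.1 = j → A b = (π ^ b.1.2)⁻¹ *
        ∑ i ∈ range M, (ω ^ i) ^ n * ((ω ^ i) ^ b.1.2)⁻¹ := by
      intro b hb
      simp only [hA]
      rw [hb, mul_sum]
      refine sum_congr rfl fun i _ => ?_
      rw [poleParam_circlePoint_self, inv_pow, mul_pow, mul_inv]
      ring
    have hω0 : ω ≠ 0 := hω.ne_zero (by omega)
    have hAb₀ : A b₀ = (π ^ n)⁻¹ * M := by
      rw [hAj b₀ rfl]
      congr 1
      rw [sum_congr rfl (g := fun _ => (1 : K)) fun i _ =>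
        mul_inv_cancel₀ (pow_ne_zero _ (pow_ne_zero _ hω0))]
      simp
    have hfinal := norm_le_of_hasSum_zero hsum hε.le (b := b₀) fun b hb => ?_
    · rw [hAb₀, norm_mul, norm_mul, norm_inv, norm_pow, hM1, mul_one] at hfinal
      exact hfinal
    by_cases hbj : b.1.1 = j
    · have hbn : b.1.2 ≠ n := fun h => hb (Subtype.ext (Prod.ext hbj h))
      rw [hAj b hbj]
      by_cases hge : N₁ ≤ b.1.2
      · refine le_trans ?_ (hN₁ b hbj hge)
        rw [norm_mul, norm_mul, norm_inv, norm_pow]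
        gcongr
        refine mul_le_of_le_one_right (by positivity) ?_
        refine IsUltrametricDist.norm_sum_le_of_forall_le_of_nonneg zero_le_one fun i _ => ?_
        simp [hω1]
      · have hz : ∑ i ∈ range M, (ω ^ i) ^ n * ((ω ^ i) ^ b.1.2)⁻¹ = 0 := by
          have e : ∀ i ∈ range M, (ω ^ i) ^ n * ((ω ^ i) ^ b.1.2)⁻¹ =
              (ω ^ i) ^ (n + (M - b.1.2)) := by
            intro i _
            rw [pow_add]
            congr 1
            apply inv_eq_of_mul_eq_one_right
            rw [← pow_add, Nat.add_sub_cancel' (by omega), ← pow_mul, mul_comm, pow_mul, hω.pow_eq_one, one_pow]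
          rw [sum_congr rfl e, sum_pow_primitiveRoot hω, if_neg]
          intro hd
          have h1 : M ∣ n + (M - b.1.2) := hd
          by_cases hlt : n < b.1.2
          · have := Nat.le_of_dvd (by omega) h1
            omega
          · have h2 : n + (M - b.1.2) = M + (n - b.1.2) := by omega
            rw [h2] at h1
            have h3 := (Nat.dvd_add_right dvd_rfl).mp h1
            have := Nat.le_of_dvd (by omega) h3
            omega
        rw [hz, mul_zero, mul_zero, norm_zero]
        exact hε.le
    · obtain ⟨R, hR⟩ := exists_polynomial_poleParam hQ1 hQ hπ1 hπ0 (by omega : 1 ≤ M) hbj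
      have h1 : ‖A b‖ ≤ ‖π‖ ^ (M - n) := by
        have h2 := norm_sum_primitiveRoot_eval_le hω hb₀ hπ1.le (R ^ b.1.2)
        convert h2 using 2
        simp only [hA]
        refine sum_congr rfl fun i _ => ?_
        rw [hR _ (hzM i), Polynomial.eval₂_pow]
      rw [norm_mul]
      calc ‖c b‖ * ‖A b‖ ≤ B * ‖π‖ ^ (M - n) := by gcongr; exact hB b
        _ ≤ B * ‖π‖ ^ N₂ := by
          gcongr B * ?_
          exact pow_le_pow_of_le_one hπpos.le hπ1.le (by omega)
        _ ≤ B * (ε / B) := by gcongr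
        _ = ε := by field_simp
  funext b
  by_cases hb : 1 ≤ b.1.2
  · exact hmain b hb
  · have hb0 : b.1.2 = 0 := by omega
    have h1 := hc _ (circlePoint_mem hQ1 hQ hr0 hr1 hπr hπ1 b.1.1)
    have h3 := hasSum_single (f := fun b' : BasisIdx ℓ => c b' *
      poleParam Q b'.1.1 (circlePoint Q b.1.1 π) ^ b'.1.2) b fun b' hb' => by
        by_cases hb1 : 1 ≤ b'.1.2
        · rw [hmain b' hb1, zero_mul]
        · exfalso
          apply hb'
          have e1 := b.2
          have e2 := b'.2
          refine Subtype.ext (Prod.ext (Fin.ext ?_) ?_) <;> omega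
    have h4 := h3.unique h1
    rwa [hb0, pow_zero, mul_one] at h4

end Uniqueness

/-! ### Expansion of products of series over multi-indices -/

section MultiIndex

theorem sum_piAntidiag_insert {σ R : Type*} [DecidableEq σ] [AddCommMonoid R] {i : σ}
    {s : Finset σ} (hi : i ∉ s) (n : ℕ) (f : (σ → ℕ) → R) :
    ∑ r ∈ piAntidiag (insert i s) n, f r =
      ∑ kl ∈ HasAntidiagonal.antidiagonal n, ∑ ρ ∈ piAntidiag s kl.2,
        f (ρ + Pi.single i kl.1) := by
  rw [← cons_eq_insert i s hi, piAntidiag_cons hi, sum_disjiUnion]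
  refine sum_congr rfl fun kl _ => ?_
  rw [sum_map]
  refine sum_congr rfl fun ρ _ => ?_
  rw [addRightEmbedding_apply]
  congr 2
  ext t
  rw [Pi.single_apply]

theorem prod_insert_piAntidiag {σ R : Type*} [DecidableEq σ] [CommMonoid R] {i : σ}
    {s : Finset σ} (hi : i ∉ s) (g : σ → ℕ → R) {n k : ℕ} {ρ : σ → ℕ} (hρ : ρ ∈ piAntidiag s n) :
    ∏ t ∈ insert i s, g t ((ρ + Pi.single i k : σ → ℕ) t) = g i k * ∏ t ∈ s, g t (ρ t) := by
  rw [prod_insert hi]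
  congr 1
  · have : ρ i = 0 := by
      by_contra h
      exact hi ((mem_piAntidiag.mp hρ).2 i h)
    simp [this]
  · refine prod_congr rfl fun t ht => ?_
    have : t ≠ i := by rintro rfl; exact hi ht
    simp [Pi.single_eq_of_ne this]

variable {K : Type*} [NormedField K] [IsUltrametricDist K] [CompleteSpace K]

/-- An iterated Cauchy product; by the ultrametric inequality each homogeneous part obeys the same
geometric bound as the factors, which keeps the induction going. -/
theorem hasSum_prod_piAntidiag {σ : Type*} [DecidableEq σ] (s : Finset σ) {a : σ → ℕ → K} {q : ℝ}
    (hq0 : 0 ≤ q) (hq1 : q < 1) (ha : ∀ t n, ‖a t n‖ ≤ q ^ n) :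
    HasSum (fun n => ∑ r ∈ piAntidiag s n, ∏ t ∈ s, a t (r t)) (∏ t ∈ s, ∑' n, a t n) ∧
      ∀ n, ‖∑ r ∈ piAntidiag s n, ∏ t ∈ s, a t (r t)‖ ≤ q ^ n := by
  have hnorm : ∀ (s : Finset σ) (n : ℕ), ‖∑ r ∈ piAntidiag s n, ∏ t ∈ s, a t (r t)‖ ≤ q ^ n := by
    intro s n
    refine IsUltrametricDist.norm_sum_le_of_forall_le_of_nonneg (by positivity) fun r hr => ?_
    rw [norm_prod, ← (mem_piAntidiag.mp hr).1, ← prod_pow_eq_pow_sum]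
    exact prod_le_prod (fun _ _ => norm_nonneg _) fun t _ => ha t _
  have hs : ∀ f : ℕ → K, (∀ n, ‖f n‖ ≤ q ^ n) → Summable fun n => ‖f n‖ := fun f hf =>
    Summable.of_nonneg_of_le (fun _ => norm_nonneg _) hf (summable_geometric_of_lt_one hq0 hq1)
  refine ⟨?_, hnorm s⟩
  induction s using Finset.induction_on with
  | empty =>
    simp only [prod_empty, sum_const, nsmul_eq_mul, mul_one]
    convert hasSum_single (f := fun n => ((piAntidiag (∅ : Finset σ) n).card : K)) 0 ?_ using 1
    · simp
    · intro n hn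
      simp [piAntidiag_empty_of_ne_zero hn]
  | insert i s hi ih =>
    have h1 : ∀ n, ∑ r ∈ piAntidiag (insert i s) n, ∏ t ∈ insert i s, a t (r t) =
        ∑ kl ∈ HasAntidiagonal.antidiagonal n, a i kl.1 *
          ∑ ρ ∈ piAntidiag s kl.2, ∏ t ∈ s, a t (ρ t) := by
      intro n
      rw [sum_piAntidiag_insert hi]
      refine sum_congr rfl fun kl _ => ?_
      rw [mul_sum]
      exact sum_congr rfl fun ρ hρ => prod_insert_piAntidiag hi a hρ
    simp_rw [h1]
    rw [prod_insert hi, ← ih.tsum_eq, tsum_mul_tsum_eq_tsum_sum_antidiagonal_of_summable_norm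
      (hs _ (ha i)) (hs _ (hnorm s))]
    exact (summable_norm_sum_mul_antidiagonal_of_summable_norm
      (hs _ (ha i)) (hs _ (hnorm s))).of_norm.hasSum

end MultiIndex

/-! ### Integrality of the expansion coefficients -/

section Integrality

/-- The power series with coefficients in a subring. -/
def seriesSubring {R : Type*} [CommRing R] (S : Subring R) : Subring (PowerSeries R) where
  carrier := {f | ∀ n, PowerSeries.coeff n f ∈ S}
  mul_mem' := by
    intro f g hf hg n
    rw [PowerSeries.coeff_mul]
    exact S.sum_mem fun kl _ => S.mul_mem (hf _) (hg _)
  one_mem' := by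
    intro n
    rw [PowerSeries.coeff_one]
    split_ifs
    · exact S.one_mem
    · exact S.zero_mem
  add_mem' := by
    intro f g hf hg n
    rw [map_add]
    exact S.add_mem (hf n) (hg n)
  zero_mem' := by
    intro n
    rw [map_zero]
    exact S.zero_mem
  neg_mem' := by
    intro f hf n
    rw [map_neg]
    exact S.neg_mem (hf n)

theorem C_mem_seriesSubring {R : Type*} [CommRing R] {S : Subring R} {x : R} (hx : x ∈ S) :
    PowerSeries.C x ∈ seriesSubring S := by
  intro n
  rw [PowerSeries.coeff_C]
  split_ifs
  · exact hx
  · exact S.zero_mem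

theorem X_mem_seriesSubring {R : Type*} [CommRing R] (S : Subring R) :
    PowerSeries.X ∈ seriesSubring S := by
  intro n
  rw [PowerSeries.coeff_X]
  split_ifs
  · exact S.one_mem
  · exact S.zero_mem

variable {K : Type*} [NormedField K] [IsUltrametricDist K] {ℓ : ℕ} {Q : Fin ℓ → K}

theorem locSeries_mem (hQ1 : ∀ j : Fin ℓ, j.val ≠ 0 → ‖Q j‖ ≤ 1)
    (hQ : ∀ i j : Fin ℓ, i.val ≠ 0 → j.val ≠ 0 → i ≠ j → ‖Q i - Q j‖ = 1) {j i : Fin ℓ}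
    (hij : i ≠ j) : locSeries Q j i ∈ seriesSubring (unitBall K) := by
  unfold locSeries
  split_ifs with hj hi
  · have hi : i.val ≠ 0 := fun h => hij (Fin.ext (h.trans hj.symm))
    intro n
    rw [PowerSeries.coeff_mk]
    split_ifs
    · exact (unitBall K).zero_mem
    · exact (unitBall K).pow_mem (hQ1 i hi) _
  · exact (seriesSubring _).add_mem (C_mem_seriesSubring (hQ1 j hj)) (X_mem_seriesSubring _)
  · intro n
    rw [PowerSeries.coeff_mk, mem_unitBall, norm_mul, norm_pow, norm_pow, norm_inv,
      hQ j i hj hi (Ne.symm hij)]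
    simp

theorem restSeries_mem (hQ1 : ∀ j : Fin ℓ, j.val ≠ 0 → ‖Q j‖ ≤ 1)
    (hQ : ∀ i j : Fin ℓ, i.val ≠ 0 → j.val ≠ 0 → i ≠ j → ‖Q i - Q j‖ = 1) (j : Fin ℓ)
    (w : Fin ℓ → ℕ) : restSeries Q j w ∈ seriesSubring (unitBall K) :=
  (seriesSubring _).prod_mem fun _ hi =>
    (seriesSubring _).pow_mem (locSeries_mem hQ1 hQ (ne_of_mem_erase hi)) _

theorem norm_pfCoeff_le (hQ1 : ∀ j : Fin ℓ, j.val ≠ 0 → ‖Q j‖ ≤ 1)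
    (hQ : ∀ i j : Fin ℓ, i.val ≠ 0 → j.val ≠ 0 → i ≠ j → ‖Q i - Q j‖ = 1) (w : Fin ℓ → ℕ)
    (j : Fin ℓ) (n : ℕ) : ‖pfCoeff Q w j n‖ ≤ 1 := by
  unfold pfCoeff
  split_ifs
  · exact restSeries_mem hQ1 hQ j w _
  · simp

theorem norm_dworkCoeff_le {p : ℕ} {x : K} (hx : ‖x‖ ≤ 1) (m n : ℕ) :
    ‖dworkCoeff p x m n‖ ≤ 1 := by
  have hC := C_mem_seriesSubring (S := unitBall K) hx
  have hX := X_mem_seriesSubring (unitBall K)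
  have h := (seriesSubring (unitBall K)).mul_mem
    ((seriesSubring _).pow_mem ((seriesSubring _).add_mem hC hX) (p - 1))
    ((seriesSubring _).pow_mem ((seriesSubring _).sub_mem
      ((seriesSubring _).pow_mem ((seriesSubring _).add_mem hC hX) p)
      (C_mem_seriesSubring ((unitBall K).pow_mem hx p))) (m - 1))
  exact h (n - 1)

theorem norm_uCoeff_le {p : ℕ} (hQ1 : ∀ j : Fin ℓ, j.val ≠ 0 → ‖Q j‖ ≤ 1) (j : Fin ℓ) (m n : ℕ) :
    ‖uCoeff p Q j m n‖ ≤ 1 := by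
  unfold uCoeff
  split_ifs with h1
  · simp
  · simp
  · simp
  · exact norm_dworkCoeff_le (hQ1 j h1) m n

theorem norm_rowCoeff_le {p : ℕ} (hQ1 : ∀ j : Fin ℓ, j.val ≠ 0 → ‖Q j‖ ≤ 1)
    (hQ : ∀ i j : Fin ℓ, i.val ≠ 0 → j.val ≠ 0 → i ≠ j → ‖Q i - Q j‖ = 1) (w : Fin ℓ → ℕ)
    (j : Fin ℓ) (m : ℕ) : ‖rowCoeff p Q w j m‖ ≤ 1 :=
  (unitBall K).sum_mem fun n _ =>
    (unitBall K).mul_mem (norm_uCoeff_le hQ1 j m n) (norm_pfCoeff_le hQ1 hQ w j n)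

end Integrality

/-! ### The expansion of the columns of the Frobenius matrix -/

section Columns

/-- The exponents of the local parameters in the monomial of a multi-index. -/
def poleWeight {ℓ : ℕ} {d : Fin ℓ → ℕ} (r : CoeffIdx d → ℕ) (j : Fin ℓ) : ℕ :=
  ∑ i : Fin (d j), (i.val + 1) * r ⟨j, i⟩

/-- The part of degree `N` in `γ` of the coefficient of `X_j ^ m` in `U_p (F · X_J ^ i)`. -/
def entryCoeff {K : Type*} [Field K] {ℓ : ℕ} (p : ℕ) (d : Fin ℓ → ℕ) (u : ℕ → K)
    (A : CoeffIdx d → K) (Q : Fin ℓ → K) (J : Fin ℓ) (i : ℕ) (j : Fin ℓ) (m N : ℕ) : K :=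
  ∑ r ∈ piAntidiag univ N, (∏ s, u (r s) * A s ^ r s) *
    rowCoeff p Q (poleWeight r + Pi.single J i) j m

variable {K : Type*} [NormedField K] [IsUltrametricDist K] {ℓ : ℕ} {d : Fin ℓ → ℕ}

theorem poleWeight_le (r : CoeffIdx d → ℕ) (j : Fin ℓ) : poleWeight r j ≤ d j * ∑ s, r s := by
  unfold poleWeight
  calc ∑ i : Fin (d j), (i.val + 1) * r ⟨j, i⟩ ≤ ∑ i : Fin (d j), d j * r ⟨j, i⟩ := by
        refine sum_le_sum fun i _ => Nat.mul_le_mul_right _ ?_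
        have := i.2
        omega
    _ = d j * ∑ i : Fin (d j), r ⟨j, i⟩ := by rw [mul_sum]
    _ ≤ d j * ∑ s, r s := by
        refine Nat.mul_le_mul_left _ ?_
        rw [Fintype.sum_sigma]
        exact single_le_sum (f := fun j => ∑ i : Fin (d j), r ⟨j, i⟩)
          (fun _ _ => Nat.zero_le _) (mem_univ j)

theorem norm_entryCoeff_le {p : ℕ} {u : ℕ → K} (hu : ∀ n, ‖u n‖ ≤ 1) {A : CoeffIdx d → K}
    (hA : ∀ s, ‖A s‖ ≤ 1) {Q : Fin ℓ → K} (hQ1 : ∀ j : Fin ℓ, j.val ≠ 0 → ‖Q j‖ ≤ 1)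
    (hQ : ∀ i j : Fin ℓ, i.val ≠ 0 → j.val ≠ 0 → i ≠ j → ‖Q i - Q j‖ = 1) (J : Fin ℓ) (i : ℕ)
    (j : Fin ℓ) (m N : ℕ) : ‖entryCoeff p d u A Q J i j m N‖ ≤ 1 :=
  (unitBall K).sum_mem fun _ _ => (unitBall K).mul_mem
    ((unitBall K).prod_mem fun s _ => (unitBall K).mul_mem (hu _)
      ((unitBall K).pow_mem (hA s) _)) (norm_rowCoeff_le hQ1 hQ _ j m)

theorem poleWeight_add_single_le (r : CoeffIdx d → ℕ) (J j : Fin ℓ) (i : ℕ) :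
    (poleWeight r + Pi.single J i : Fin ℓ → ℕ) j ≤ (∑ j, d j) * (∑ s, r s) + i := by
  have h1 := poleWeight_le r j
  have h2 : d j ≤ ∑ j, d j := single_le_sum (f := d) (fun _ _ => Nat.zero_le _) (mem_univ j)
  have h3 : (Pi.single J i : Fin ℓ → ℕ) j ≤ i := by
    by_cases h : j = J
    · subst h; simp
    · simp [Pi.single_eq_of_ne h]
  have h4 := Nat.mul_le_mul_right (∑ s, r s) h2
  simp only [Pi.add_apply]
  omega

theorem entryCoeff_of_lt {p : ℕ} (hp : 0 < p) {u : ℕ → K} {A : CoeffIdx d → K} {Q : Fin ℓ → K}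
    {J : Fin ℓ} {i : ℕ} {j : Fin ℓ} {m N : ℕ} (h : (∑ j, d j) * N + i < m) :
    entryCoeff p d u A Q J i j m N = 0 := by
  refine sum_eq_zero fun r hr => ?_
  have h1 := poleWeight_add_single_le r J j i
  have h2 : ∑ s, r s = N := (mem_piAntidiag.mp hr).1
  rw [h2] at h1
  rw [rowCoeff_of_lt hp Q (h1.trans_lt h), mul_zero]

/-- The only issue is the constant term for a single pole at infinity: there a monomial of positive
degree in `x` has none, and `U_p` does not create one. -/
theorem entryCoeff_of_not {p : ℕ} {u : ℕ → K} {A : CoeffIdx d → K} {Q : Fin ℓ → K}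
    {J : Fin ℓ} {i : ℕ} {j : Fin ℓ} {m N : ℕ} (hi : 1 ≤ i ∨ 2 ≤ ℓ)
    (h : ¬ (1 ≤ m ∨ (j.val = 0 ∧ 2 ≤ ℓ))) : entryCoeff p d u A Q J i j m N = 0 := by
  refine sum_eq_zero fun r _ => ?_
  by_cases h' : 1 ≤ m ∨ j.val = 0
  · have hm : m = 0 := by omega
    have hj : j.val = 0 := by omega
    have hℓ : ℓ = 1 := by have := j.2; omega
    subst hm hℓ
    have hJ : J = j := Subsingleton.elim _ _
    rw [rowCoeff, sum_eq_zero, mul_zero]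
    intro n _
    rw [uCoeff, if_pos hj]
    split_ifs with hn
    · have hn0 : n = 0 := by omega
      subst hn0
      rw [pfCoeff, if_pos ⟨Or.inr hj, Nat.zero_le _⟩, restSeries]
      have he : (univ : Finset (Fin 1)).erase j = ∅ := by
        ext a; simp [Subsingleton.elim a j]
      rw [he, prod_empty, PowerSeries.coeff_one, if_neg, mul_zero]
      simp only [Pi.add_apply, hJ, Pi.single_eq_same]
      omega
    · rw [zero_mul]
  · rw [rowCoeff_of_not Q h', mul_zero]

/-- The splitting function, over any normed field and with arbitrary series coefficients. -/
def splitProd (d : Fin ℓ → ℕ) (u : ℕ → K) (γ : K) (A : CoeffIdx d → K) (Q : Fin ℓ → K) (x : K) :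
    K :=
  ∏ j : Fin ℓ, ∏ i : Fin (d j),
    ∑' m : ℕ, u m * (γ * A ⟨j, i⟩ * poleParam Q j x ^ (i.val + 1)) ^ m

theorem hasSum_splitProd [CompleteSpace K] {u : ℕ → K} (hu : ∀ n, ‖u n‖ ≤ 1)
    {A : CoeffIdx d → K} (hA : ∀ s, ‖A s‖ ≤ 1) {Q : Fin ℓ → K} {γ : K} {ρ : ℝ} (hρ : 1 ≤ ρ)
    (hq : ‖γ‖ * ρ ^ (∑ j, d j) < 1) {y : K} (hy : ∀ j, ‖poleParam Q j y‖ ≤ ρ) :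
    HasSum (fun N => γ ^ N * ∑ r ∈ piAntidiag univ N, (∏ s, u (r s) * A s ^ r s) *
      ∏ j, poleParam Q j y ^ poleWeight r j) (splitProd d u γ A Q y) := by
  have h := (hasSum_prod_piAntidiag (univ : Finset (CoeffIdx d)) (K := K)
    (a := fun s m => u m * (γ * A s * poleParam Q s.1 y ^ (s.2.val + 1)) ^ m)
    (q := ‖γ‖ * ρ ^ (∑ j, d j)) (by positivity) hq ?_).1
  · rw [Fintype.prod_sigma] at h
    refine (congrArg (HasSum · _) (funext fun N => ?_)).mpr h
    rw [mul_sum]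
    refine sum_congr rfl fun r hr => ?_
    have h2 : ∑ s, r s = N := (mem_piAntidiag.mp hr).1
    have e1 : ∏ s : CoeffIdx d, u (r s) * (γ * A s * poleParam Q s.1 y ^ (s.2.val + 1)) ^ r s =
        ∏ s : CoeffIdx d, γ ^ r s * ((u (r s) * A s ^ r s) *
          poleParam Q s.1 y ^ ((s.2.val + 1) * r s)) := by
      refine prod_congr rfl fun s _ => ?_
      rw [mul_pow, mul_pow, ← pow_mul]
      ring
    have e2 : ∏ s : CoeffIdx d, poleParam Q s.1 y ^ ((s.2.val + 1) * r s) =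
        ∏ j, poleParam Q j y ^ poleWeight r j := by
      rw [Fintype.prod_sigma]
      refine prod_congr rfl fun j _ => ?_
      rw [poleWeight, ← prod_pow_eq_pow_sum]
    have e3 : ∏ s : CoeffIdx d, γ ^ r s * ((u (r s) * A s ^ r s) *
        poleParam Q s.1 y ^ ((s.2.val + 1) * r s)) =
        γ ^ N * ((∏ s, u (r s) * A s ^ r s) * ∏ j, poleParam Q j y ^ poleWeight r j) := by
      rw [← e2, ← prod_mul_distrib, ← h2, ← prod_pow_eq_pow_sum, ← prod_mul_distrib]
    exact (e1.trans e3).symm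
  · intro s n
    rw [norm_mul, norm_pow]
    refine (mul_le_of_le_one_left (by positivity) (hu n)).trans ?_
    gcongr
    rw [norm_mul, norm_mul, norm_pow]
    have h1 : ‖poleParam Q s.1 y‖ ^ (s.2.val + 1) ≤ ρ ^ (∑ j, d j) := by
      refine (pow_le_pow_left₀ (norm_nonneg _) (hy s.1) _).trans
        (pow_le_pow_right₀ hρ ?_)
      have h2 : d s.1 ≤ ∑ j, d j :=
        single_le_sum (f := d) (fun _ _ => Nat.zero_le _) (mem_univ s.1)
      have := s.2.2
      omega
    calc ‖γ‖ * ‖A s‖ * ‖poleParam Q s.1 y‖ ^ (s.2.val + 1) ≤ ‖γ‖ * 1 * ρ ^ (∑ j, d j) := by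
          gcongr; exact hA s
      _ = _ := by ring

theorem norm_poleParam_le {Q : Fin ℓ → K} {r : ℝ} (hr : 0 < r) {x : K}
    (hx : x ∈ poleAffinoid Q r) (j : Fin ℓ) : ‖poleParam Q j x‖ ≤ r⁻¹ := by
  unfold poleParam
  split_ifs with hj
  · exact hx.1
  · rw [norm_inv]
    exact inv_anti₀ hr (hx.2 j hj)

/-- For integral elements `‖y ^ p - Q ^ p‖ ≤ ‖y - Q‖`, so `p`-th roots do not come closer to a pole;
`F` thus converges at all points over which `U_p` sums. -/
theorem mem_poleAffinoid_of_pow {p : ℕ} (hp : p.Prime) {Q : Fin ℓ → K}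
    (hQ1 : ∀ j : Fin ℓ, j.val ≠ 0 → ‖Q j‖ ≤ 1) {r : ℝ} (hr0 : 0 < r) (hr1 : r < 1) {y : K}
    (hy : y ^ p ∈ poleAffinoid (fun j => Q j ^ p) r) : y ∈ poleAffinoid Q r := by
  have hr1' : 1 < r⁻¹ := (one_lt_inv₀ hr0).mpr hr1
  refine ⟨?_, fun j hj => ?_⟩
  · by_contra! h
    have h1 := hy.1
    rw [norm_pow] at h1
    have h2 : ‖y‖ ≤ ‖y‖ ^ p := le_self_pow₀ (hr1'.trans h).le hp.ne_zero
    linarith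
  · by_cases hy1 : ‖y‖ ≤ 1
    · have h1 := norm_pow_sub_pow_le_norm hp hy1 (hQ1 j hj) 1
      rw [pow_one] at h1
      exact (hy.2 j hj).trans h1
    · push Not at hy1
      have h2 : ‖y - Q j‖ = ‖y‖ := by
        apply norm_eq_of_norm_sub_lt
        rw [sub_sub_cancel_left, norm_neg]
        exact (hQ1 j hj).trans_lt hy1
      rw [h2]
      linarith

/-- Frobenius is injective on the residue field: the poles `Q_j ^ p` keep distinct residues. -/
theorem norm_pow_sub_pow_eq_one {p : ℕ} (hp : p.Prime) (hpK : ‖(p : K)‖ < 1) {x y : K}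
    (hy : ‖y‖ ≤ 1) (hxy : ‖x - y‖ = 1) : ‖x ^ p - y ^ p‖ = 1 := by
  obtain ⟨r, hr, h⟩ := exists_integral_add_pow hp hxy.le hy 1
  rw [sub_add_cancel, pow_one] at h
  have e : x ^ p - y ^ p - (x - y) ^ p = p * (x - y) * y * r := by
    rw [h]; ring
  have h1 : ‖(x - y) ^ p‖ = 1 := by rw [norm_pow, hxy, one_pow]
  rw [← h1]
  apply norm_eq_of_norm_sub_lt
  rw [e, h1, norm_mul, norm_mul, norm_mul]
  calc ‖(p : K)‖ * ‖x - y‖ * ‖y‖ * ‖r‖ ≤ ‖(p : K)‖ * 1 * 1 * 1 := by gcongr; exact hxy.le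
    _ < 1 := by simpa using hpK

theorem hasSum_multiset_map {s : Multiset K} {f : K → ℕ → K} {g : K → K}
    (h : ∀ y ∈ s, HasSum (f y) (g y)) :
    HasSum (fun N => (s.map fun y => f y N).sum) (s.map g).sum := by
  induction s using Multiset.induction_on with
  | empty => simp
  | cons a s ih =>
    simp only [Multiset.map_cons, Multiset.sum_cons]
    exact (h a (Multiset.mem_cons_self a s)).add
      (ih fun y hy => h y (Multiset.mem_cons_of_mem hy))

theorem sum_nthRoots_monomials [IsAlgClosed K] [CharZero K] {p : ℕ} [hp : Fact p.Prime]
    (hℓ : 1 ≤ ℓ) {u : ℕ → K} {A : CoeffIdx d → K} {Q : Fin ℓ → K}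
    (hQinj : ∀ i j : Fin ℓ, i.val ≠ 0 → j.val ≠ 0 → Q i = Q j → i = j) (γ : K) (J : Fin ℓ) (i : ℕ)
    {x : K} (hxne : ∀ j : Fin ℓ, j.val ≠ 0 → x ≠ Q j ^ p) (N : ℕ) :
    ((Polynomial.nthRoots p x).map fun y => γ ^ N * ∑ r ∈ piAntidiag univ N,
        (∏ s, u (r s) * A s ^ r s) *
          ∏ j, poleParam Q j y ^ (poleWeight r + Pi.single J i : Fin ℓ → ℕ) j).sum / p =
      γ ^ N * ∑ j, ∑ m ∈ range ((∑ j, d j) * N + i + 1), entryCoeff p d u A Q J i j m N *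
        poleParam (fun j => Q j ^ p) j x ^ m := by
  rw [Multiset.sum_map_mul_left, multiset_sum_map_sum, mul_div_assoc, sum_div]
  congr 1
  have e : ∀ j, ∀ m ∈ range ((∑ j, d j) * N + i + 1), entryCoeff p d u A Q J i j m N *
        poleParam (fun j => Q j ^ p) j x ^ m =
      ∑ r ∈ piAntidiag univ N, (∏ s, u (r s) * A s ^ r s) *
        (rowCoeff p Q (poleWeight r + Pi.single J i) j m *
          poleParam (fun j => Q j ^ p) j x ^ m) := by
    intro j m _
    rw [entryCoeff, sum_mul]
    exact sum_congr rfl fun r _ => mul_assoc _ _ _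
  rw [sum_congr rfl fun j _ => (sum_congr rfl (e j)).trans sum_comm, sum_comm]
  refine sum_congr rfl fun r hr => ?_
  have hrN : ∑ s, r s = N := (mem_piAntidiag.mp hr).1
  rw [Multiset.sum_map_mul_left, mul_div_assoc,
    sum_nthRoots_prod_poleParam_pow hp.out.pos hℓ hQinj hxne _
      ((∑ j, d j) * N + i + 1) fun j => ?_]
  · rw [mul_sum]
    exact sum_congr rfl fun j _ => mul_sum _ _ _
  · have := poleWeight_add_single_le r J j i
    rw [hrN] at this
    omega

theorem hasSum_splitProd_mul [CompleteSpace K] {u : ℕ → K} (hu : ∀ n, ‖u n‖ ≤ 1)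
    {A : CoeffIdx d → K} (hA : ∀ s, ‖A s‖ ≤ 1) {Q : Fin ℓ → K} {γ : K} {ρ : ℝ} (hρ : 1 ≤ ρ)
    (hq : ‖γ‖ * ρ ^ (∑ j, d j) < 1) {y : K} (hy : ∀ j, ‖poleParam Q j y‖ ≤ ρ) (J : Fin ℓ) (i : ℕ) :
    HasSum (fun N => γ ^ N * ∑ r ∈ piAntidiag univ N, (∏ s, u (r s) * A s ^ r s) *
      ∏ j, poleParam Q j y ^ (poleWeight r + Pi.single J i : Fin ℓ → ℕ) j)
      (splitProd d u γ A Q y * poleParam Q J y ^ i) := by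
  have h1 := (hasSum_splitProd hu hA hρ hq hy).mul_right (poleParam Q J y ^ i)
  refine (congrArg (HasSum · _) (funext fun N => ?_)).mpr h1
  rw [mul_assoc, sum_mul]
  congr 1
  refine sum_congr rfl fun r _ => ?_
  rw [mul_assoc]
  congr 1
  simp only [Pi.add_apply, pow_add, prod_mul_distrib]
  congr 1
  rw [prod_eq_single J] <;> simp +contextual [Pi.single_eq_of_ne]

theorem hasSum_of_fiberwise {B : Type*} {g : ℕ × B → K} {v : ℕ → K} {w : B → K} {S : K}
    (hg : Summable g) (hv : ∀ N, HasSum (fun b => g (N, b)) (v N)) (hS : HasSum v S)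
    (hw : ∀ b, HasSum (fun N => g (N, b)) (w b)) : HasSum w S := by
  have h : HasSum g S := by
    rw [← (hg.hasSum.prod_fiberwise hv).unique hS]
    exact hg.hasSum
  exact ((Equiv.prodComm B ℕ).hasSum_iff.mpr h).prod_fiberwise hw

set_option maxHeartbeats 1000000 in
/-- The expansion of `U_p (F · X_J ^ i)` in powers of the local parameters. -/
theorem hasSum_column [CompleteSpace K] [IsAlgClosed K] [CharZero K] {p : ℕ} [hp : Fact p.Prime]
    (hℓ : 1 ≤ ℓ) {u : ℕ → K} (hu : ∀ n, ‖u n‖ ≤ 1)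
    {A : CoeffIdx d → K} (hA : ∀ s, ‖A s‖ ≤ 1) {Q : Fin ℓ → K}
    (hQ1 : ∀ j : Fin ℓ, j.val ≠ 0 → ‖Q j‖ ≤ 1)
    (hQ : ∀ i j : Fin ℓ, i.val ≠ 0 → j.val ≠ 0 → i ≠ j → ‖Q i - Q j‖ = 1) {γ : K} {r : ℝ}
    (hr0 : 0 < r) (hr1 : r < 1) (hq : ‖γ‖ * r⁻¹ ^ (∑ j, d j) < 1) (J : Fin ℓ) {i : ℕ}
    (hi : 1 ≤ i ∨ 2 ≤ ℓ) {x : K} (hx : x ∈ poleAffinoid (fun j => Q j ^ p) r) :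
    HasSum (fun b : BasisIdx ℓ => (∑' N, γ ^ N * entryCoeff p d u A Q J i b.1.1 b.1.2 N) *
      poleParam (fun j => Q j ^ p) b.1.1 x ^ b.1.2)
      (((Polynomial.nthRoots p x).map fun y =>
        splitProd d u γ A Q y * poleParam Q J y ^ i).sum / p) := by
  have hρ1 : 1 ≤ r⁻¹ := ((one_lt_inv₀ hr0).mpr hr1).le
  set D := ∑ j, d j with hD
  set q := ‖γ‖ * r⁻¹ ^ D with hqdef
  have hq0 : 0 ≤ q := by positivity
  have hQinj : ∀ i j : Fin ℓ, i.val ≠ 0 → j.val ≠ 0 → Q i = Q j → i = j := by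
    intro i j hi hj h
    by_contra hij
    have := hQ i j hi hj hij
    rw [h, sub_self, norm_zero] at this
    exact zero_ne_one this
  have hxne : ∀ j : Fin ℓ, j.val ≠ 0 → x ≠ Q j ^ p := by
    rintro j hj rfl
    have := hx.2 j hj
    rw [sub_self, norm_zero] at this
    linarith
  set X := fun j => poleParam (fun j => Q j ^ p) j x with hX
  have hXn : ∀ j, ‖X j‖ ≤ r⁻¹ := fun j => norm_poleParam_le hr0 hx j
  set g : ℕ × BasisIdx ℓ → K := fun z =>
    γ ^ z.1 * entryCoeff p d u A Q J i z.2.1.1 z.2.1.2 z.1 * X z.2.1.1 ^ z.2.1.2 with hg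
  have hgz : ∀ z : ℕ × BasisIdx ℓ, D * z.1 + i < z.2.1.2 → g z = 0 := by
    intro z hz
    simp only [hg]
    rw [entryCoeff_of_lt hp.out.pos hz, mul_zero, zero_mul]
  -- At level `N` only exponents up to `D N + i` occur, so the growth of the parameters on the
  -- affinoid is at most `r⁻¹ ^ (D N + i)`, which `γ ^ N` absorbs because `q < 1`.
  have hgn : ∀ z : ℕ × BasisIdx ℓ, ‖g z‖ ≤ q ^ z.1 * r⁻¹ ^ i := by
    intro z
    by_cases hz : D * z.1 + i < z.2.1.2
    · rw [hgz z hz, norm_zero]; positivity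
    · push Not at hz
      simp only [hg]
      rw [norm_mul, norm_mul, norm_pow, norm_pow]
      have h1 : ‖X z.2.1.1‖ ^ z.2.1.2 ≤ r⁻¹ ^ (D * z.1 + i) :=
        (pow_le_pow_left₀ (norm_nonneg _) (hXn _) _).trans (pow_le_pow_right₀ hρ1 hz)
      calc ‖γ‖ ^ z.1 * ‖entryCoeff p d u A Q J i z.2.1.1 z.2.1.2 z.1‖ * ‖X z.2.1.1‖ ^ z.2.1.2
          ≤ ‖γ‖ ^ z.1 * 1 * r⁻¹ ^ (D * z.1 + i) := by
            gcongr
            exact norm_entryCoeff_le hu hA hQ1 hQ _ _ _ _ _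
        _ = q ^ z.1 * r⁻¹ ^ i := by rw [hqdef, mul_pow, ← pow_mul, pow_add]; ring
  -- In a complete ultrametric field a family tending to zero is summable: the levels decay
  -- geometrically and each level involves finitely many basis elements. This permits the
  -- interchange of the two summations.
  have hgs : Summable g := by
    apply NonarchimedeanAddGroup.summable_of_tendsto_cofinite_zero
    rw [Metric.tendsto_nhds]
    intro ε hε
    have hlim : Tendsto (fun N : ℕ => q ^ N * r⁻¹ ^ i) atTop (nhds 0) := by
      simpa using (tendsto_pow_atTop_nhds_zero_of_lt_one hq0 hq).mul_const (r⁻¹ ^ i)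
    obtain ⟨N₀, hN₀⟩ := eventually_atTop.mp (hlim.eventually_lt_const hε)
    rw [eventually_cofinite]
    have hfin : (Set.Iio N₀ ×ˢ {b : BasisIdx ℓ | b.1.2 ≤ D * N₀ + i}).Finite := by
      refine (Set.finite_Iio N₀).prod ?_
      refine Set.Finite.of_finite_image (f := fun b : BasisIdx ℓ => b.1) ?_
        Subtype.val_injective.injOn
      refine Set.Finite.subset
        ((Set.finite_univ (α := Fin ℓ)).prod (Set.finite_Iic (D * N₀ + i))) ?_
      rintro _ ⟨b, hb, rfl⟩
      exact ⟨Set.mem_univ _, hb⟩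
    refine hfin.subset ?_
    intro z hz
    simp only [Set.mem_ofPred_eq, dist_zero_right, not_lt] at hz
    have h1 : z.1 < N₀ := by
      by_contra! h
      have := (hgn z).trans_lt (hN₀ z.1 h)
      linarith
    refine ⟨h1, ?_⟩
    by_contra h
    simp only [Set.mem_ofPred_eq, not_le] at h
    have : D * z.1 + i < z.2.1.2 := by
      have := Nat.mul_le_mul_left D h1.le
      omega
    rw [hgz z this, norm_zero] at hz
    linarith
  -- summation over the basis first
  have hfib : ∀ N : ℕ, HasSum (fun b : BasisIdx ℓ => g (N, b))
      (γ ^ N * ∑ j, ∑ m ∈ range (D * N + i + 1), entryCoeff p d u A Q J i j m N * X j ^ m) := by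
    intro N
    classical
    set f : Fin ℓ × ℕ → K := fun b => γ ^ N * (entryCoeff p d u A Q J i b.1 b.2 N * X b.1 ^ b.2)
      with hf
    have h1 : HasSum f (∑ b ∈ univ ×ˢ range (D * N + i + 1), f b) := by
      refine hasSum_sum_of_ne_finset_zero fun b hb => ?_
      have hb' : D * N + i < b.2 := by
        simp only [mem_product, mem_univ, mem_range, true_and, not_lt] at hb
        omega
      simp only [hf]
      rw [entryCoeff_of_lt hp.out.pos hb', zero_mul, mul_zero]
    have h2 : HasSum (fun b : BasisIdx ℓ => f b.1) (∑ b ∈ univ ×ˢ range (D * N + i + 1), f b) := by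
      refine (hasSum_subtype_iff_of_support_subset
        (s := {b : Fin ℓ × ℕ | 1 ≤ b.2 ∨ (b.1.val = 0 ∧ 2 ≤ ℓ)}) ?_).mpr h1
      intro b hb
      by_contra hb'
      apply hb
      simp only [hf]
      rw [entryCoeff_of_not hi hb', zero_mul, mul_zero]
    convert h2 using 1
    · funext b
      simp only [hg, hf]
      ring
    · rw [sum_product, mul_sum]
      refine sum_congr rfl fun j _ => ?_
      rw [mul_sum]
  have hval : HasSum (fun N : ℕ => γ ^ N * ∑ j, ∑ m ∈ range (D * N + i + 1),
      entryCoeff p d u A Q J i j m N * X j ^ m) (((Polynomial.nthRoots p x).map fun y =>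
        splitProd d u γ A Q y * poleParam Q J y ^ i).sum / p) := by
    have h2 := (hasSum_multiset_map (s := Polynomial.nthRoots p x) fun y hy =>
      hasSum_splitProd_mul hu hA hρ1 hq (fun j => norm_poleParam_le hr0
        (mem_poleAffinoid_of_pow hp.out hQ1 hr0 hr1
          (by rwa [(Polynomial.mem_nthRoots hp.out.pos).mp hy])) j) J i).div_const (p : K)
    simp only [sum_nthRoots_monomials hℓ hQinj γ J i hxne] at h2
    exact h2
  refine hasSum_of_fiberwise hgs hfib hval fun b => ?_
  have hsN : Summable fun N => γ ^ N * entryCoeff p d u A Q J i b.1.1 b.1.2 N := by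
    have hγ : ‖γ‖ < 1 := lt_of_le_of_lt (le_mul_of_one_le_right (norm_nonneg _)
      (one_le_pow₀ hρ1)) hq
    refine Summable.of_norm_bounded (summable_geometric_of_lt_one (norm_nonneg γ) hγ) fun N => ?_
    rw [norm_mul, norm_pow]
    exact mul_le_of_le_one_right (by positivity) (norm_entryCoeff_le hu hA hQ1 hQ _ _ _ _ _)
  exact hsN.hasSum.mul_right _

end Columns

/-! ### The entries of the Frobenius matrix -/

section Entries

variable {p : ℕ} [hp : Fact p.Prime]

theorem norm_ratCast (q : ℚ) : ‖(q : ℂ_[p])‖ = ‖(q : ℚ_[p])‖ := by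
  rw [← PadicComplex.norm_extends' p (q : ℚ_[p])]
  congr 1
  exact (map_ratCast (algebraMap ℚ_[p] ℂ_[p]) q).symm

theorem norm_prime : ‖(p : ℂ_[p])‖ = (p : ℝ)⁻¹ := by
  have := norm_ratCast (p := p) (p : ℚ)
  simpa using this

theorem norm_prime_lt_one : ‖(p : ℂ_[p])‖ < 1 := by
  rw [norm_prime]
  exact inv_lt_one_of_one_lt₀ (by exact_mod_cast hp.out.one_lt)

/-- The coefficients of the Artin–Hasse exponential as elements of `ℂ_p`. -/
def ahCoeff (p : ℕ) [Fact p.Prime] (n : ℕ) : ℂ_[p] :=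
  ((PowerSeries.coeff n (artinHasse p) : ℚ) : ℂ_[p])

theorem norm_ahCoeff_le (n : ℕ) : ‖ahCoeff p n‖ ≤ 1 := by
  rw [ahCoeff, norm_ratCast]
  exact norm_coeff_artinHasse_le p n

theorem ahCoeff_of_lt {n : ℕ} (hn : n < p) : ahCoeff p n = (n.factorial : ℂ_[p])⁻¹ := by
  rw [ahCoeff, coeff_artinHasse_of_lt p hn]
  simp

theorem norm_pow_of_isArtinHasseRoot {γ : ℂ_[p]} (hγ : IsArtinHasseRoot p γ) :
    γ ≠ 0 ∧ ‖γ‖ ^ (p - 1) = (p : ℝ)⁻¹ := by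
  have hp1 : (1 : ℝ) < p := by exact_mod_cast hp.out.one_lt
  have h := hγ.2
  unfold ordp at h
  have h0 : γ ≠ 0 := by
    rintro rfl
    rw [norm_zero, Real.logb_zero, neg_zero] at h
    have : 0 < 1 / ((p : ℝ) - 1) := by
      apply div_pos one_pos; linarith
    linarith
  refine ⟨h0, ?_⟩
  have hn : 0 < ‖γ‖ := norm_pos_iff.mpr h0
  have h1 : Real.logb p ‖γ‖ = -(1 / ((p : ℝ) - 1)) := by linarith
  have h2 : ‖γ‖ = (p : ℝ) ^ (-(1 / ((p : ℝ) - 1))) := by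
    rw [← h1, Real.rpow_logb (by linarith) (by linarith) hn]
  rw [h2, ← Real.rpow_natCast, ← Real.rpow_mul (by linarith), Nat.cast_sub hp.out.one_le,
    Nat.cast_one, neg_mul, one_div, inv_mul_cancel₀ (by linarith), Real.rpow_neg_one]

theorem norm_lt_one_of_isArtinHasseRoot {γ : ℂ_[p]} (hγ : IsArtinHasseRoot p γ) : ‖γ‖ < 1 := by
  by_contra! h
  have h1 := (norm_pow_of_isArtinHasseRoot hγ).2
  have h2 : 1 ≤ ‖γ‖ ^ (p - 1) := one_le_pow₀ h
  rw [h1] at h2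
  have : (p : ℝ)⁻¹ < 1 := inv_lt_one_of_one_lt₀ (by exact_mod_cast hp.out.one_lt)
  linarith

/-- The entry of the Frobenius matrix, up to the normalisation of the basis. -/
def frobEntry {ℓ : ℕ} (d : Fin ℓ → ℕ) (γ : ℂ_[p]) (A : CoeffIdx d → ℂ_[p]) (Q : Fin ℓ → ℂ_[p])
    (b' b : BasisIdx ℓ) : ℂ_[p] :=
  ∑' N, γ ^ N * entryCoeff p d (ahCoeff p) A Q b.1.1 b.1.2 b'.1.1 b'.1.2 N

theorem exists_radius {c : ℝ} (hc : c < 1) (D : ℕ) :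
    ∃ r : ℝ, 0 < r ∧ r < 1 ∧ c * r⁻¹ ^ D < 1 := by
  have h : Tendsto (fun r : ℝ => c * r⁻¹ ^ D) (nhdsWithin 1 (Set.Iio 1)) (nhds (c * 1⁻¹ ^ D)) := by
    refine Tendsto.mono_left ?_ nhdsWithin_le_nhds
    exact ((tendsto_id.inv₀ one_ne_zero).pow D).const_mul c
  have h1 := h.eventually_lt_const (u := 1) (by simpa using hc)
  have h2 : ∀ᶠ r : ℝ in nhdsWithin 1 (Set.Iio 1), 0 < r :=
    nhdsWithin_le_nhds (eventually_gt_nhds one_pos)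
  obtain ⟨r, hr1, hr2, hr3⟩ := (h1.and (h2.and self_mem_nhdsWithin)).exists
  exact ⟨r, hr2, hr3, hr1⟩

/-- The coordinates are defined by a choice among expansions on some affinoid. The explicit series
is such an expansion by `hasSum_column`; comparing both on the affinoid of the larger radius,
uniqueness identifies them. -/
theorem frobeniusMatrix_apply {ℓ : ℕ} (hℓ : 1 ≤ ℓ) {d : Fin ℓ → ℕ} {γ : ℂ_[p]}
    (hγ : IsArtinHasseRoot p γ) {δ : Fin ℓ → ℂ_[p]} (hδ : ∀ j, δ j ≠ 0) {A : CoeffIdx d → ℂ_[p]}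
    (hA : ∀ s, ‖A s‖ ≤ 1) {Q : Fin ℓ → ℂ_[p]} (hQ1 : ∀ j : Fin ℓ, j.val ≠ 0 → ‖Q j‖ ≤ 1)
    (hQ : ∀ i j : Fin ℓ, i.val ≠ 0 → j.val ≠ 0 → i ≠ j → ‖Q i - Q j‖ = 1) (b' b : BasisIdx ℓ) :
    frobeniusMatrix d γ δ A Q b' b =
      (δ b'.1.1 ^ b'.1.2)⁻¹ * (δ b.1.1 ^ b.1.2 * frobEntry d γ A Q b' b) := by
  set c : BasisIdx ℓ → ℂ_[p] := fun b' =>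
    (δ b'.1.1 ^ b'.1.2)⁻¹ * (δ b.1.1 ^ b.1.2 * frobEntry d γ A Q b' b) with hc
  set g : ℂ_[p] → ℂ_[p] := dworkU fun y => splittingFun d γ A Q y * basisFun δ Q b y with hg
  have hi : 1 ≤ b.1.2 ∨ 2 ≤ ℓ := b.2.imp_right And.right
  have hcoords : ∀ (c : BasisIdx ℓ → ℂ_[p]) (x : ℂ_[p]) (b' : BasisIdx ℓ),
      c b' * basisFun δ (fun j => Q j ^ p) b' x = (c b' * δ b'.1.1 ^ b'.1.2) *
        poleParam (fun j => Q j ^ p) b'.1.1 x ^ b'.1.2 := by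
    intro c x b'
    rw [basisFun, mul_pow, ← mul_assoc]
    rfl
  have hexp : IsBasisExpansion δ (fun j => Q j ^ p) g c := by
    obtain ⟨r, hr0, hr1, hr⟩ := exists_radius
      (norm_lt_one_of_isArtinHasseRoot hγ) (∑ j, d j)
    refine ⟨r, hr0, hr1, fun x hx => ?_⟩
    have h := (hasSum_column hℓ (norm_ahCoeff_le (p := p)) hA hQ1 hQ hr0 hr1 hr b.1.1 hi
      (x := x) hx).mul_left (δ b.1.1 ^ b.1.2)
    have e : g x = δ b.1.1 ^ b.1.2 * (((Polynomial.nthRoots p x).map fun y =>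
        splitProd d (ahCoeff p) γ A Q y * poleParam Q b.1.1 y ^ b.1.2).sum / p) := by
      rw [hg, dworkU, ← mul_div_assoc, ← Multiset.sum_map_mul_left]
      congr 3
      funext y
      rw [basisFun, mul_pow, mul_left_comm]
      rfl
    rw [e]
    refine (congrArg (HasSum · _) (funext fun b' => ?_)).mpr h
    rw [hcoords, hc]
    have : δ b'.1.1 ^ b'.1.2 ≠ 0 := pow_ne_zero _ (hδ _)
    simp only [frobEntry]
    field_simp
  have hex : ∃ c, IsBasisExpansion δ (fun j => Q j ^ p) g c := ⟨c, hexp⟩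
  have hchoose := hex.choose_spec
  have heq : frobeniusMatrix d γ δ A Q b' b = hex.choose b' := by
    simp only [frobeniusMatrix, Matrix.of_apply, basisCoords]
    rw [dif_pos hex]
  rw [heq]
  obtain ⟨r₁, h10, h11, h1⟩ := hexp
  obtain ⟨r₂, h20, h21, h2⟩ := hchoose
  set c' := hex.choose
  have hz : (fun b' : BasisIdx ℓ => (c' b' - c b') * δ b'.1.1 ^ b'.1.2) = 0 := by
    refine poleParam_expansion_unique norm_prime_lt_one (Q := fun j => Q j ^ p)
      (fun j hj => ?_) (fun i j hi hj hij => ?_) (lt_max_of_lt_left h10) (max_lt h11 h21)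
      fun x hx => ?_
    · rw [norm_pow]
      exact pow_le_one₀ (norm_nonneg _) (hQ1 j hj)
    · exact norm_pow_sub_pow_eq_one hp.out norm_prime_lt_one (hQ1 j hj) (hQ i j hi hj hij)
    · have hx1 : x ∈ affinoid (fun j => Q j ^ p) r₁ :=
        ⟨hx.1.trans (inv_anti₀ h10 (le_max_left _ _)), fun j hj =>
          (le_max_left _ _).trans (hx.2 j hj)⟩
      have hx2 : x ∈ affinoid (fun j => Q j ^ p) r₂ :=
        ⟨hx.1.trans (inv_anti₀ h20 (le_max_right _ _)), fun j hj =>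
          (le_max_right _ _).trans (hx.2 j hj)⟩
      have h3 := (h2 x hx2).sub (h1 x hx1)
      rw [sub_self] at h3
      refine (congrArg (HasSum · _) (funext fun b' => ?_)).mpr h3
      rw [hcoords, hcoords]
      ring
  have h4 := congrFun hz b'
  have : δ b'.1.1 ^ b'.1.2 ≠ 0 := pow_ne_zero _ (hδ _)
  exact sub_eq_zero.mp ((mul_eq_zero.mp h4).resolve_right this)

/-- The determinant of a block of the Frobenius matrix does not depend on the normalisation of the
basis. -/
theorem det_principalBlock_frobeniusMatrix {ℓ : ℕ} (hℓ : 1 ≤ ℓ) {d : Fin ℓ → ℕ} {γ : ℂ_[p]}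
    (hγ : IsArtinHasseRoot p γ) {δ : Fin ℓ → ℂ_[p]} (hδ : ∀ j, δ j ≠ 0) {A : CoeffIdx d → ℂ_[p]}
    (hA : ∀ s, ‖A s‖ ≤ 1) {Q : Fin ℓ → ℂ_[p]} (hQ1 : ∀ j : Fin ℓ, j.val ≠ 0 → ‖Q j‖ ≤ 1)
    (hQ : ∀ i j : Fin ℓ, i.val ≠ 0 → j.val ≠ 0 → i ≠ j → ‖Q i - Q j‖ = 1) (e : ℕ ≃ BasisIdx ℓ)
    (k : ℕ) :
    (principalBlock e k (frobeniusMatrix d γ δ A Q)).det =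
      (Matrix.of fun a b : Fin k => frobEntry d γ A Q (e a) (e b)).det := by
  set v : Fin k → ℂ_[p] := fun a => δ (e a).1.1 ^ (e a).1.2 with hv
  have hv0 : ∀ a, v a ≠ 0 := fun a => pow_ne_zero _ (hδ _)
  have h1 : principalBlock e k (frobeniusMatrix d γ δ A Q) =
      Matrix.of fun a b => (v a)⁻¹ * (Matrix.of fun a b => v b *
        (Matrix.of fun a b : Fin k => frobEntry d γ A Q (e a) (e b)) a b) a b := by
    ext a b
    simp only [principalBlock, Matrix.submatrix_apply, Matrix.of_apply]
    exact frobeniusMatrix_apply hℓ hγ hδ hA hQ1 hQ (e a) (e b)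
  rw [h1, Matrix.det_mul_column, Matrix.det_mul_row, ← mul_assoc, ← prod_mul_distrib,
    prod_congr rfl fun a _ => inv_mul_cancel₀ (hv0 a), prod_const_one, one_mul]

end Entries

/-! ### Leading coefficients of the entries -/

section LeadingCoefficients

/-- The shift `0` or `1` in the weight of the basis elements at a pole. -/
def poleShift {ℓ : ℕ} (j : Fin ℓ) : ℕ := if j.val ≤ 1 then 0 else 1

/-- The numerator of the weight of a basis element. -/
def weightNum {ℓ : ℕ} (b : BasisIdx ℓ) : ℕ := b.1.2 - poleShift b.1.1

theorem poleShift_le {ℓ : ℕ} (b : BasisIdx ℓ) : poleShift b.1.1 ≤ b.1.2 := by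
  unfold poleShift
  split_ifs with h
  · exact Nat.zero_le _
  · rcases b.2 with h' | h'
    · exact h'
    · omega

theorem weightNum_add {ℓ : ℕ} (b : BasisIdx ℓ) : weightNum b + poleShift b.1.1 = b.1.2 :=
  Nat.sub_add_cancel (poleShift_le b)

theorem basisWeight_eq {ℓ : ℕ} (d : Fin ℓ → ℕ) (b : BasisIdx ℓ) :
    basisWeight d b = (weightNum b : ℚ) / d b.1.1 := by
  have h := poleShift_le b
  unfold basisWeight weightNum
  split_ifs with h1
  · simp [poleShift, h1]
  · rw [Nat.cast_sub h]
    simp [poleShift, h1]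

/-- The discrete data of a block of the matrix: its basis elements, the residues of `p` times the
numerators of their weights, and the bounds for the truncation of the expansions. -/
structure BlockShape {ℓ : ℕ} (d : Fin ℓ → ℕ) (k : ℕ) where
  /-- all pole orders are positive -/
  pos : ∀ j, 1 ≤ d j
  /-- the basis elements -/
  idx : Fin k → BasisIdx ℓ
  /-- the residues -/
  res : Fin k → ℕ
  /-- the order of truncation in the uniformiser -/
  depth : ℕ
  /-- the bound for the degree in the lower coefficients -/
  cut : ℕ
  /-- the bound for all remaining indices -/
  bound : ℕ

/-- The data over a ring from which the leading coefficients of the entries are computed. -/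
structure CoefData (R : Type*) [CommRing R] {ℓ : ℕ} (d : Fin ℓ → ℕ) (k : ℕ) where
  /-- ratios of inverse factorials -/
  ratio : Fin k → ℤ → R
  /-- the leading coefficients of the Dwork operator -/
  lead : Fin k → ℕ → R
  /-- the expansions of the local parameters at the other poles -/
  loc : Fin ℓ → Fin ℓ → PowerSeries R
  /-- the coefficients -/
  A : CoeffIdx d → R
  /-- the inverse factorials -/
  invFact : ℕ → R

variable {R R' : Type*} [CommRing R] [CommRing R'] {ℓ : ℕ} {d : Fin ℓ → ℕ} {k : ℕ}

/-- The coefficient of degree `q` in the product of a series and a monomial in local expansions. -/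
def locCoeff (W : ℕ → R) (S : Fin ℓ → PowerSeries R) (j : Fin ℓ) (w : Fin ℓ → ℕ) (q : ℕ) : R :=
  ∑ s ∈ range (q + 1), W s * PowerSeries.coeff (q - s) (∏ i ∈ univ.erase j, S i ^ w i)

/-- The same in degree `hi - lo`, which is zero for `hi < lo`. -/
def locCoeffSub (W : ℕ → R) (S : Fin ℓ → PowerSeries R) (j : Fin ℓ) (w : Fin ℓ → ℕ)
    (lo hi : ℕ) : R :=
  if lo ≤ hi then locCoeff W S j w (hi - lo) else 0

/-- The index of the leading coefficient at a pole. -/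
def topIdx (hd : ∀ j, 1 ≤ d j) (j : Fin ℓ) : CoeffIdx d :=
  ⟨j, ⟨d j - 1, by have := hd j; omega⟩⟩

namespace BlockShape

variable (B : BlockShape d k)

/-- The pole of a row. -/
def pole (a : Fin k) : Fin ℓ := (B.idx a).1.1

/-- The index of the leading coefficient at the pole of a row. -/
def top (a : Fin k) : CoeffIdx d := topIdx B.pos (B.pole a)

/-- The exponents of the local parameters in the monomial of a multi-index and a column. -/
def expo (b : Fin k) (ρ : CoeffIdx d → ℕ) : Fin ℓ → ℕ :=
  poleWeight ρ + Pi.single (B.pole b) (B.idx b).1.2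

end BlockShape

namespace CoefData

variable (D : CoefData R d k) (B : BlockShape d k)

/-- The contribution of a multi-index to a leading coefficient. -/
def term (a b : Fin k) (y h : ℕ) (ρ : CoeffIdx d → ℕ) : R :=
  D.ratio a ((y : ℤ) - h) * (∏ s, D.invFact (ρ s) * D.A s ^ ρ s) *
    D.A (B.top a) ^ (B.cut + y - h) *
    locCoeffSub (D.lead a) (D.loc (B.pole a)) (B.pole a) (B.expo b ρ)
      (d (B.pole a) * h + B.res a + poleShift (B.pole a))
      (d (B.pole a) * y + B.expo b ρ (B.pole a))

/-- The `y`-th leading coefficient of an entry. -/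
def coef (a b : Fin k) (y : ℕ) : R :=
  ∑ h ∈ range (B.cut + 1), ∑ ρ ∈ piAntidiag (univ.erase (B.top a)) h, D.term B a b y h ρ

/-- The polynomial formed by the leading coefficients of an entry. -/
def entryPoly (a b : Fin k) : Polynomial R :=
  ∑ y ∈ range (B.depth + 1), Polynomial.C (D.coef B a b y) * Polynomial.X ^ y

/-- The determinant of the block of leading coefficients. -/
def detPoly : Polynomial R := (Matrix.of fun a b => D.entryPoly B a b).det

/-- The image of the data under a ring homomorphism. -/
def map (g : R →+* R') : CoefData R' d k where
  ratio a z := g (D.ratio a z)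
  lead a n := g (D.lead a n)
  loc j i := PowerSeries.map g (D.loc j i)
  A s := g (D.A s)
  invFact n := g (D.invFact n)

theorem map_locCoeffSub (g : R →+* R') (W : ℕ → R) (S : Fin ℓ → PowerSeries R) (j : Fin ℓ)
    (w : Fin ℓ → ℕ) (lo hi : ℕ) : g (locCoeffSub W S j w lo hi) =
      locCoeffSub (fun n => g (W n)) (fun i => PowerSeries.map g (S i)) j w lo hi := by
  unfold locCoeffSub locCoeff
  split_ifs
  · rw [map_sum]
    refine sum_congr rfl fun s _ => ?_
    rw [map_mul, ← PowerSeries.coeff_map, map_prod]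
    simp only [map_pow]
  · exact map_zero g

theorem map_coef (g : R →+* R') (a b : Fin k) (y : ℕ) :
    g (D.coef B a b y) = (D.map g).coef B a b y := by
  unfold coef term
  simp only [map_sum, map_mul, map_prod, map_pow, map_locCoeffSub]
  rfl

theorem map_detPoly (g : R →+* R') : (D.detPoly B).map g = (D.map g).detPoly B := by
  unfold detPoly
  have h := RingHom.map_det (Polynomial.mapRingHom g) (Matrix.of fun a b => D.entryPoly B a b)
  rw [Polynomial.coe_mapRingHom] at h
  rw [h]
  congr 1
  ext1 a b
  simp only [RingHom.mapMatrix_apply, Matrix.map_apply, Matrix.of_apply, entryPoly,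
    Polynomial.coe_mapRingHom, Polynomial.map_sum, Polynomial.map_mul, Polynomial.map_C,
    Polynomial.map_pow, Polynomial.map_X, D.map_coef B g]

theorem coeff_detPoly_map (g : R →+* R') (t : ℕ) :
    ((D.map g).detPoly B).coeff t = g ((D.detPoly B).coeff t) := by
  rw [← map_detPoly, Polynomial.coeff_map]

theorem detPoly_congr {F F' : CoefData R d k} (e1 : F.ratio = F'.ratio) (e2 : F.lead = F'.lead)
    (e3 : ∀ j i, i ≠ j → F.loc j i = F'.loc j i) (e4 : F.A = F'.A)
    (e5 : F.invFact = F'.invFact) : F.detPoly B = F'.detPoly B := by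
  unfold detPoly entryPoly coef term locCoeffSub locCoeff
  rw [e1, e2, e4, e5]
  have e6 : ∀ (j : Fin ℓ) (w : Fin ℓ → ℕ), ∏ i ∈ univ.erase j, F.loc j i ^ w i =
      ∏ i ∈ univ.erase j, F'.loc j i ^ w i := fun j w =>
    prod_congr rfl fun i hi => by rw [e3 j i (ne_of_mem_erase hi)]
  simp only [e6]

/-- A relation compatible with the ring operations passes from the data to the coefficients of the
determinant. -/
theorem coeff_detPoly_mem {S : Subring (R × R')} {D : CoefData R d k} {D' : CoefData R' d k}
    (h1 : ∀ a z, (D.ratio a z, D'.ratio a z) ∈ S) (h2 : ∀ a n, (D.lead a n, D'.lead a n) ∈ S)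
    (h3 : ∀ j i n, i ≠ j → (PowerSeries.coeff n (D.loc j i), PowerSeries.coeff n (D'.loc j i)) ∈ S)
    (h4 : ∀ s, (D.A s, D'.A s) ∈ S) (h5 : ∀ n, (D.invFact n, D'.invFact n) ∈ S) (t : ℕ) :
    ((D.detPoly B).coeff t, (D'.detPoly B).coeff t) ∈ S := by
  classical
  -- Both data are lifted to one datum over the subring of pairs, whose two projections give them
  -- back. The expansions `loc j j` never enter the determinant and may be set to zero.
  set E : CoefData S d k :=
    { ratio := fun a z => ⟨_, h1 a z⟩
      lead := fun a n => ⟨_, h2 a n⟩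
      loc := fun j i => PowerSeries.mk fun n => if h : i ≠ j then ⟨_, h3 j i n h⟩ else 0
      A := fun s => ⟨_, h4 s⟩
      invFact := fun n => ⟨_, h5 n⟩ } with hE
  have k1 : D.detPoly B = (E.map ((RingHom.fst R R').comp S.subtype)).detPoly B := by
    refine detPoly_congr B rfl rfl (fun j i hij => ?_) rfl rfl
    ext n
    simp [hE, map, hij]
  have k2 : D'.detPoly B = (E.map ((RingHom.snd R R').comp S.subtype)).detPoly B := by
    refine detPoly_congr B rfl rfl (fun j i hij => ?_) rfl rfl
    ext n
    simp [hE, map, hij]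
  rw [k1, k2, coeff_detPoly_map, coeff_detPoly_map]
  exact ((E.detPoly B).coeff t).2

end CoefData

end LeadingCoefficients

/-! ### Identification of the leading coefficients -/

section ShiftFactor

/-- The ratio `κ! / (κ + z)!` for an integer `z`. -/
def shiftFactor {F : Type*} [Field F] (κ : F) : ℤ → F
  | Int.ofNat n => ∏ l ∈ range n, (κ + (l + 1 : ℕ))⁻¹
  | Int.negSucc n => ∏ l ∈ range (n + 1), (κ - l)

variable {F : Type*} [Field F]

theorem shiftFactor_zero (κ : F) : shiftFactor κ 0 = 1 := prod_range_zero _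

theorem inv_factorial_add (U n : ℕ) : ((U + n).factorial : F)⁻¹ =
    (U.factorial : F)⁻¹ * shiftFactor (U : F) (n : ℤ) := by
  change _ = (U.factorial : F)⁻¹ * ∏ l ∈ range n, ((U : F) + (l + 1 : ℕ))⁻¹
  induction n with
  | zero => simp
  | succ n ih =>
    rw [prod_range_succ, ← mul_assoc, ← ih, ← add_assoc, Nat.factorial_succ, Nat.cast_mul,
      mul_inv, mul_comm]
    push_cast
    rw [add_assoc]

theorem prod_range_natCast_sub [CharZero F] (U n : ℕ) (h : n ≤ U) :
    ((U - n).factorial : F)⁻¹ = (U.factorial : F)⁻¹ * ∏ l ∈ range n, ((U : F) - l) := by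
  induction n with
  | zero => simp
  | succ n ih =>
    have h1 : U - n = (U - (n + 1)) + 1 := by omega
    have h2 : (U : F) - n = ((U - (n + 1) : ℕ) : F) + 1 := by
      rw [← Nat.cast_sub (by omega), h1]; push_cast; ring
    rw [prod_range_succ, ← mul_assoc, ← ih (by omega), h1, Nat.factorial_succ, Nat.cast_mul, h2]
    have h3 : (((U - (n + 1) : ℕ) : F) + 1) ≠ 0 := Nat.cast_add_one_ne_zero _
    push_cast
    field_simp

theorem inv_factorial_eq_shiftFactor [CharZero F] {U n : ℕ} {z : ℤ} (h : (n : ℤ) = U + z) :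
    ((n.factorial : ℕ) : F)⁻¹ = (U.factorial : F)⁻¹ * shiftFactor (U : F) z := by
  rcases z with m | m
  · have : n = U + m := by
      simp only [Int.ofNat_eq_natCast] at h
      omega
    rw [this]
    exact inv_factorial_add U m
  · have h1 : m + 1 ≤ U := by
      rw [Int.negSucc_eq] at h
      omega
    have : n = U - (m + 1) := by
      rw [Int.negSucc_eq] at h
      omega
    rw [this]
    exact prod_range_natCast_sub U (m + 1) h1

/-- The product contains the factor `U - U`. So the formula gives zero by itself where an inverse
factorial of a negative integer would appear. -/
theorem shiftFactor_natCast_of_neg {U : ℕ} {z : ℤ} (h : (U : ℤ) + z < 0) :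
    shiftFactor (U : F) z = 0 := by
  rcases z with m | m
  · simp only [Int.ofNat_eq_natCast] at h
    omega
  · rw [Int.negSucc_eq] at h
    exact prod_eq_zero (mem_range.mpr (show U < m + 1 by omega)) (sub_self _)

end ShiftFactor

/-! ### Pole orders of multi-indices -/

section Weights

variable {ℓ : ℕ} {d : Fin ℓ → ℕ}

theorem poleWeight_add (r r' : CoeffIdx d → ℕ) :
    poleWeight (r + r') = poleWeight r + poleWeight r' := by
  ext j
  simp only [poleWeight, Pi.add_apply, mul_add, sum_add_distrib]

theorem poleWeight_eq_sum (r : CoeffIdx d → ℕ) (j : Fin ℓ) :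
    poleWeight r j = ∑ s : CoeffIdx d, (if s.1 = j then s.2.val + 1 else 0) * r s := by
  rw [Fintype.sum_sigma, sum_eq_single j]
  · simp [poleWeight]
  · intro i _ hi
    simp [hi]
  · simp

theorem poleWeight_single (s : CoeffIdx d) (n : ℕ) (j : Fin ℓ) :
    poleWeight (Pi.single s n) j = if s.1 = j then (s.2.val + 1) * n else 0 := by
  rw [poleWeight_eq_sum, sum_eq_single s]
  · simp
  · intro t _ ht
    rw [Pi.single_eq_of_ne ht, mul_zero]
  · simp

theorem poleWeight_single_topIdx (hd : ∀ j, 1 ≤ d j) (j : Fin ℓ) (n : ℕ) :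
    poleWeight (Pi.single (topIdx hd j) n) j = d j * n := by
  rw [poleWeight_single, if_pos (by rfl)]
  congr 1
  exact Nat.sub_add_cancel (hd j)

theorem poleWeight_single_topIdx_of_ne (hd : ∀ j, 1 ≤ d j) {j i : Fin ℓ} (h : i ≠ j) (n : ℕ) :
    poleWeight (Pi.single (topIdx hd j) n) i = 0 := by
  rw [poleWeight_single]
  exact if_neg (Ne.symm h)

/-- Every index other than the leading one at `j` contributes at most `d j - 1` to the pole order at
`j`. Each unit of `ρ` thus loses at least one against the leading index, which bounds the size of
the relevant `ρ` independently of `p`. -/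
theorem poleWeight_add_sum_le (hd : ∀ j, 1 ≤ d j) {j : Fin ℓ} {h : ℕ} {ρ : CoeffIdx d → ℕ}
    (hρ : ρ ∈ piAntidiag (univ.erase (topIdx hd j)) h) : poleWeight ρ j + h ≤ d j * h := by
  have h0 : ρ (topIdx hd j) = 0 := by
    by_contra hne
    exact (mem_erase.mp ((mem_piAntidiag.mp hρ).2 _ hne)).1 rfl
  have hs : ∑ s, ρ s = h := by
    rw [← (mem_piAntidiag.mp hρ).1]
    exact (sum_erase univ h0).symm
  rw [poleWeight_eq_sum, ← hs, mul_sum, ← sum_add_distrib]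
  refine sum_le_sum fun s _ => ?_
  by_cases hst : s = topIdx hd j
  · rw [hst, h0]; simp
  · rw [← Nat.succ_mul]
    refine Nat.mul_le_mul_right _ ?_
    split_ifs with hj
    · obtain ⟨i, l⟩ := s
      subst hj
      have h1 := l.2
      have h2 : l.val ≠ d i - 1 := by
        intro h'
        apply hst
        simp only [topIdx]
        congr 1
        exact Fin.ext h'
      simp only
      omega
    · exact hd j

end Weights

/-! ### Separation of the main part of a coefficient from the low exponents -/

section RowSplit

variable {K : Type*} [Field K] {ℓ : ℕ} {d : Fin ℓ → ℕ}

/-- The main part of a coefficient of the operator: the contribution of the exponents from `lo`. -/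
def rowMain (p : ℕ) (Q : Fin ℓ → K) (w : Fin ℓ → ℕ) (j : Fin ℓ) (m lo : ℕ) : K :=
  locCoeffSub (fun s => uCoeff p Q j m (lo + s)) (locSeries Q j) j w lo (w j)

/-- Applied with `lo = pν + poleShift`, the first exponent whose image under `U_p` contains the
wanted power with a unit coefficient. The sum over smaller exponents is an error term. -/
theorem rowCoeff_eq_add_rowMain (p : ℕ) (Q : Fin ℓ → K) (w : Fin ℓ → ℕ) (j : Fin ℓ) (m : ℕ)
    {lo : ℕ} (hlo : 1 ≤ lo ∨ j.val = 0) :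
    rowCoeff p Q w j m =
      ∑ n ∈ range lo, uCoeff p Q j m n * pfCoeff Q w j n + rowMain p Q w j m lo := by
  rw [rowCoeff_eq_sum_range Q w j m (M := lo + (w j + 1)) (by omega), sum_range_add]
  congr 1
  unfold rowMain locCoeffSub
  split_ifs with h
  · unfold locCoeff
    symm
    refine sum_subset_zero_on_sdiff (range_subset_range.mpr (by omega)) (fun s hs => ?_)
      fun s hs => ?_
    · rw [Finset.mem_sdiff, mem_range, mem_range] at hs
      rw [pfCoeff_of_lt Q (by omega), mul_zero]
    · rw [mem_range] at hs
      rw [pfCoeff, if_pos ⟨by omega, by omega⟩, restSeries]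
      congr 3
      omega
  · refine sum_eq_zero fun s _ => ?_
    rw [pfCoeff_of_lt Q (by omega), mul_zero]

/-- Only the difference `hi - lo` and the exponents at the other poles matter. A multiple of `d_j U`
common to both bounds, the only large quantity, therefore cancels. -/
theorem locCoeffSub_congr {R : Type*} [CommRing R] {W W' : ℕ → R} {S : Fin ℓ → PowerSeries R}
    {j : Fin ℓ} {w w' : Fin ℓ → ℕ} {lo hi lo' hi' : ℕ} (hw : ∀ i ≠ j, w i = w' i)
    (h : lo + hi' = lo' + hi) {c : R} (hW : ∀ s ≤ hi - lo, W s = c * W' s) :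
    locCoeffSub W S j w lo hi = c * locCoeffSub W' S j w' lo' hi' := by
  unfold locCoeffSub
  by_cases h1 : lo ≤ hi
  · rw [if_pos h1, if_pos (by omega)]
    have h2 : hi' - lo' = hi - lo := by omega
    unfold locCoeff
    rw [h2, mul_sum]
    refine sum_congr rfl fun s hs => ?_
    rw [mem_range] at hs
    rw [hW s (by omega), mul_assoc]
    congr 3
    exact prod_congr rfl fun i hi => by rw [hw i (ne_of_mem_erase hi)]
  · rw [if_neg h1, if_neg (by omega), mul_zero]

end RowSplit

/-- The `p`-adic data of a block. -/
def padicData {K : Type*} [Field K] {ℓ : ℕ} {d : Fin ℓ → ℕ} {k : ℕ} (p : ℕ) (B : BlockShape d k)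
    (A : CoeffIdx d → K) (Q : Fin ℓ → K) : CoefData K d k where
  -- The cut-offs here and below discard only arguments that do not occur for a large shape, and
  -- they keep every value `p`-integral for large `p`.
  ratio a z := if z ≤ B.depth then
    shiftFactor ((p * weightNum (B.idx a) / d (B.pole a) : ℕ) : K) z else 0
  lead a n := if n ≤ B.bound then uCoeff p Q (B.pole a) (B.idx a).1.2
    (p * weightNum (B.idx a) + poleShift (B.pole a) + n) *
      (Q (B.pole a) ^ ((p - 1) * poleShift (B.pole a)))⁻¹ else 0
  loc := locSeries Q
  A := A
  invFact n := if n ≤ B.bound then (n.factorial : K)⁻¹ else 0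

/-- The bounds of a block shape are large enough. -/
structure BlockShape.IsLarge {ℓ : ℕ} {d : Fin ℓ → ℕ} {k : ℕ} (B : BlockShape d k) : Prop where
  weight_lt : ∀ a, weightNum (B.idx a) < d (B.pole a)
  le_cut : ∀ a b, d (B.pole a) * B.depth + (B.idx b).1.2 ≤ B.cut
  le_bound : ∀ a b, d (B.pole a) * (B.depth + B.cut) + (B.idx b).1.2 ≤ B.bound
  cut_le_bound : B.cut ≤ B.bound

/-! ### The leading coefficients of a row after removal of `γ ^ U` -/

section Main

variable {K : Type*} [Field K] [CharZero K] {ℓ : ℕ} {d : Fin ℓ → ℕ} {k : ℕ} {p : ℕ}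

/-- The main part of the coefficient of `γ ^ N` in an entry. -/
def mainCoeff (p : ℕ) (u : ℕ → K) (A : CoeffIdx d → K) (Q : Fin ℓ → K) (B : BlockShape d k)
    (a b : Fin k) (N : ℕ) : K :=
  ∑ r ∈ piAntidiag univ N, (∏ s, u (r s) * A s ^ r s) *
    rowMain p Q (B.expo b r) (B.pole a) (B.idx a).1.2
      (p * weightNum (B.idx a) + poleShift (B.pole a))

/-- The common factor of the leading coefficients of a row. -/
def rowScalar (p : ℕ) (A : CoeffIdx d → K) (Q : Fin ℓ → K) (B : BlockShape d k) (a : Fin k) : K :=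
  ((p * weightNum (B.idx a) / d (B.pole a)).factorial : K)⁻¹ *
    -- Splitting off `U - cut` instead of `U` leaves the exponent `cut + y - h`, which is never
    -- negative, so that the remaining coefficient is polynomial in `A`.
    A (B.top a) ^ ((p * weightNum (B.idx a) / d (B.pole a) : ℕ) - B.cut : ℤ) *
    Q (B.pole a) ^ ((p - 1) * poleShift (B.pole a))

variable {u : ℕ → K} {A : CoeffIdx d → K} {Q : Fin ℓ → K} {B : BlockShape d k}

theorem mainCoeff_eq_sum (a b : Fin k) (N : ℕ) :
    mainCoeff p u A Q B a b N = ∑ h ∈ range (N + 1), ∑ ρ ∈ piAntidiag (univ.erase (B.top a)) h,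
      (∏ s, u ((ρ + Pi.single (B.top a) (N - h) : CoeffIdx d → ℕ) s) *
        A s ^ (ρ + Pi.single (B.top a) (N - h) : CoeffIdx d → ℕ) s) *
      rowMain p Q (B.expo b (ρ + Pi.single (B.top a) (N - h))) (B.pole a) (B.idx a).1.2
        (p * weightNum (B.idx a) + poleShift (B.pole a)) := by
  unfold mainCoeff
  have hu : (univ : Finset (CoeffIdx d)) = insert (B.top a) (univ.erase (B.top a)) :=
    (insert_erase (mem_univ _)).symm
  conv_lhs => rw [hu]
  rw [sum_piAntidiag_insert (notMem_erase _ _), ← Nat.sum_antidiagonal_swap,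
    Nat.sum_antidiagonal_eq_sum_range_succ_mk]
  simp only [Prod.snd_swap, Prod.fst_swap]
  rw [← hu]

theorem expo_add_top_pole (a b : Fin k) (ρ : CoeffIdx d → ℕ) (n : ℕ) :
    B.expo b (ρ + Pi.single (B.top a) n) (B.pole a) =
      d (B.pole a) * n + B.expo b ρ (B.pole a) := by
  unfold BlockShape.expo BlockShape.top
  rw [poleWeight_add]
  simp only [Pi.add_apply, poleWeight_single_topIdx]
  ring

theorem expo_add_top_of_ne (a b : Fin k) (ρ : CoeffIdx d → ℕ) (n : ℕ) {i : Fin ℓ}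
    (hi : i ≠ B.pole a) : B.expo b (ρ + Pi.single (B.top a) n) i = B.expo b ρ i := by
  unfold BlockShape.expo BlockShape.top
  rw [poleWeight_add]
  simp only [Pi.add_apply, poleWeight_single_topIdx_of_ne B.pos hi, add_zero]

theorem single_pole_le (a b : Fin k) :
    (Pi.single (B.pole b) (B.idx b).1.2 : Fin ℓ → ℕ) (B.pole a) ≤ (B.idx b).1.2 := by
  by_cases h : B.pole a = B.pole b
  · rw [h, Pi.single_eq_same]
  · rw [Pi.single_eq_of_ne h]
    exact Nat.zero_le _

theorem single_pole_lt (hB : B.IsLarge) (a b : Fin k) :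
    (Pi.single (B.pole b) (B.idx b).1.2 : Fin ℓ → ℕ) (B.pole a) <
      d (B.pole a) + poleShift (B.pole a) := by
  by_cases h : B.pole a = B.pole b
  · rw [h, Pi.single_eq_same]
    have h1 := hB.weight_lt b
    have h2 : weightNum (B.idx b) + poleShift (B.pole b) = (B.idx b).1.2 := weightNum_add (B.idx b)
    omega
  · rw [Pi.single_eq_of_ne h]
    have := B.pos (B.pole a)
    omega

theorem expo_pole_add_le {a : Fin k} (b : Fin k) {h : ℕ} {ρ : CoeffIdx d → ℕ}
    (hρ : ρ ∈ piAntidiag (univ.erase (B.top a)) h) :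
    B.expo b ρ (B.pole a) + h ≤ d (B.pole a) * h +
      (Pi.single (B.pole b) (B.idx b).1.2 : Fin ℓ → ℕ) (B.pole a) := by
  have := poleWeight_add_sum_le B.pos hρ
  unfold BlockShape.expo
  simp only [Pi.add_apply]
  omega

/-- A monomial of degree `N < U` times the column element has order below `d (N + 1) + poleShift ≤
pν + poleShift` at the pole of the row. -/
theorem mainCoeff_of_lt (hB : B.IsLarge) {a : Fin k} (b : Fin k) {N : ℕ}
    (hN : N < p * weightNum (B.idx a) / d (B.pole a)) : mainCoeff p u A Q B a b N = 0 := by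
  rw [mainCoeff_eq_sum]
  refine sum_eq_zero fun h hh => sum_eq_zero fun ρ hρ => ?_
  rw [mem_range] at hh
  rw [rowMain, locCoeffSub, if_neg, mul_zero]
  rw [expo_add_top_pole, not_le]
  have h1 := expo_pole_add_le b hρ
  have h2 := single_pole_lt hB a b
  have h3 : d (B.pole a) * (N - h) + d (B.pole a) * h = d (B.pole a) * N := by
    rw [← mul_add]; congr 1; omega
  have h4 : d (B.pole a) * (N + 1) ≤ p * weightNum (B.idx a) :=
    (Nat.mul_le_mul_left _ hN).trans (Nat.mul_div_le _ _)
  rw [mul_add, mul_one] at h4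
  omega

/-- Split a multi-index of degree `U + y` into `U + y - h` copies of the leading index and a
remainder `ρ` of degree `h`. The pole order needed forces `h ≤ d y + n` with `n` the exponent of the
column, hence `h ≤ cut`. The dependence on `U` then factors out: `1/(U + y - h)!` is `1/U!` times a
short product, the power of the leading coefficient splits, and the local coefficient sees only
differences of orders. -/
theorem mainCoeff_add (hB : B.IsLarge) (hu : ∀ n < p, u n = (n.factorial : K)⁻¹) {a : Fin k}
    (b : Fin k) (hA : A (B.top a) ≠ 0) (hQ : 2 ≤ (B.pole a).val → Q (B.pole a) ≠ 0)
    (hres : B.res a = p * weightNum (B.idx a) % d (B.pole a))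
    (hp : p * weightNum (B.idx a) / d (B.pole a) + B.depth < p) {y : ℕ} (hy : y ≤ B.depth) :
    mainCoeff p u A Q B a b (p * weightNum (B.idx a) / d (B.pole a) + y) =
      rowScalar p A Q B a * (padicData p B A Q).coef B a b y := by
  rw [mainCoeff_eq_sum, CoefData.coef, mul_sum]
  obtain ⟨U, hU⟩ : ∃ U, U = p * weightNum (B.idx a) / d (B.pole a) := ⟨_, rfl⟩
  rw [← hU] at hp ⊢
  have hdiv : d (B.pole a) * U + B.res a = p * weightNum (B.idx a) := by
    rw [hU, hres]; exact Nat.div_add_mod _ _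
  have hdy : d (B.pole a) * y ≤ d (B.pole a) * B.depth := Nat.mul_le_mul_left _ hy
  have hcut := hB.le_cut a b
  have hbound := hB.le_bound a b
  have hQ0 : Q (B.pole a) ^ ((p - 1) * poleShift (B.pole a)) ≠ 0 := by
    by_cases h2 : 2 ≤ (B.pole a).val
    · exact pow_ne_zero _ (hQ h2)
    · have : poleShift (B.pole a) = 0 := by
        unfold poleShift; rw [if_pos (by omega)]
      rw [this, mul_zero, pow_zero]; exact one_ne_zero
  -- vanishing beyond the cut
  have hvan : ∀ h ρ, ρ ∈ piAntidiag (univ.erase (B.top a)) h → B.cut < h → h ≤ U + y →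
      rowMain p Q (B.expo b (ρ + Pi.single (B.top a) (U + y - h))) (B.pole a) (B.idx a).1.2
        (p * weightNum (B.idx a) + poleShift (B.pole a)) = 0 := by
    intro h ρ hρ h1 h2
    rw [rowMain, locCoeffSub, if_neg]
    rw [expo_add_top_pole, not_le, ← hdiv]
    have h3 := expo_pole_add_le b hρ
    have h4 := single_pole_le (B := B) a b
    have h5 : d (B.pole a) * (U + y - h) + d (B.pole a) * h =
        d (B.pole a) * U + d (B.pole a) * y := by
      rw [← mul_add, ← mul_add]; congr 1; omega
    omega
  have hF : ∀ h ∈ range (U + y + 1), h ∉ range (min (U + y) B.cut + 1) →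
      ∑ ρ ∈ piAntidiag (univ.erase (B.top a)) h,
      (∏ s, u ((ρ + Pi.single (B.top a) (U + y - h) : CoeffIdx d → ℕ) s) *
        A s ^ (ρ + Pi.single (B.top a) (U + y - h) : CoeffIdx d → ℕ) s) *
      rowMain p Q (B.expo b (ρ + Pi.single (B.top a) (U + y - h))) (B.pole a) (B.idx a).1.2
        (p * weightNum (B.idx a) + poleShift (B.pole a)) = 0 := by
    intro h h1 h2
    rw [mem_range] at h1 h2
    refine sum_eq_zero fun ρ hρ => ?_
    rw [hvan h ρ hρ (by omega) (by omega), mul_zero]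
  -- When `h > U + y` no multi-index exists, and on the other side the factor `ratio` vanishes.
  have hG : ∀ h ∈ range (B.cut + 1), h ∉ range (min (U + y) B.cut + 1) →
      rowScalar p A Q B a * ∑ ρ ∈ piAntidiag (univ.erase (B.top a)) h,
        (padicData p B A Q).term B a b y h ρ = 0 := by
    intro h h1 h2
    rw [mem_range] at h1 h2
    rw [sum_eq_zero, mul_zero]
    intro ρ _
    have : (padicData p B A Q).ratio a ((y : ℤ) - h) = 0 := by
      simp only [padicData]
      split_ifs
      · rw [← hU]
        exact shiftFactor_natCast_of_neg (by omega)
      · rfl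
    rw [CoefData.term, this]
    simp only [zero_mul]
  rw [← sum_subset (range_subset_range.mpr (by omega)) hF,
    ← sum_subset (range_subset_range.mpr (by omega)) hG]
  refine sum_congr rfl fun h hh => ?_
  rw [mem_range] at hh
  rw [mul_sum]
  refine sum_congr rfl fun ρ hρ => ?_
  have hρ0 : ρ (B.top a) = 0 := by
    by_contra hne
    exact (mem_erase.mp ((mem_piAntidiag.mp hρ).2 _ hne)).1 rfl
  have hρle : ∀ s, ρ s ≤ h := by
    intro s
    by_cases hs : s = B.top a
    · rw [hs, hρ0]; exact Nat.zero_le _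
    · rw [← (mem_piAntidiag.mp hρ).1]
      exact single_le_sum (f := ρ) (fun _ _ => Nat.zero_le _) (mem_erase.mpr ⟨hs, mem_univ s⟩)
  have hu0 : u 0 = 1 := by rw [hu 0 (by omega)]; simp
  have e1 : ∏ s, u ((ρ + Pi.single (B.top a) (U + y - h) : CoeffIdx d → ℕ) s) *
      A s ^ (ρ + Pi.single (B.top a) (U + y - h) : CoeffIdx d → ℕ) s =
      (u (U + y - h) * A (B.top a) ^ (U + y - h)) * ∏ s, u (ρ s) * A s ^ ρ s := by
    rw [← mul_prod_erase univ _ (mem_univ (B.top a)),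
      ← mul_prod_erase univ (fun s => u (ρ s) * A s ^ ρ s) (mem_univ (B.top a))]
    simp only [Pi.add_apply, Pi.single_eq_same, hρ0, zero_add, hu0, pow_zero, mul_one, one_mul]
    congr 1
    refine prod_congr rfl fun s hs => ?_
    rw [Pi.single_eq_of_ne (ne_of_mem_erase hs), add_zero]
  have e2 : ∏ s, u (ρ s) * A s ^ ρ s =
      ∏ s, (padicData p B A Q).invFact (ρ s) * (padicData p B A Q).A s ^ ρ s := by
    refine prod_congr rfl fun s _ => ?_
    have h1 := hρle s
    have h2 := hB.cut_le_bound
    simp only [padicData]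
    rw [if_pos (by omega), hu (ρ s) (by omega)]
  have e3 : u (U + y - h) = (U.factorial : K)⁻¹ * (padicData p B A Q).ratio a ((y : ℤ) - h) := by
    rw [hu _ (by omega), inv_factorial_eq_shiftFactor (U := U) (z := (y : ℤ) - h) (by omega)]
    simp only [padicData]
    rw [if_pos (by omega), hU]
  have e4 : A (B.top a) ^ (U + y - h) =
      A (B.top a) ^ ((U : ℤ) - B.cut) * (padicData p B A Q).A (B.top a) ^ (B.cut + y - h) := by
    simp only [padicData]
    rw [← zpow_natCast, ← zpow_natCast, ← zpow_add₀ hA]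
    congr 1
    omega
  have e5 : rowMain p Q (B.expo b (ρ + Pi.single (B.top a) (U + y - h))) (B.pole a)
      (B.idx a).1.2 (p * weightNum (B.idx a) + poleShift (B.pole a)) =
      Q (B.pole a) ^ ((p - 1) * poleShift (B.pole a)) *
      locCoeffSub ((padicData p B A Q).lead a) ((padicData p B A Q).loc (B.pole a)) (B.pole a)
        (B.expo b ρ) (d (B.pole a) * h + B.res a + poleShift (B.pole a))
        (d (B.pole a) * y + B.expo b ρ (B.pole a)) := by
    have h5 : d (B.pole a) * (U + y - h) + d (B.pole a) * h =
        d (B.pole a) * U + d (B.pole a) * y := by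
      rw [← mul_add, ← mul_add]; congr 1; omega
    refine locCoeffSub_congr (fun i hi => expo_add_top_of_ne a b ρ _ hi) ?_ fun s hs => ?_
    · rw [expo_add_top_pole, ← hdiv]
      omega
    · have hsb : s ≤ B.bound := by
        rw [expo_add_top_pole, ← hdiv] at hs
        have h3 := expo_pole_add_le b hρ
        have h4 := single_pole_le (B := B) a b
        have h6 : d (B.pole a) * h ≤ d (B.pole a) * B.cut := Nat.mul_le_mul_left _ (by omega)
        rw [mul_add] at hbound
        omega
      simp only [padicData]
      rw [if_pos hsb, mul_left_comm, mul_inv_cancel₀ hQ0, mul_one]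
  rw [e1, e2, e3, e4, e5, CoefData.term, rowScalar, ← hU]
  ring

end Main

/-! ### Estimates for the coefficients of the Dwork operator -/

section DworkEstimates

variable {K : Type*} [NormedField K] [IsUltrametricDist K]

theorem exists_shift_pow_eq {p : ℕ} (hp : p.Prime) {x : K} (hx : ‖x‖ ≤ 1) :
    ∃ h ∈ seriesSubring (unitBall K), (PowerSeries.C x + PowerSeries.X) ^ p =
      PowerSeries.C (x ^ p) + PowerSeries.X ^ p +
        PowerSeries.C (p : K) * (PowerSeries.X * h) := by
  obtain ⟨r, hr⟩ := exists_add_pow_prime_pow_eq hp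
    (⟨_, C_mem_seriesSubring (S := unitBall K) hx⟩ : seriesSubring (unitBall K))
    ⟨_, X_mem_seriesSubring (unitBall K)⟩ 1
  refine ⟨PowerSeries.C x * r, (seriesSubring _).mul_mem (C_mem_seriesSubring hx) r.2, ?_⟩
  have h := congrArg (Subring.subtype (seriesSubring (unitBall K))) hr
  rw [pow_one] at h
  simp only [Subring.subtype_apply, Subring.coe_pow, Subring.coe_add, Subring.coe_mul,
    Subring.coe_natCast] at h
  rw [h, map_pow, map_natCast]
  ring

theorem norm_coeff_mul_le {f g : PowerSeries K} {c c' ρ : ℝ} (hρ : 0 ≤ ρ) (hc : 0 ≤ c)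
    (hf : ∀ t, ‖PowerSeries.coeff t f‖ * ρ ^ t ≤ c)
    (hg : ∀ t, ‖PowerSeries.coeff t g‖ * ρ ^ t ≤ c') (t : ℕ) :
    ‖PowerSeries.coeff t (f * g)‖ * ρ ^ t ≤ c * c' := by
  rw [PowerSeries.coeff_mul]
  have hpt : ∀ kl ∈ HasAntidiagonal.antidiagonal t,
      ‖PowerSeries.coeff kl.1 f * PowerSeries.coeff kl.2 g‖ * ρ ^ t ≤ c * c' := by
    intro kl hkl
    rw [HasAntidiagonal.mem_antidiagonal] at hkl
    rw [← hkl, pow_add, norm_mul]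
    calc _ = (‖PowerSeries.coeff kl.1 f‖ * ρ ^ kl.1) * (‖PowerSeries.coeff kl.2 g‖ * ρ ^ kl.2) := by
          ring
      _ ≤ c * c' := mul_le_mul (hf _) (hg _) (by positivity) hc
  obtain ⟨kl, hkl, h⟩ := IsUltrametricDist.exists_norm_finsetSum_le_of_nonempty
    (t := HasAntidiagonal.antidiagonal t) ⟨(0, t), by simp⟩
    (fun kl => PowerSeries.coeff kl.1 f * PowerSeries.coeff kl.2 g)
  exact (mul_le_mul_of_nonneg_right h (by positivity)).trans (hpt kl hkl)

theorem norm_coeff_pow_le {f : PowerSeries K} {c ρ : ℝ} (hρ : 0 ≤ ρ) (hρ1 : ρ ≤ 1) (hc : 0 ≤ c)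
    (hf : ∀ t, ‖PowerSeries.coeff t f‖ * ρ ^ t ≤ c) (n t : ℕ) :
    ‖PowerSeries.coeff t (f ^ n)‖ * ρ ^ t ≤ c ^ n := by
  induction n generalizing t with
  | zero =>
    rw [pow_zero, pow_zero, PowerSeries.coeff_one]
    split_ifs
    · simpa using pow_le_one₀ hρ hρ1
    · simp
  | succ n ih =>
    rw [pow_succ, pow_succ]
    exact norm_coeff_mul_le hρ (by positivity) ih hf t

/-- A Gauss norm argument on the disc of radius `‖γ‖`: since `‖p γ‖ = ‖γ‖ ^ p`, the series `(x +
X)^p - x^p = X^p + p X h` has weighted norm at most `‖γ‖ ^ p`, and its `(m - 1)`-st power at most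
`‖γ‖ ^ (p (m - 1))`. -/
theorem norm_dworkCoeff_le_pow {p : ℕ} (hp : p.Prime) {γ : K} (hγ : γ ≠ 0) (hγ1 : ‖γ‖ ≤ 1)
    (hγp : ‖γ‖ ^ (p - 1) = ‖(p : K)‖) {x : K} (hx : ‖x‖ ≤ 1) (m n : ℕ) {y : ℕ}
    (hy : n - 1 + y = p * (m - 1)) : ‖dworkCoeff p x m n‖ ≤ ‖γ‖ ^ y := by
  obtain ⟨h, hh, e⟩ := exists_shift_pow_eq hp hx
  have hpos : 0 < ‖γ‖ := norm_pos_iff.mpr hγ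
  have h1 : ∀ t, ‖PowerSeries.coeff t ((PowerSeries.C x + PowerSeries.X) ^ p -
      PowerSeries.C (x ^ p))‖ * ‖γ‖ ^ t ≤ ‖γ‖ ^ p := by
    intro t
    have e' : (PowerSeries.C x + PowerSeries.X) ^ p - PowerSeries.C (x ^ p) =
        PowerSeries.X ^ p + PowerSeries.C (p : K) * (PowerSeries.X * h) := by
      rw [e]; ring
    rw [e', map_add]
    have h2 : ‖PowerSeries.coeff t ((PowerSeries.X : PowerSeries K) ^ p)‖ * ‖γ‖ ^ t ≤ ‖γ‖ ^ p := by
      rw [PowerSeries.coeff_X_pow]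
      split_ifs with h
      · rw [h]; simp
      · simp
    have h3 : ‖PowerSeries.coeff t (PowerSeries.C (p : K) * (PowerSeries.X * h))‖ * ‖γ‖ ^ t ≤
        ‖γ‖ ^ p := by
      rw [PowerSeries.coeff_C_mul]
      rcases t with _ | t
      · simp
      · rw [PowerSeries.coeff_succ_X_mul, norm_mul, ← hγp]
        have h4 : ‖PowerSeries.coeff t h‖ ≤ 1 := hh t
        have h5 : ‖γ‖ ^ t ≤ 1 := pow_le_one₀ hpos.le hγ1
        calc ‖γ‖ ^ (p - 1) * ‖PowerSeries.coeff t h‖ * ‖γ‖ ^ (t + 1) ≤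
              ‖γ‖ ^ (p - 1) * 1 * (1 * ‖γ‖) := by rw [pow_succ]; gcongr
          _ = ‖γ‖ ^ p := by
              rw [mul_one, one_mul, ← pow_succ, Nat.sub_add_cancel hp.one_le]
    refine (mul_le_mul_of_nonneg_right (IsUltrametricDist.norm_add_le_max _ _)
      (by positivity)).trans ?_
    rw [max_mul_of_nonneg _ _ (by positivity)]
    exact max_le h2 h3
  have h0 : ∀ t, ‖PowerSeries.coeff t ((PowerSeries.C x + PowerSeries.X) ^ (p - 1))‖ *
      ‖γ‖ ^ t ≤ 1 := by
    intro t
    refine mul_le_one₀ ?_ (by positivity) (pow_le_one₀ hpos.le hγ1)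
    exact (seriesSubring _).pow_mem ((seriesSubring _).add_mem
      (C_mem_seriesSubring (S := unitBall K) hx) (X_mem_seriesSubring _)) _ t
  have h4 := norm_coeff_mul_le hpos.le zero_le_one h0
    (norm_coeff_pow_le hpos.le hγ1 (by positivity) h1 (m - 1)) (n - 1)
  rw [one_mul, ← pow_mul, ← hy, pow_add, mul_comm (‖γ‖ ^ (n - 1))] at h4
  exact le_of_mul_le_mul_right h4 (by positivity)

/-- Modulo `p` the difference `(x + X)^p - x^p` is `X^p`. -/
theorem exists_dworkSeries_eq {p : ℕ} (hp : p.Prime) {x : K} (hx : ‖x‖ ≤ 1) (ν : ℕ) :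
    ∃ g ∈ seriesSubring (unitBall K), (PowerSeries.C x + PowerSeries.X) ^ (p - 1) *
      ((PowerSeries.C x + PowerSeries.X) ^ p - PowerSeries.C (x ^ p)) ^ ν =
      (PowerSeries.C x + PowerSeries.X) ^ (p - 1) * PowerSeries.X ^ (p * ν) +
        PowerSeries.C (p : K) * g := by
  obtain ⟨h, hh, e⟩ := exists_shift_pow_eq hp hx
  have e' : (PowerSeries.C x + PowerSeries.X) ^ p - PowerSeries.C (x ^ p) =
      PowerSeries.X ^ p + PowerSeries.C (p : K) * (PowerSeries.X * h) := by
    rw [e]; ring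
  have hX := X_mem_seriesSubring (unitBall K)
  have hCX := (seriesSubring _).add_mem (C_mem_seriesSubring (S := unitBall K) hx) hX
  have hpC := C_mem_seriesSubring (S := unitBall K) (IsUltrametricDist.norm_natCast_le_one K p)
  have key : ∃ g ∈ seriesSubring (unitBall K), (PowerSeries.X ^ p + PowerSeries.C (p : K) *
      (PowerSeries.X * h)) ^ ν = PowerSeries.X ^ (p * ν) + PowerSeries.C (p : K) * g := by
    induction ν with
    | zero => exact ⟨0, Subring.zero_mem _, by simp⟩
    | succ ν ih =>
      obtain ⟨g, hg, hge⟩ := ih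
      refine ⟨PowerSeries.X ^ (p * ν) * (PowerSeries.X * h) + g * (PowerSeries.X ^ p +
        PowerSeries.C (p : K) * (PowerSeries.X * h)), ?_, ?_⟩
      · have hXh := (seriesSubring _).mul_mem hX hh
        exact (seriesSubring _).add_mem
          ((seriesSubring _).mul_mem ((seriesSubring _).pow_mem hX _) hXh)
          ((seriesSubring _).mul_mem hg ((seriesSubring _).add_mem
            ((seriesSubring _).pow_mem hX _) ((seriesSubring _).mul_mem hpC hXh)))
      · rw [pow_succ, hge, mul_add p, pow_add, mul_one]
        ring
  obtain ⟨g, hg, hge⟩ := key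
  refine ⟨(PowerSeries.C x + PowerSeries.X) ^ (p - 1) * g,
    (seriesSubring _).mul_mem ((seriesSubring _).pow_mem hCX _) hg, ?_⟩
  rw [e', hge]
  ring

theorem norm_dworkCoeff_le_prime {p : ℕ} (hp : p.Prime) {x : K} (hx : ‖x‖ ≤ 1) {m n : ℕ}
    (hn : n - 1 < p * (m - 1)) : ‖dworkCoeff p x m n‖ ≤ ‖(p : K)‖ := by
  obtain ⟨g, hg, e⟩ := exists_dworkSeries_eq hp hx (m - 1)
  rw [dworkCoeff, e, map_add, PowerSeries.coeff_mul_X_pow', if_neg (by omega), zero_add,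
    PowerSeries.coeff_C_mul, norm_mul]
  exact mul_le_of_le_one_right (norm_nonneg _) (hg _)

/-- Modulo `p` the coefficient is that of `X^s` in `(x + X)^{p-1} = (x^p + X^p)/(x + X)`. For `s <
p` the term `X^p` plays no role, and `x^p/(x + X)` has coefficients `x^{p-1} (-1/x)^s`. -/
theorem norm_dworkCoeff_sub_le {p : ℕ} (hp : p.Prime) {x : K} (hx : ‖x‖ = 1) {ν s : ℕ}
    (hs : s < p) : ‖dworkCoeff p x (ν + 1) (p * ν + 1 + s) * (x ^ (p - 1))⁻¹ - (-x⁻¹) ^ s‖ ≤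
      ‖(p : K)‖ := by
  have hx0 : x ≠ 0 := norm_ne_zero_iff.mp (by rw [hx]; exact one_ne_zero)
  obtain ⟨g, hg, e⟩ := exists_dworkSeries_eq hp hx.le ν
  obtain ⟨h, hh, e2⟩ := exists_shift_pow_eq hp hx.le
  -- the inverse of `x + X`
  set V : PowerSeries K := PowerSeries.mk fun n => x⁻¹ * (-x⁻¹) ^ n with hV
  have hV1 : (PowerSeries.C x + PowerSeries.X) * V = 1 := by
    ext n
    rw [add_mul, map_add, PowerSeries.coeff_C_mul, PowerSeries.coeff_one]
    rcases n with _ | n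
    · simp [hV, hx0]
    · rw [PowerSeries.coeff_succ_X_mul, hV, PowerSeries.coeff_mk, PowerSeries.coeff_mk,
        if_neg (Nat.succ_ne_zero n), ← mul_assoc, mul_inv_cancel₀ hx0, pow_succ]
      ring
  have hVm : V ∈ seriesSubring (unitBall K) := by
    intro n
    rw [hV, PowerSeries.coeff_mk, mem_unitBall, norm_mul, norm_pow, norm_neg, norm_inv, hx]
    simp
  have e3 : (PowerSeries.C x + PowerSeries.X) ^ (p - 1) = PowerSeries.C (x ^ p) * V +
      V * PowerSeries.X ^ p + PowerSeries.C (p : K) * (PowerSeries.X * h * V) := by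
    have h1 : (PowerSeries.C x + PowerSeries.X) ^ p =
        (PowerSeries.C x + PowerSeries.X) ^ (p - 1) * (PowerSeries.C x + PowerSeries.X) := by
      rw [← pow_succ, Nat.sub_add_cancel hp.one_le]
    calc (PowerSeries.C x + PowerSeries.X) ^ (p - 1) =
        (PowerSeries.C x + PowerSeries.X) ^ p * V := by rw [h1, mul_assoc, hV1, mul_one]
      _ = _ := by rw [e2]; ring
  have e4 : dworkCoeff p x (ν + 1) (p * ν + 1 + s) = x ^ p * (x⁻¹ * (-x⁻¹) ^ s) +
      p * (PowerSeries.coeff s (PowerSeries.X * h * V) + PowerSeries.coeff (p * ν + s) g) := by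
    rw [dworkCoeff, Nat.add_sub_cancel, e, show p * ν + 1 + s - 1 = s + p * ν by omega, map_add,
      PowerSeries.coeff_mul_X_pow, e3, map_add, map_add, PowerSeries.coeff_C_mul,
      PowerSeries.coeff_mul_X_pow', if_neg (by omega), PowerSeries.coeff_C_mul,
      PowerSeries.coeff_C_mul, hV, PowerSeries.coeff_mk, add_comm s]
    ring
  have hxp : x ^ p = x ^ (p - 1) * x := by rw [← pow_succ, Nat.sub_add_cancel hp.one_le]
  have hxp0 : x ^ (p - 1) ≠ 0 := pow_ne_zero _ hx0
  have e5 : dworkCoeff p x (ν + 1) (p * ν + 1 + s) * (x ^ (p - 1))⁻¹ - (-x⁻¹) ^ s =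
      p * ((PowerSeries.coeff s (PowerSeries.X * h * V) + PowerSeries.coeff (p * ν + s) g) *
        (x ^ (p - 1))⁻¹) := by
    rw [e4, hxp]
    field_simp
    ring
  rw [e5, norm_mul]
  refine mul_le_of_le_one_right (norm_nonneg _) ?_
  refine (unitBall K).mul_mem ((unitBall K).add_mem ?_ (hg _)) ?_
  · exact (seriesSubring _).mul_mem ((seriesSubring _).mul_mem (X_mem_seriesSubring _) hh) hVm s
  · rw [mem_unitBall, norm_inv, norm_pow, hx]
    simp

end DworkEstimates

/-! ### The order of the determinant -/

section UltrametricDet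

variable {K : Type*} [NormedField K] [IsUltrametricDist K]

theorem norm_prod_sub_prod_le {σ : Type*} (s : Finset σ) {f g : σ → K} {c : ℝ} (hc : 0 ≤ c)
    (hf : ∀ i ∈ s, ‖f i‖ ≤ 1) (hg : ∀ i ∈ s, ‖g i‖ ≤ 1) (hfg : ∀ i ∈ s, ‖f i - g i‖ ≤ c) :
    ‖∏ i ∈ s, f i - ∏ i ∈ s, g i‖ ≤ c := by
  classical
  induction s using Finset.induction_on with
  | empty => simpa using hc
  | insert a s ha ih =>
    rw [prod_insert ha, prod_insert ha]
    have e : f a * ∏ i ∈ s, f i - g a * ∏ i ∈ s, g i =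
        f a * (∏ i ∈ s, f i - ∏ i ∈ s, g i) + (f a - g a) * ∏ i ∈ s, g i := by ring
    rw [e]
    refine (IsUltrametricDist.norm_add_le_max _ _).trans (max_le ?_ ?_)
    · rw [norm_mul]
      exact (mul_le_of_le_one_left (norm_nonneg _) (hf a (mem_insert_self a s))).trans
        (ih (fun i hi => hf i (mem_insert_of_mem hi)) (fun i hi => hg i (mem_insert_of_mem hi))
          fun i hi => hfg i (mem_insert_of_mem hi))
    · rw [norm_mul]
      refine (mul_le_of_le_one_right (norm_nonneg _) ?_).trans (hfg a (mem_insert_self a s))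
      exact (unitBall K).prod_mem fun i hi => hg i (mem_insert_of_mem hi)

theorem norm_det_sub_det_le {k : ℕ} {M M' : Matrix (Fin k) (Fin k) K} {c : ℝ} (hc : 0 ≤ c)
    (hM : ∀ a b, ‖M a b‖ ≤ 1) (hM' : ∀ a b, ‖M' a b‖ ≤ 1) (h : ∀ a b, ‖M a b - M' a b‖ ≤ c) :
    ‖M.det - M'.det‖ ≤ c := by
  rw [Matrix.det_apply, Matrix.det_apply, ← sum_sub_distrib]
  refine IsUltrametricDist.norm_sum_le_of_forall_le_of_nonneg hc fun τ _ => ?_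
  rw [← smul_sub]
  have h1 : ∀ (z : ℤˣ) (v : K), ‖z • v‖ = ‖v‖ := by
    intro z v
    rcases Int.units_eq_one_or z with rfl | rfl <;> simp [Units.smul_def]
  rw [h1]
  exact norm_prod_sub_prod_le _ hc (fun _ _ => hM _ _) (fun _ _ => hM' _ _) fun _ _ => h _ _

theorem norm_tsum_le_of_forall_le {f : ℕ → K} {c : ℝ} (hf : Summable f)
    (h : ∀ n, ‖f n‖ ≤ c) : ‖∑' n, f n‖ ≤ c := by
  have h0 : 0 ≤ c := (norm_nonneg _).trans (h 0)
  refine le_of_tendsto hf.hasSum.tendsto_sum_nat.norm (Eventually.of_forall fun n => ?_)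
  exact IsUltrametricDist.norm_sum_le_of_forall_le_of_nonneg h0 fun i _ => h i

theorem norm_tsum_sub_sum_le [CompleteSpace K] {γ : K} (hγ1 : ‖γ‖ < 1) {f g : ℕ → K} {M : ℕ}
    (hf : ∀ N, ‖f N‖ ≤ 1) (hfg : ∀ N, ‖γ ^ N * (f N - g N)‖ ≤ ‖γ‖ ^ M) :
    ‖∑' N, γ ^ N * f N - ∑ N ∈ range M, γ ^ N * g N‖ ≤ ‖γ‖ ^ M := by
  have hfn : ∀ N, ‖γ ^ N * f N‖ ≤ ‖γ‖ ^ N := fun N => by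
    rw [norm_mul, norm_pow]
    exact mul_le_of_le_one_right (pow_nonneg (norm_nonneg _) _) (hf N)
  have hfs : Summable fun N => γ ^ N * f N :=
    Summable.of_norm_bounded (summable_geometric_of_lt_one (norm_nonneg γ) hγ1) hfn
  have hfs2 : Summable fun N => γ ^ (N + M) * f (N + M) :=
    (summable_nat_add_iff (f := fun N => γ ^ N * f N) M).mpr hfs
  rw [← hfs.sum_add_tsum_nat_add M, add_sub_right_comm, ← sum_sub_distrib]
  refine (IsUltrametricDist.norm_add_le_max _ _).trans (max_le ?_ ?_)
  · refine IsUltrametricDist.norm_sum_le_of_forall_le_of_nonneg (by positivity) fun N _ => ?_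
    rw [← mul_sub]
    exact hfg N
  · exact norm_tsum_le_of_forall_le hfs2 fun N => (hfn (N + M)).trans
      (pow_le_pow_of_le_one (norm_nonneg _) hγ1.le (Nat.le_add_left M N))

/-- The norm of the value of a polynomial whose coefficients are units or very small, up to a small
error. -/
theorem exists_norm_eq_pow {D : Polynomial K} {γ : K} (hγ1 : ‖γ‖ < 1) (hγ : γ ≠ 0) {L : ℕ}
    (h1 : ∀ t, ‖D.coeff t‖ ≤ 1) (h2 : ∀ t, ‖D.coeff t‖ < 1 → ‖D.coeff t‖ ≤ ‖γ‖ ^ (L + 1))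
    {t₀ : ℕ} (ht₀ : t₀ ≤ L) (ht : ‖D.coeff t₀‖ = 1) {R : K}
    (hR : ‖R - D.eval γ‖ ≤ ‖γ‖ ^ (L + 1)) : ∃ t ≤ L, ‖R‖ = ‖γ‖ ^ t := by
  classical
  have hpos : 0 < ‖γ‖ := norm_pos_iff.mpr hγ
  have hex : ∃ t, ‖D.coeff t‖ = 1 := ⟨t₀, ht⟩
  -- The first index with a unit coefficient gives the dominant term: earlier coefficients are below
  -- `‖γ‖ ^ (L + 1)`, and later terms carry an additional factor `γ`.
  set t := Nat.find hex with htdef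
  have htt : t ≤ L := (Nat.find_min' hex ht).trans ht₀
  refine ⟨t, htt, ?_⟩
  have hlt : ∀ s, s ≠ t → ‖D.coeff s * γ ^ s‖ ≤ ‖γ‖ ^ (t + 1) := by
    intro s hs
    rw [norm_mul, norm_pow]
    rcases lt_or_gt_of_ne hs with h | h
    · have h3 : ‖D.coeff s‖ ≤ ‖γ‖ ^ (L + 1) :=
        h2 s (lt_of_le_of_ne (h1 s) (Nat.find_min hex h))
      calc ‖D.coeff s‖ * ‖γ‖ ^ s ≤ ‖γ‖ ^ (L + 1) * 1 := by
            gcongr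
            exact pow_le_one₀ hpos.le hγ1.le
        _ ≤ ‖γ‖ ^ (t + 1) := by
            rw [mul_one]
            exact pow_le_pow_of_le_one hpos.le hγ1.le (by omega)
    · exact (mul_le_of_le_one_left (by positivity) (h1 s)).trans
        (pow_le_pow_of_le_one hpos.le hγ1.le h)
  have hsucc : ‖γ‖ ^ (t + 1) < ‖γ‖ ^ t := pow_lt_pow_right_of_lt_one₀ hpos hγ1 (Nat.lt_succ_self t)
  have hmain : ‖D.coeff t * γ ^ t‖ = ‖γ‖ ^ t := by
    rw [norm_mul, norm_pow, Nat.find_spec hex, one_mul]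
  rw [← hmain]
  apply norm_eq_of_norm_sub_lt
  rw [hmain]
  refine lt_of_le_of_lt ?_ hsucc
  have htmem : t ∈ range (D.natDegree + 1) := by
    rw [mem_range]
    by_contra! h
    have := Nat.find_spec hex
    rw [← htdef, Polynomial.coeff_eq_zero_of_natDegree_lt (by omega), norm_zero] at this
    exact zero_ne_one this
  have e : R - D.coeff t * γ ^ t = (R - D.eval γ) +
      ∑ s ∈ (range (D.natDegree + 1)).erase t, D.coeff s * γ ^ s := by
    rw [Polynomial.eval_eq_sum_range, ← add_sum_erase _ _ htmem]
    ring
  rw [e]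
  refine (IsUltrametricDist.norm_add_le_max _ _).trans (max_le ?_ ?_)
  · exact hR.trans (pow_le_pow_of_le_one hpos.le hγ1.le (by omega))
  · exact IsUltrametricDist.norm_sum_le_of_forall_le_of_nonneg (by positivity) fun s hs =>
      hlt s (ne_of_mem_erase hs)

end UltrametricDet

/-! ### The error in replacing an entry by its leading coefficients -/

section EntryEstimate

variable {K : Type*} [NormedField K] [IsUltrametricDist K] {ℓ : ℕ} {d : Fin ℓ → ℕ} {k : ℕ}
  {p : ℕ} [hp : Fact p.Prime] {u : ℕ → K} {A : CoeffIdx d → K} {Q : Fin ℓ → K} {B : BlockShape d k}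

/-- At infinity and at the origin `U_p` acts exactly on powers of the parameter. At the origin `Q =
0`, and the series defining the coefficient is the monomial `X^{pm-1}`. -/
theorem uCoeff_of_poleShift_eq_zero (hQ0 : ∀ j : Fin ℓ, j.val = 1 → Q j = 0) {j : Fin ℓ}
    (hj : poleShift j = 0) {m n : ℕ} (hm : 1 ≤ m ∨ j.val = 0) (hn : 1 ≤ n ∨ j.val = 0) :
    uCoeff p Q j m n = if n = p * m then 1 else 0 := by
  have hj1 : j.val ≤ 1 := by
    unfold poleShift at hj
    by_contra h
    rw [if_neg h] at hj
    exact one_ne_zero hj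
  unfold uCoeff
  split_ifs with h1 h2 h3 h4
  · rfl
  · rfl
  · omega
  · rfl
  all_goals
    rw [dworkCoeff, hQ0 j (by omega), zero_pow hp.out.ne_zero, map_zero, zero_add, sub_zero,
      ← pow_mul, ← pow_add, PowerSeries.coeff_X_pow]
    have hpm : p - 1 + p * (m - 1) + 1 = p * m := by
      have := hp.out.one_le
      obtain ⟨m', rfl⟩ : ∃ m', m = m' + 1 := ⟨m - 1, by omega⟩
      rw [Nat.add_sub_cancel, mul_add, mul_one]
      omega
  · rw [if_pos (by omega)]
  · rw [if_neg (by omega)]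

theorem one_le_lo (B : BlockShape d k) (a : Fin k) :
    1 ≤ p * weightNum (B.idx a) + poleShift (B.pole a) ∨ (B.pole a).val = 0 := by
  by_cases h0 : (B.pole a).val = 0
  · exact Or.inr h0
  · left
    have h1 : weightNum (B.idx a) + poleShift (B.pole a) = (B.idx a).1.2 := weightNum_add (B.idx a)
    have h2 : 1 ≤ (B.idx a).1.2 := by
      rcases (B.idx a).2 with h | h
      · exact h
      · exact absurd h.1 h0
    have h3 := Nat.le_mul_of_pos_left (weightNum (B.idx a)) hp.out.pos
    omega

/-- A deficit `x` in the pole order lowers the required degree `N` by only about `x/D`, whereas it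
gains `M ≥ x` from the coefficient of `U_p`. As `D ≥ 2`, at least about `M/2` remains, and `M ≥ 2L +
3` makes this sufficient. -/
theorem error_exponent_le {D N n x U L T M : ℕ} (hD : 2 ≤ D) (hn : n ≤ D * N + D)
    (hx : n - 1 + x = T) (hU : D * U ≤ T) (hxM : x ≤ M) (hM : 2 * L + 3 ≤ M) :
    U + L + 1 ≤ N + M := by
  by_contra! hcon
  obtain ⟨E, rfl⟩ : ∃ E, D = E + 2 := ⟨D - 2, by omega⟩
  have h1 : (E + 2) * (N + M) ≤ (E + 2) * (U + L) := Nat.mul_le_mul_left _ (by omega)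
  have h2 : (E + 1) * (2 * L + 3) ≤ (E + 1) * M := Nat.mul_le_mul_left _ hM
  have h3 : (E + 2) * M = (E + 1) * M + M := by ring
  have h4 : (E + 1) * (2 * L + 3) = E * L + (E + 2) * L + 3 * E + 3 := by ring
  rw [mul_add, mul_add] at h1
  omega

set_option maxHeartbeats 1000000 in
-- At infinity and at the origin the exponents below `pν` contribute nothing. At another pole the
-- coefficient of `U_p` at an exponent with deficit `x` is bounded both by `‖γ‖ ^ x` and by `‖p‖ =
-- ‖γ‖ ^ (p - 1)`; the better bound beats the loss in `N` by `error_exponent_le`.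
theorem pow_error_le {γ : K} (hγ : γ ≠ 0) (hγ1 : ‖γ‖ ≤ 1) (hγp : ‖γ‖ ^ (p - 1) = ‖(p : K)‖)
    (hQ1 : ∀ j : Fin ℓ, j.val ≠ 0 → ‖Q j‖ ≤ 1)
    (hQ : ∀ i j : Fin ℓ, i.val ≠ 0 → j.val ≠ 0 → i ≠ j → ‖Q i - Q j‖ = 1)
    (hQ0 : ∀ j : Fin ℓ, j.val = 1 → Q j = 0) (hB : B.IsLarge) (hpL : 2 * B.depth + 3 < p)
    {a : Fin k} (b : Fin k) {N n : ℕ} {r : CoeffIdx d → ℕ} (hr : r ∈ piAntidiag univ N)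
    (hn : n < p * weightNum (B.idx a) + poleShift (B.pole a)) :
    ‖γ ^ N * (uCoeff p Q (B.pole a) (B.idx a).1.2 n * pfCoeff Q (B.expo b r) (B.pole a) n)‖ ≤
      ‖γ‖ ^ (p * weightNum (B.idx a) / d (B.pole a) + B.depth + 1) := by
  by_cases hn1 : 1 ≤ n ∨ (B.pole a).val = 0
  swap
  · rw [pfCoeff_of_not hn1, mul_zero, mul_zero, norm_zero]; positivity
  by_cases hnw : B.expo b r (B.pole a) < n
  · rw [pfCoeff_of_lt Q hnw, mul_zero, mul_zero, norm_zero]; positivity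
  push Not at hnw
  have hm : weightNum (B.idx a) + poleShift (B.pole a) = (B.idx a).1.2 := weightNum_add (B.idx a)
  by_cases hs : poleShift (B.pole a) = 0
  · have hm1 : 1 ≤ (B.idx a).1.2 ∨ (B.pole a).val = 0 := (B.idx a).2.imp_right And.left
    rw [uCoeff_of_poleShift_eq_zero hQ0 hs hm1 hn1, if_neg, zero_mul, mul_zero, norm_zero]
    · positivity
    · rw [← hm, hs]
      rw [hs] at hn
      exact fun h => by rw [h, add_zero, add_zero] at hn; exact lt_irrefl _ hn
  · have hs1 : poleShift (B.pole a) = 1 := by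
      unfold poleShift at hs ⊢
      split_ifs at hs ⊢
      · exact absurd rfl hs
      · rfl
    have hj : ¬ (B.pole a).val ≤ 1 := by
      intro h
      exact hs (if_pos h)
    rw [hs1] at hn hm
    obtain ⟨ν, hν⟩ : ∃ ν, ν = weightNum (B.idx a) := ⟨_, rfl⟩
    rw [← hν] at hn hm ⊢
    have hw : B.expo b r (B.pole a) ≤ d (B.pole a) * N + d (B.pole a) := by
      have h1 := poleWeight_le r (B.pole a)
      have h2 : ∑ s, r s = N := (mem_piAntidiag.mp hr).1
      have h3 := single_pole_lt hB a b
      rw [h2] at h1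
      rw [hs1] at h3
      unfold BlockShape.expo
      simp only [Pi.add_apply]
      omega
    obtain ⟨x, hx⟩ : ∃ x, n - 1 + x = p * ((B.idx a).1.2 - 1) :=
      ⟨p * ((B.idx a).1.2 - 1) - (n - 1), by
        rw [← hm, Nat.add_sub_cancel]
        omega⟩
    have hlt : n - 1 < p * ((B.idx a).1.2 - 1) := by
      rw [← hm, Nat.add_sub_cancel]
      omega
    have hu : uCoeff p Q (B.pole a) (B.idx a).1.2 n =
        dworkCoeff p (Q (B.pole a)) (B.idx a).1.2 n := by
      rw [uCoeff, if_neg (by omega), if_neg (by omega)]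
    have hQa := hQ1 (B.pole a) (by omega)
    have hu1 : ‖uCoeff p Q (B.pole a) (B.idx a).1.2 n‖ ≤ ‖γ‖ ^ max x (p - 1) := by
      rw [hu]
      rcases le_total x (p - 1) with h | h
      · rw [max_eq_right h, hγp]
        exact norm_dworkCoeff_le_prime hp.out hQa hlt
      · rw [max_eq_left h]
        exact norm_dworkCoeff_le_pow hp.out hγ hγ1 hγp hQa _ _ hx
    rw [norm_mul, norm_mul, norm_pow]
    have hN : p * ν / d (B.pole a) + B.depth + 1 ≤ N + max x (p - 1) := by
      have hdU : d (B.pole a) * (p * ν / d (B.pole a)) ≤ p * ν := Nat.mul_div_le _ _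
      have hνd : ν < d (B.pole a) := by rw [hν]; exact hB.weight_lt a
      rw [← hm, Nat.add_sub_cancel] at hx hlt
      -- From `0 < ν < d` follows `d ≥ 2`, which the exponent estimate requires.
      have hν0 : ν ≠ 0 := by
        rintro h
        rw [h, mul_zero] at hlt
        omega
      exact error_exponent_le (by omega) (hnw.trans hw) hx hdU (le_max_left _ _)
        ((show 2 * B.depth + 3 ≤ p - 1 by omega).trans (le_max_right _ _))
    calc ‖γ‖ ^ N * (‖uCoeff p Q (B.pole a) (B.idx a).1.2 n‖ *
          ‖pfCoeff Q (B.expo b r) (B.pole a) n‖) ≤ ‖γ‖ ^ N * (‖γ‖ ^ max x (p - 1) * 1) := by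
          gcongr
          exact norm_pfCoeff_le hQ1 hQ _ _ _
      _ = ‖γ‖ ^ (N + max x (p - 1)) := by rw [mul_one, pow_add]
      _ ≤ _ := pow_le_pow_of_le_one (norm_nonneg _) hγ1 hN

theorem norm_entryCoeff_sub_mainCoeff_le {γ : K} (hγ : γ ≠ 0) (hγ1 : ‖γ‖ ≤ 1)
    (hγp : ‖γ‖ ^ (p - 1) = ‖(p : K)‖) (hu : ∀ n, ‖u n‖ ≤ 1) (hA : ∀ s, ‖A s‖ ≤ 1)
    (hQ1 : ∀ j : Fin ℓ, j.val ≠ 0 → ‖Q j‖ ≤ 1)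
    (hQ : ∀ i j : Fin ℓ, i.val ≠ 0 → j.val ≠ 0 → i ≠ j → ‖Q i - Q j‖ = 1)
    (hQ0 : ∀ j : Fin ℓ, j.val = 1 → Q j = 0) (hB : B.IsLarge) (hpL : 2 * B.depth + 3 < p)
    (a b : Fin k) (N : ℕ) :
    ‖γ ^ N * (entryCoeff p d u A Q (B.pole b) (B.idx b).1.2 (B.pole a) (B.idx a).1.2 N -
      mainCoeff p u A Q B a b N)‖ ≤
      ‖γ‖ ^ (p * weightNum (B.idx a) / d (B.pole a) + B.depth + 1) := by
  unfold entryCoeff mainCoeff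
  rw [← sum_sub_distrib, mul_sum]
  refine IsUltrametricDist.norm_sum_le_of_forall_le_of_nonneg (by positivity) fun r hr => ?_
  have e : rowCoeff p Q (poleWeight r + Pi.single (B.pole b) (B.idx b).1.2) (B.pole a)
      (B.idx a).1.2 = _ := rowCoeff_eq_add_rowMain p Q (B.expo b r) (B.pole a) (B.idx a).1.2
    (one_le_lo (p := p) B a)
  rw [e, ← mul_sub, add_sub_cancel_right, mul_left_comm, norm_mul]
  refine (mul_le_of_le_one_left (norm_nonneg _) ?_).trans ?_
  · exact (unitBall K).prod_mem fun s _ =>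
      (unitBall K).mul_mem (hu _) ((unitBall K).pow_mem (hA s) _)
  · rw [mul_sum]
    refine IsUltrametricDist.norm_sum_le_of_forall_le_of_nonneg (by positivity) fun n hn => ?_
    rw [mem_range] at hn
    exact pow_error_le hγ hγ1 hγp hQ1 hQ hQ0 hB hpL b hr hn

set_option maxHeartbeats 1000000 in
theorem norm_tsum_entryCoeff_sub_le [CharZero K] [CompleteSpace K] {γ : K} (hγ : γ ≠ 0)
    (hγ1 : ‖γ‖ < 1) (hγp : ‖γ‖ ^ (p - 1) = ‖(p : K)‖) (hu : ∀ n, ‖u n‖ ≤ 1)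
    (hup : ∀ n < p, u n = (n.factorial : K)⁻¹) (hA : ∀ s, ‖A s‖ ≤ 1)
    (hQ1 : ∀ j : Fin ℓ, j.val ≠ 0 → ‖Q j‖ ≤ 1)
    (hQ : ∀ i j : Fin ℓ, i.val ≠ 0 → j.val ≠ 0 → i ≠ j → ‖Q i - Q j‖ = 1)
    (hQ0 : ∀ j : Fin ℓ, j.val = 1 → Q j = 0) (hB : B.IsLarge) (hpL : 2 * B.depth + 3 < p)
    {a : Fin k} (b : Fin k) (hAa : A (B.top a) ≠ 0) (hQa : 2 ≤ (B.pole a).val → Q (B.pole a) ≠ 0)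
    (hres : B.res a = p * weightNum (B.idx a) % d (B.pole a))
    (hpU : p * weightNum (B.idx a) / d (B.pole a) + B.depth < p) :
    ‖(∑' N, γ ^ N * entryCoeff p d u A Q (B.pole b) (B.idx b).1.2 (B.pole a) (B.idx a).1.2 N) -
      γ ^ (p * weightNum (B.idx a) / d (B.pole a)) * rowScalar p A Q B a *
        ((padicData p B A Q).entryPoly B a b).eval γ‖ ≤
      ‖γ‖ ^ (p * weightNum (B.idx a) / d (B.pole a) + B.depth + 1) := by
  obtain ⟨U, hU⟩ : ∃ U, U = p * weightNum (B.idx a) / d (B.pole a) := ⟨_, rfl⟩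
  have hmain : ∑ N ∈ range (U + (B.depth + 1)), γ ^ N * mainCoeff p u A Q B a b N =
      γ ^ U * rowScalar p A Q B a * ((padicData p B A Q).entryPoly B a b).eval γ := by
    rw [sum_range_add, sum_eq_zero, zero_add, CoefData.entryPoly, Polynomial.eval_finsetSum, mul_sum]
    · refine sum_congr rfl fun y hy => ?_
      rw [mem_range] at hy
      rw [hU, mainCoeff_add hB hup b hAa hQa hres hpU (by omega)]
      simp only [Polynomial.eval_mul, Polynomial.eval_C, Polynomial.eval_pow, Polynomial.eval_X]
      rw [pow_add]
      ring
    · intro N hN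
      rw [mem_range, hU] at hN
      rw [mainCoeff_of_lt hB b hN, mul_zero]
  rw [← hU, ← hmain]
  refine norm_tsum_sub_sum_le hγ1 (fun N => norm_entryCoeff_le hu hA hQ1 hQ _ _ _ _ _) fun N => ?_
  rw [hU]
  exact norm_entryCoeff_sub_mainCoeff_le hγ hγ1.le hγp hu hA hQ1 hQ hQ0 hB hpL a b N

end EntryEstimate

/-! ### The limiting data -/

/-- The limiting data of a block for the primes of a given residue class, over a ring that receives
a field containing the poles. -/
def classData {F R : Type*} [Field F] [CommRing R] {ℓ : ℕ} {d : Fin ℓ → ℕ} {k : ℕ}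
    (B : BlockShape d k) (P : Fin ℓ → F) (g : F →+* R) (A : CoeffIdx d → R) : CoefData R d k where
  ratio a z := g (if z ≤ B.depth then shiftFactor (-(B.res a : F) / d (B.pole a)) z else 0)
  lead a n := g (if n ≤ B.bound then (if poleShift (B.pole a) = 0 then (if n = 0 then 1 else 0)
    else (-(P (B.pole a))⁻¹) ^ n) else 0)
  loc j i := PowerSeries.map g (locSeries P j i)
  A := A
  invFact n := g (if n ≤ B.bound then (n.factorial : F)⁻¹ else 0)

theorem classData_map {F R R' : Type*} [Field F] [CommRing R] [CommRing R'] {ℓ : ℕ}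
    {d : Fin ℓ → ℕ} {k : ℕ} (B : BlockShape d k) (P : Fin ℓ → F) (g : F →+* R)
    (A : CoeffIdx d → R) (h : R →+* R') :
    (classData B P g A).map h = classData B P (h.comp g) fun s => h (A s) := by
  unfold CoefData.map classData
  congr 1

section Pairs

variable {K : Type*} [NormedField K] [IsUltrametricDist K] {p : ℕ} [hp : Fact p.Prime]

theorem frobPairs_of_norm_le (hpK : ‖(p : K)‖ < 1) {x : K} (hx : ‖x‖ ≤ ‖(p : K)‖) :
    (x, 0) ∈ frobPairs K p := by
  refine ⟨hx.trans hpK.le, ⟨1, le_rfl, ?_⟩, by simp, by simpa using hx.trans_lt hpK⟩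
  refine (norm_sub_le_max' _ _).trans (max_le ?_ hx)
  rw [norm_pow, pow_one]
  exact (pow_le_of_le_one (norm_nonneg _) (hx.trans hpK.le) hp.out.ne_zero).trans hx

theorem frobPairs_of_norm_sub_le (hpK : ‖(p : K)‖ < 1) {x y z : K} (h : (y, z) ∈ frobPairs K p)
    (hx : ‖x - y‖ ≤ ‖(p : K)‖) : (x, z) ∈ frobPairs K p := by
  have := (frobPairs K p).add_mem (frobPairs_of_norm_le hpK hx) h
  simpa using this

theorem norm_natCast_eq_one_of_lt (hpK : ‖(p : K)‖ < 1) {n : ℕ} (h0 : n ≠ 0) (hn : n < p) :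
    ‖(n : K)‖ = 1 :=
  norm_natCast_eq_one hpK fun h => absurd (Nat.le_of_dvd (Nat.pos_of_ne_zero h0) h) (by omega)

theorem frobPairs_inv_natCast (hpK : ‖(p : K)‖ < 1) {n : ℕ} (h0 : n ≠ 0) (hn : n < p) :
    ((n : K)⁻¹, (n : K)⁻¹) ∈ frobPairs K p :=
  frobPairs_inv (frobPairs_natCast n) (norm_natCast_eq_one_of_lt hpK h0 hn)

theorem frobPairs_inv_factorial (hpK : ‖(p : K)‖ < 1) {n : ℕ} (hn : n < p) :
    ((n.factorial : K)⁻¹, (n.factorial : K)⁻¹) ∈ frobPairs K p := by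
  refine frobPairs_inv (frobPairs_natCast _) (norm_natCast_eq_one hpK ?_)
  rw [hp.out.dvd_factorial]
  omega

theorem frobPairs_shiftFactor {x y : K} (h : (x, y) ∈ frobPairs K p)
    {L : ℕ} (hL : ∀ l < L, ‖y + (l + 1 : ℕ)‖ = 1) {z : ℤ} (hz : z ≤ L) :
    (shiftFactor x z, shiftFactor y z) ∈ frobPairs K p := by
  rcases z with n | n
  · have := (frobPairs K p).prod_mem (t := range n)
      (f := fun l => ((x + (l + 1 : ℕ))⁻¹, (y + (l + 1 : ℕ))⁻¹)) fun l hl => by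
        rw [mem_range] at hl
        simp only [Int.ofNat_eq_natCast, Nat.cast_le] at hz
        exact frobPairs_inv ((frobPairs K p).add_mem h (frobPairs_natCast (l + 1)))
          (hL l (by omega))
    have e : (shiftFactor x (Int.ofNat n), shiftFactor y (Int.ofNat n)) =
        ∏ l ∈ range n, ((x + (l + 1 : ℕ))⁻¹, (y + (l + 1 : ℕ))⁻¹) := by
      ext
      · rw [Prod.fst_prod]; rfl
      · rw [Prod.snd_prod]; rfl
    rw [e]
    exact this
  · have := (frobPairs K p).prod_mem (t := range (n + 1))
      (f := fun l => (x - (l : ℕ), y - (l : ℕ))) fun l hl =>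
        (frobPairs K p).sub_mem h (frobPairs_natCast l)
    have e : (shiftFactor x (Int.negSucc n), shiftFactor y (Int.negSucc n)) =
        ∏ l ∈ range (n + 1), (x - (l : ℕ), y - (l : ℕ)) := by
      ext
      · rw [Prod.fst_prod]; rfl
      · rw [Prod.snd_prod]; rfl
    rw [e]
    exact this

/-- With `τ = pν mod D` one has `⌊pν/D⌋ = (pν - τ)/D ≡ -τ/D` modulo `p`. The right side depends only
on `p` modulo `D`. -/
theorem frobPairs_residue (hpK : ‖(p : K)‖ < 1) {D ν : ℕ} (hD : D ≠ 0) (hDp : D < p) :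
    (((p * ν / D : ℕ) : K), -((p * ν % D : ℕ) : K) / D) ∈ frobPairs K p := by
  have hD1 := norm_natCast_eq_one_of_lt hpK hD hDp
  have hD0 : (D : K) ≠ 0 := norm_ne_zero_iff.mp (by rw [hD1]; exact one_ne_zero)
  have h1 := (frobPairs K p).mul_mem ((frobPairs K p).neg_mem (frobPairs_natCast (p * ν % D)))
    (frobPairs_inv_natCast hpK hD hDp)
  rw [div_eq_mul_inv]
  refine frobPairs_of_norm_sub_le hpK h1 ?_
  have e : ((p * ν / D : ℕ) : K) - -((p * ν % D : ℕ) : K) * (D : K)⁻¹ =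
      (p : K) * ((ν : K) * (D : K)⁻¹) := by
    have h2 : (D : K) * ((p * ν / D : ℕ) : K) + ((p * ν % D : ℕ) : K) = p * ν := by
      exact_mod_cast congrArg (Nat.cast (R := K)) (Nat.div_add_mod (p * ν) D)
    field_simp
    linear_combination h2
  change ‖((p * ν / D : ℕ) : K) - -((p * ν % D : ℕ) : K) * (D : K)⁻¹‖ ≤ _
  rw [e, norm_mul]
  refine mul_le_of_le_one_right (norm_nonneg _) ?_
  rw [norm_mul, norm_inv, hD1, inv_one, mul_one]
  exact IsUltrametricDist.norm_natCast_le_one K ν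

/-- The numerator `D (l + 1) - τ` lies strictly between `0` and `p`. The denominators in the limit
of `ratio` are thus units. -/
theorem norm_residue_add (hpK : ‖(p : K)‖ < 1) {D τ l L : ℕ} (hτ : τ < D) (hl : l < L)
    (hD : D * (L + 1) < p) : ‖-(τ : K) / D + (l + 1 : ℕ)‖ = 1 := by
  have hDp : D < p := lt_of_le_of_lt (Nat.le_mul_of_pos_right D (Nat.succ_pos L)) hD
  have hD1 := norm_natCast_eq_one_of_lt hpK (show D ≠ 0 by omega) hDp
  have hD0 : (D : K) ≠ 0 := norm_ne_zero_iff.mp (by rw [hD1]; exact one_ne_zero)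
  have hle : D ≤ D * (l + 1) := Nat.le_mul_of_pos_right D (Nat.succ_pos l)
  have hle2 : D * (l + 1) ≤ D * (L + 1) := Nat.mul_le_mul_left D (by omega)
  have e : -(τ : K) / D + (l + 1 : ℕ) = ((D * (l + 1) - τ : ℕ) : K) * (D : K)⁻¹ := by
    rw [Nat.cast_sub (by omega), Nat.cast_mul]
    field_simp
    ring
  rw [e, norm_mul, norm_inv, hD1, inv_one, mul_one]
  exact norm_natCast_eq_one_of_lt hpK (by omega) (by omega)

variable {ℓ : ℕ} {d : Fin ℓ → ℕ} {k : ℕ}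

theorem frobPairs_locSeries {Q P : Fin ℓ → K}
    (hQP : ∀ j : Fin ℓ, j.val ≠ 0 → (Q j, P j) ∈ frobPairs K p)
    (hP : ∀ i j : Fin ℓ, i.val ≠ 0 → j.val ≠ 0 → i ≠ j → ‖P i - P j‖ = 1) {j i : Fin ℓ}
    (hij : i ≠ j) (n : ℕ) : (PowerSeries.coeff n (locSeries Q j i),
      PowerSeries.coeff n (locSeries P j i)) ∈ frobPairs K p := by
  have h0 : ((0 : K), (0 : K)) ∈ frobPairs K p := (frobPairs K p).zero_mem
  have h1 : ((1 : K), (1 : K)) ∈ frobPairs K p := (frobPairs K p).one_mem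
  unfold locSeries
  split_ifs with hj hi
  · have hi : i.val ≠ 0 := fun h => hij (Fin.ext (h.trans hj.symm))
    rw [PowerSeries.coeff_mk, PowerSeries.coeff_mk]
    split_ifs
    · exact h0
    · exact (frobPairs K p).pow_mem (hQP i hi) _
  · rw [map_add, map_add, PowerSeries.coeff_C, PowerSeries.coeff_C, PowerSeries.coeff_X]
    split_ifs
    · exact (frobPairs K p).add_mem (hQP j hj) h1
    · exact (frobPairs K p).add_mem (hQP j hj) h0
    · exact (frobPairs K p).add_mem h0 h1
    · exact (frobPairs K p).add_mem h0 h0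
  · rw [PowerSeries.coeff_mk, PowerSeries.coeff_mk]
    refine (frobPairs K p).mul_mem (x := ((-1) ^ n, (-1) ^ n)) ((frobPairs K p).pow_mem
      ((frobPairs K p).neg_mem h1) n) ((frobPairs K p).pow_mem
        (x := ((Q j - Q i)⁻¹, (P j - P i)⁻¹)) ?_ _)
    exact frobPairs_inv ((frobPairs K p).sub_mem (hQP j hj) (hQP i hi)) (hP j i hj hi hij.symm)

/-- After division by the power of `Q`, the coefficients of `U_p` from the critical exponent on have
reductions that do not depend on `p`: those of `1` at infinity and at the origin, those of `1/(1 +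
X/P)` at the other poles. -/
theorem frobPairs_lead (hpK : ‖(p : K)‖ < 1) {B : BlockShape d k} {Q P : Fin ℓ → K}
    (hQP : ∀ j : Fin ℓ, j.val ≠ 0 → (Q j, P j) ∈ frobPairs K p)
    (hQ0 : ∀ j : Fin ℓ, j.val = 1 → Q j = 0) {a : Fin k}
    (hP1 : 2 ≤ (B.pole a).val → ‖P (B.pole a)‖ = 1) {n : ℕ} (hn : n < p) :
    (uCoeff p Q (B.pole a) (B.idx a).1.2
      (p * weightNum (B.idx a) + poleShift (B.pole a) + n) *
        (Q (B.pole a) ^ ((p - 1) * poleShift (B.pole a)))⁻¹,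
      if poleShift (B.pole a) = 0 then (if n = 0 then 1 else 0)
        else (-(P (B.pole a))⁻¹) ^ n) ∈ frobPairs K p := by
  have hm : weightNum (B.idx a) + poleShift (B.pole a) = (B.idx a).1.2 := weightNum_add (B.idx a)
  have hlo := one_le_lo (p := p) B a
  split_ifs with hs h0
  · have hm1 : 1 ≤ (B.idx a).1.2 ∨ (B.pole a).val = 0 := (B.idx a).2.imp_right And.left
    rw [hs, add_zero] at hm hlo
    rw [hs, uCoeff_of_poleShift_eq_zero hQ0 hs hm1 (by omega), h0, hm, if_pos (by omega)]
    simp only [mul_zero, pow_zero, inv_one, mul_one]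
    exact (frobPairs K p).one_mem
  · have hm1 : 1 ≤ (B.idx a).1.2 ∨ (B.pole a).val = 0 := (B.idx a).2.imp_right And.left
    rw [hs, add_zero] at hm hlo
    rw [hs, uCoeff_of_poleShift_eq_zero hQ0 hs hm1 (by omega), hm, if_neg (by omega)]
    simp only [zero_mul]
    exact (frobPairs K p).zero_mem
  · have hj : ¬ (B.pole a).val ≤ 1 := fun h => hs (if_pos h)
    have hs1 : poleShift (B.pole a) = 1 := if_neg hj
    rw [hs1] at hm ⊢
    have hQa := hQP (B.pole a) (by omega)
    have hQ1 := frobPairs_norm_eq_one hQa (hP1 (by omega))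
    rw [mul_one, uCoeff, if_neg (by omega), if_neg (by omega), ← hm]
    exact frobPairs_of_norm_sub_le hpK ((frobPairs K p).pow_mem ((frobPairs K p).neg_mem
      (frobPairs_inv hQa (hP1 (by omega)))) n) (norm_dworkCoeff_sub_le hp.out hQ1 hn)

/-- The coefficients of the determinants of the `p`-adic and of the limiting block have the same
reductions. -/
theorem frobPairs_coeff_detPoly (hpK : ‖(p : K)‖ < 1) {B : BlockShape d k}
    {A : CoeffIdx d → K} {Q : Fin ℓ → K} {F : Type*} [Field F] (ι : F →+* K) {P : Fin ℓ → F}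
    {f : CoeffIdx d → F} (hA : ∀ s, (A s, ι (f s)) ∈ frobPairs K p)
    (hQP : ∀ j : Fin ℓ, j.val ≠ 0 → (Q j, ι (P j)) ∈ frobPairs K p)
    (hP : ∀ i j : Fin ℓ, i.val ≠ 0 → j.val ≠ 0 → i ≠ j → ‖ι (P i) - ι (P j)‖ = 1)
    (hP1 : ∀ j : Fin ℓ, 2 ≤ j.val → ‖ι (P j)‖ = 1)
    (hQ0 : ∀ j : Fin ℓ, j.val = 1 → Q j = 0)
    (hres : ∀ a, B.res a = p * weightNum (B.idx a) % d (B.pole a))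
    (hpB : B.bound < p) (hpd : ∀ j, d j * (B.depth + 1) < p) (t : ℕ) :
    (((padicData p B A Q).detPoly B).coeff t,
      ((classData B P ι fun s => ι (f s)).detPoly B).coeff t) ∈ frobPairs K p := by
  have h0 : ((0 : K), ι 0) ∈ frobPairs K p := by
    rw [map_zero]
    exact (frobPairs K p).zero_mem
  have hmapS : ∀ κ : F, ∀ z : ℤ, ι (shiftFactor κ z) = shiftFactor (ι κ) z := by
    intro κ z
    rcases z with n | n <;> simp [shiftFactor, map_prod]
  refine CoefData.coeff_detPoly_mem B (fun a z => ?_) (fun a n => ?_) (fun j i n hij => ?_) hA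
    (fun n => ?_) t
  · simp only [padicData, classData]
    split_ifs with hz
    · have hd := B.pos (B.pole a)
      have hlt : B.res a < d (B.pole a) := by rw [hres]; exact Nat.mod_lt _ hd
      rw [hmapS]
      have e : ι (-(B.res a : F) / d (B.pole a)) = -((B.res a : ℕ) : K) / d (B.pole a) := by simp
      rw [e]
      refine frobPairs_shiftFactor ?_ (fun l hl => ?_) hz
      · rw [hres]
        exact frobPairs_residue hpK (by omega) (lt_of_le_of_lt
          (Nat.le_mul_of_pos_right _ (Nat.succ_pos B.depth)) (hpd (B.pole a)))
      · exact norm_residue_add hpK hlt hl (hpd (B.pole a))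
    · exact h0
  · simp only [padicData, classData]
    split_ifs with hn hs hn0
    · rw [map_one]
      have := frobPairs_lead hpK (B := B) (a := a) hQP hQ0 (hP1 _) (show n < p by omega)
      rwa [if_pos hs, if_pos hn0] at this
    · rw [map_zero]
      have := frobPairs_lead hpK (B := B) (a := a) hQP hQ0 (hP1 _) (show n < p by omega)
      rwa [if_pos hs, if_neg hn0] at this
    · have := frobPairs_lead hpK (B := B) (a := a) hQP hQ0 (hP1 _) (show n < p by omega)
      rw [if_neg hs] at this
      simpa using this
    · exact h0
  · have e : PowerSeries.map ι (locSeries P j i) = locSeries (fun j => ι (P j)) j i := by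
      ext n
      unfold locSeries
      rw [PowerSeries.coeff_map]
      split_ifs
      · simp only [PowerSeries.coeff_mk]
        split_ifs <;> simp
      · simp only [map_add, PowerSeries.coeff_C, PowerSeries.coeff_X]
        split_ifs <;> simp
      · simp [PowerSeries.coeff_mk]
    simp only [padicData, classData]
    rw [e]
    exact frobPairs_locSeries hQP hP hij n
  · simp only [padicData, classData]
    split_ifs with hn
    · rw [map_inv₀, map_natCast]
      exact frobPairs_inv_factorial hpK (by omega)
    · exact h0

end Pairs

/-! ### The determinant for a fixed prime -/

section FixedPrime

theorem norm_mainCoeff_le {K : Type*} [NormedField K] [IsUltrametricDist K] {ℓ : ℕ}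
    {d : Fin ℓ → ℕ} {k : ℕ} {p : ℕ} [hp : Fact p.Prime] {u : ℕ → K} {A : CoeffIdx d → K}
    {Q : Fin ℓ → K} {B : BlockShape d k} (hu : ∀ n, ‖u n‖ ≤ 1) (hA : ∀ s, ‖A s‖ ≤ 1)
    (hQ1 : ∀ j : Fin ℓ, j.val ≠ 0 → ‖Q j‖ ≤ 1)
    (hQ : ∀ i j : Fin ℓ, i.val ≠ 0 → j.val ≠ 0 → i ≠ j → ‖Q i - Q j‖ = 1) (a b : Fin k) (N : ℕ) :
    ‖mainCoeff p u A Q B a b N‖ ≤ 1 := by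
  refine (unitBall K).sum_mem fun r _ => (unitBall K).mul_mem
    ((unitBall K).prod_mem fun s _ => (unitBall K).mul_mem (hu _)
      ((unitBall K).pow_mem (hA s) _)) ?_
  have e := rowCoeff_eq_add_rowMain p Q (B.expo b r) (B.pole a) (B.idx a).1.2
    (one_le_lo (p := p) B a)
  rw [← sub_eq_iff_eq_add'] at e
  rw [← e]
  exact (unitBall K).sub_mem (norm_rowCoeff_le hQ1 hQ _ _ _) ((unitBall K).sum_mem fun n _ =>
    (unitBall K).mul_mem (norm_uCoeff_le hQ1 _ _ _) (norm_pfCoeff_le hQ1 hQ _ _ _))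

variable {p : ℕ} [hp : Fact p.Prime] {ℓ : ℕ} {d : Fin ℓ → ℕ} {k : ℕ}

theorem norm_rowScalar {B : BlockShape d k} {A : CoeffIdx d → ℂ_[p]} {Q : Fin ℓ → ℂ_[p]}
    {a : Fin k} (hA : ‖A (B.top a)‖ = 1) (hQ : 2 ≤ (B.pole a).val → ‖Q (B.pole a)‖ = 1)
    (hU : p * weightNum (B.idx a) / d (B.pole a) < p) : ‖rowScalar p A Q B a‖ = 1 := by
  unfold rowScalar
  rw [norm_mul, norm_mul, norm_inv, norm_zpow, norm_pow, hA, one_zpow, mul_one,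
    norm_natCast_eq_one norm_prime_lt_one (by rw [hp.out.dvd_factorial]; omega), inv_one, one_mul]
  by_cases h2 : 2 ≤ (B.pole a).val
  · rw [hQ h2, one_pow]
  · have : poleShift (B.pole a) = 0 := if_pos (by omega)
    rw [this, mul_zero, pow_zero]

/-- Divide row `a` by `γ ^ U_a` times its unit scalar. The resulting integral matrix agrees modulo
`γ ^ (L + 1)` with the value at `γ` of a polynomial matrix, so its determinant is `D(γ)` up to that
error. The coefficients of `D` are units or of norm at most `‖p‖ = ‖γ‖ ^ (p - 1)`, and the one of
index `t₀` is a unit because the limiting one is; `exists_norm_eq_pow` concludes. -/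
theorem norm_det_frobeniusMatrix (hℓ : 1 ≤ ℓ) {γ : ℂ_[p]} (hγ : IsArtinHasseRoot p γ)
    {δ : Fin ℓ → ℂ_[p]} (hδ : ∀ j, δ j ≠ 0) {A : CoeffIdx d → ℂ_[p]} {Q : Fin ℓ → ℂ_[p]}
    {F : Type*} [Field F] (ι : F →+* ℂ_[p]) {P : Fin ℓ → F} {f : CoeffIdx d → F}
    (hA : ∀ s, (A s, ι (f s)) ∈ frobPairs ℂ_[p] p)
    (hQP : ∀ j : Fin ℓ, j.val ≠ 0 → (Q j, ι (P j)) ∈ frobPairs ℂ_[p] p)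
    (hP : ∀ i j : Fin ℓ, i.val ≠ 0 → j.val ≠ 0 → i ≠ j → ‖ι (P i) - ι (P j)‖ = 1)
    (hP1 : ∀ j : Fin ℓ, 2 ≤ j.val → ‖ι (P j)‖ = 1)
    (hQ0 : ∀ j : Fin ℓ, j.val = 1 → Q j = 0) {B : BlockShape d k} (hB : B.IsLarge)
    (hf : ∀ j, ‖ι (f (topIdx B.pos j))‖ = 1)
    (hres : ∀ a, B.res a = p * weightNum (B.idx a) % d (B.pole a))
    (hpB : B.bound < p) (hpd : ∀ j, d j * (B.depth + 1) < p) (hpL : 2 * B.depth + 3 < p)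
    {t₀ : ℕ} (ht₀ : t₀ ≤ B.depth)
    (ht : ‖ι (MvPolynomial.eval f
      (((classData B P MvPolynomial.C MvPolynomial.X).detPoly B).coeff t₀))‖ = 1)
    (e : ℕ ≃ BasisIdx ℓ) (he : ∀ a : Fin k, B.idx a = e a) :
    ∃ t ≤ B.depth, ‖(principalBlock e k (frobeniusMatrix d γ δ A Q)).det‖ =
      ‖γ‖ ^ (∑ a, p * weightNum (B.idx a) / d (B.pole a) + t) := by
  have hpK : ‖(p : ℂ_[p])‖ < 1 := norm_prime_lt_one
  obtain ⟨hγ0, hγp'⟩ := norm_pow_of_isArtinHasseRoot hγ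
  have hγp : ‖γ‖ ^ (p - 1) = ‖(p : ℂ_[p])‖ := by rw [hγp', norm_prime]
  have hγ1 := norm_lt_one_of_isArtinHasseRoot hγ
  have hpos : 0 < ‖γ‖ := norm_pos_iff.mpr hγ0
  have hA1 : ∀ s, ‖A s‖ ≤ 1 := fun s => (hA s).1
  have hQ1 : ∀ j : Fin ℓ, j.val ≠ 0 → ‖Q j‖ ≤ 1 := fun j hj => (hQP j hj).1
  have hQ : ∀ i j : Fin ℓ, i.val ≠ 0 → j.val ≠ 0 → i ≠ j → ‖Q i - Q j‖ = 1 := fun i j hi hj hij =>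
    frobPairs_norm_eq_one ((frobPairs ℂ_[p] p).sub_mem (hQP i hi) (hQP j hj)) (hP i j hi hj hij)
  have hQu : ∀ j : Fin ℓ, 2 ≤ j.val → ‖Q j‖ = 1 := fun j hj =>
    frobPairs_norm_eq_one (hQP j (by omega)) (hP1 j hj)
  have hAu : ∀ a, ‖A (B.top a)‖ = 1 := fun a => frobPairs_norm_eq_one (hA _) (hf _)
  -- As `ν ≤ d - 1` and `d (depth + 1) < p`, all factorials up to `U + depth` are prime to `p`, and
  -- the coefficients of `E` are there those of the exponential.
  have hpU : ∀ a, p * weightNum (B.idx a) / d (B.pole a) + B.depth < p := by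
    intro a
    have h1 := hB.weight_lt a
    have h2 := hpd (B.pole a)
    have hd := B.pos (B.pole a)
    have h3 := Nat.mul_div_le (p * weightNum (B.idx a)) (d (B.pole a))
    have h4 : p * (weightNum (B.idx a) + 1) ≤ p * d (B.pole a) := Nat.mul_le_mul_left _ h1
    by_contra! hcon
    have h5 := Nat.mul_le_mul_left (d (B.pole a)) hcon
    rw [mul_add] at h2 h4 h5
    rw [mul_comm (d (B.pole a)) p] at h5
    omega
  rw [det_principalBlock_frobeniusMatrix hℓ hγ hδ hA1 hQ1 hQ]
  set D := (padicData p B A Q).detPoly B with hD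
  have hpair : ∀ t, (D.coeff t, ((classData B P ι fun s => ι (f s)).detPoly B).coeff t) ∈
      frobPairs ℂ_[p] p := fun t =>
    frobPairs_coeff_detPoly hpK ι hA hQP hP hP1 hQ0 hres hpB hpd t
  have hclass : ∀ t, ((classData B P ι fun s => ι (f s)).detPoly B).coeff t =
      ι (MvPolynomial.eval f
        (((classData B P MvPolynomial.C MvPolynomial.X).detPoly B).coeff t)) := by
    intro t
    rw [← RingHom.comp_apply, ← CoefData.coeff_detPoly_map, classData_map]
    congr 2
    have e1 : (ι.comp (MvPolynomial.eval f)).comp MvPolynomial.C = ι := by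
      ext x; simp
    rw [e1]
    congr 1
    funext s
    simp
  set S : Fin k → ℂ_[p] := fun a =>
    γ ^ (p * weightNum (B.idx a) / d (B.pole a)) * rowScalar p A Q B a with hS
  have hsc : ∀ a, ‖rowScalar p A Q B a‖ = 1 := fun a =>
    norm_rowScalar (hAu a) (hQu _) (by have := hpU a; omega)
  have hSn : ∀ a, ‖S a‖ = ‖γ‖ ^ (p * weightNum (B.idx a) / d (B.pole a)) := fun a => by
    simp only [hS]
    rw [norm_mul, norm_pow, hsc, mul_one]
  have hS0 : ∀ a, S a ≠ 0 := fun a => norm_ne_zero_iff.mp (by rw [hSn]; positivity)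
  set E : Matrix (Fin k) (Fin k) ℂ_[p] := Matrix.of fun a b =>
    ((padicData p B A Q).entryPoly B a b).eval γ with hE
  set M : Matrix (Fin k) (Fin k) ℂ_[p] := Matrix.of fun a b =>
    (S a)⁻¹ * frobEntry d γ A Q (e a) (e b) with hM
  have hME : ∀ a b, ‖M a b - E a b‖ ≤ ‖γ‖ ^ (B.depth + 1) := by
    intro a b
    have h1 := norm_tsum_entryCoeff_sub_le hγ0 hγ1 hγp (norm_ahCoeff_le (p := p))
      (fun n hn => ahCoeff_of_lt hn) hA1 hQ1 hQ hQ0 hB hpL (a := a) b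
      (norm_ne_zero_iff.mp (by rw [hAu a]; exact one_ne_zero))
      (fun h => norm_ne_zero_iff.mp (by rw [hQu _ h]; exact one_ne_zero)) (hres a) (hpU a)
    have e1 : M a b - E a b = (S a)⁻¹ * ((∑' N, γ ^ N * entryCoeff p d (ahCoeff p) A Q (B.pole b)
        (B.idx b).1.2 (B.pole a) (B.idx a).1.2 N) -
        S a * ((padicData p B A Q).entryPoly B a b).eval γ) := by
      rw [mul_sub, inv_mul_cancel_left₀ (hS0 a)]
      simp only [hM, hE, Matrix.of_apply, frobEntry, BlockShape.pole, he]
    rw [e1, norm_mul, norm_inv, hSn]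
    rw [inv_mul_le_iff₀ (by positivity), ← pow_add, ← add_assoc]
    exact h1
  -- Integrality is inherited from the main coefficients, which differ from these only by unit
  -- scalars.
  have hE1 : ∀ a b, ‖E a b‖ ≤ 1 := by
    intro a b
    simp only [hE, Matrix.of_apply, CoefData.entryPoly, Polynomial.eval_finsetSum,
      Polynomial.eval_mul, Polynomial.eval_C, Polynomial.eval_pow, Polynomial.eval_X]
    refine (unitBall ℂ_[p]).sum_mem fun y hy => (unitBall ℂ_[p]).mul_mem ?_
      ((unitBall ℂ_[p]).pow_mem hγ1.le _)
    rw [mem_range] at hy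
    have h1 := mainCoeff_add (p := p) (u := ahCoeff p) (A := A) (Q := Q) hB
      (fun n hn => ahCoeff_of_lt hn) (a := a) b
      (norm_ne_zero_iff.mp (by rw [hAu a]; exact one_ne_zero))
      (fun h => norm_ne_zero_iff.mp (by rw [hQu _ h]; exact one_ne_zero)) (hres a) (hpU a)
      (show y ≤ B.depth by omega)
    have h2 := norm_mainCoeff_le (p := p) (B := B) (norm_ahCoeff_le (p := p)) hA1 hQ1 hQ a b
      (p * weightNum (B.idx a) / d (B.pole a) + y)
    rw [h1, norm_mul, hsc, one_mul] at h2
    exact h2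
  have hM1 : ∀ a b, ‖M a b‖ ≤ 1 := by
    intro a b
    have h1 := IsUltrametricDist.norm_add_le_max (M a b - E a b) (E a b)
    rw [sub_add_cancel] at h1
    exact h1.trans (max_le ((hME a b).trans (pow_le_one₀ hpos.le hγ1.le)) (hE1 a b))
  have hdet : (Matrix.of fun a b : Fin k => frobEntry d γ A Q (e a) (e b)).det =
      (∏ a, S a) * M.det := by
    rw [← Matrix.det_mul_column]
    congr 1
    ext a b
    simp only [hM, Matrix.of_apply]
    rw [mul_inv_cancel_left₀ (hS0 a)]
  have hEdet : E.det = D.eval γ := by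
    have h := RingHom.map_det (Polynomial.evalRingHom γ)
      (Matrix.of fun a b => (padicData p B A Q).entryPoly B a b)
    rw [Polynomial.coe_evalRingHom] at h
    rw [hD, CoefData.detPoly, h]
    rfl
  obtain ⟨t, ht1, ht2⟩ := exists_norm_eq_pow (D := D) hγ1 hγ0 (L := B.depth)
    (fun t => frobPairs_norm_le (hpair t))
    (fun t hlt => (frobPairs_norm_le_of_lt (hpair t) hlt).trans (by
      rw [← hγp]
      exact pow_le_pow_of_le_one hpos.le hγ1.le (by omega))) ht₀
    (frobPairs_norm_eq_one (hpair t₀) (by rw [hclass]; exact ht)) (R := M.det)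
    (by
      rw [← hEdet]
      exact norm_det_sub_det_le (by positivity) hM1 hE1 hME)
  refine ⟨t, ht1, ?_⟩
  rw [hdet, norm_mul, ht2, norm_prod, prod_congr rfl fun a _ => hSn a, prod_pow_eq_pow_sum,
    ← pow_add]

theorem ordp_of_norm_eq_pow {γ : ℂ_[p]} (hγ : IsArtinHasseRoot p γ) {x : ℂ_[p]} {n : ℕ}
    (hx : ‖x‖ = ‖γ‖ ^ n) : ordp p x = n / ((p : ℝ) - 1) := by
  have h := hγ.2
  unfold ordp at h ⊢
  rw [hx, Real.logb_pow, ← mul_neg, h]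
  ring

end FixedPrime

/-! ### Lowest terms of determinants -/

section LowestTerms

/-- After multiplication of column `b` by `X ^ β b`, row `a` is divisible by `X ^ α a`. Cancelling
these powers and setting `X = 0` gives the determinant of lowest coefficients. -/
theorem coeff_det_of_le {R : Type*} [CommRing R] {k : ℕ}
    (M : Matrix (Fin k) (Fin k) (Polynomial R)) (α β : Fin k → ℕ)
    (h : ∀ a b n, (M a b).coeff n ≠ 0 → α a ≤ n + β b) :
    (Polynomial.X ^ (∑ b, β b) * M.det).coeff (∑ a, α a) =
      (Matrix.of fun a b => if β b ≤ α a then (M a b).coeff (α a - β b) else 0).det := by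
  have hM' : ∀ a b, ∃ q : Polynomial R, Polynomial.X ^ β b * M a b = Polynomial.X ^ α a * q ∧
      q.coeff 0 = if β b ≤ α a then (M a b).coeff (α a - β b) else 0 := by
    intro a b
    split_ifs with hb
    · have hdvd : Polynomial.X ^ (α a - β b) ∣ M a b := by
        rw [Polynomial.X_pow_dvd_iff]
        intro n hn
        by_contra hne
        have := h a b n hne
        omega
      obtain ⟨q, hq⟩ := hdvd
      refine ⟨q, ?_, ?_⟩
      · rw [hq, ← mul_assoc, ← pow_add, Nat.add_sub_cancel' hb]
      · have := Polynomial.coeff_X_pow_mul q (α a - β b) 0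
        rw [zero_add] at this
        rw [hq, this]
    · refine ⟨Polynomial.X ^ (β b - α a) * M a b, ?_, ?_⟩
      · rw [← mul_assoc, ← pow_add, Nat.add_sub_cancel' (by omega)]
      · rw [Polynomial.coeff_X_pow_mul', if_neg (by omega)]
  choose q hq1 hq2 using hM'
  have e1 : Polynomial.X ^ (∑ b, β b) * M.det = Polynomial.X ^ (∑ a, α a) * (Matrix.of q).det := by
    rw [← prod_pow_eq_pow_sum, ← prod_pow_eq_pow_sum, ← Matrix.det_mul_row,
      ← Matrix.det_mul_column]
    congr 1
    ext1 a b
    exact hq1 a b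
  have h0 := Polynomial.coeff_X_pow_mul (Matrix.of q).det (∑ a, α a) 0
  rw [zero_add] at h0
  rw [e1, h0]
  have h2 := RingHom.map_det (Polynomial.constantCoeff (R := R)) (Matrix.of q)
  rw [Polynomial.constantCoeff_apply] at h2
  rw [h2]
  congr 1
  ext1 a b
  exact hq2 a b

/-- The matrix of inverse factorials of differences of two sets of integers, one of them an
interval, is invertible. -/
theorem det_inv_factorial_ne_zero {F σ : Type*} [Field F] [CharZero F] [Fintype σ] [DecidableEq σ]
    {τ ν : σ → ℕ} (hτ : Function.Injective τ) (hν : Function.Injective ν)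
    (hint : ∀ a n, n ≤ ν a → ∃ b, ν b = n) :
    (Matrix.of fun a b : σ => if ν b ≤ τ a then ((τ a - ν b).factorial : F)⁻¹ else 0).det ≠ 0 := by
  -- The values of `ν` are distinct and closed downwards, so they are exactly the integers below the
  -- size of the matrix.
  have hlt : ∀ a, ν a < Fintype.card σ := by
    intro a
    have h1 : range (ν a + 1) ⊆ univ.image ν := by
      intro n hn
      rw [mem_range] at hn
      obtain ⟨b, hb⟩ := hint a n (by omega)
      exact mem_image.mpr ⟨b, mem_univ b, hb⟩
    have h2 := card_le_card h1
    rw [card_range, card_image_of_injective _ hν] at h2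
    exact h2
  set φ : σ → Fin (Fintype.card σ) := fun a => ⟨ν a, hlt a⟩ with hφ
  have hφb : Function.Bijective φ := by
    rw [Fintype.bijective_iff_injective_and_card]
    refine ⟨fun a b hab => hν (congrArg Fin.val hab), by simp⟩
  set ψ := Equiv.ofBijective φ hφb with hψ
  -- `1/(τ - ν)!` is `1/τ!` times the falling factorial of `τ` of length `ν`. The latter is a monic
  -- polynomial of degree `ν` in `τ`, so a Vandermonde determinant in the `τ a` remains.
  have e : ∀ a b, (if ν b ≤ τ a then ((τ a - ν b).factorial : F)⁻¹ else 0) =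
      ((τ a).factorial : F)⁻¹ * ((τ a).descFactorial (ν b) : F) := by
    intro a b
    have hne : ((τ a).factorial : F) ≠ 0 := Nat.cast_ne_zero.mpr (Nat.factorial_ne_zero _)
    split_ifs with h
    · have hne2 : ((τ a - ν b).factorial : F) ≠ 0 := Nat.cast_ne_zero.mpr (Nat.factorial_ne_zero _)
      have h3 : ((τ a - ν b).factorial : F) * ((τ a).descFactorial (ν b) : F) =
          (τ a).factorial := by exact_mod_cast Nat.factorial_mul_descFactorial h
      rw [← h3]
      have h4 : ((τ a).descFactorial (ν b) : F) ≠ 0 := by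
        intro h0
        rw [h0, mul_zero] at h3
        exact hne h3.symm
      field_simp
    · rw [Nat.descFactorial_of_lt (by omega), Nat.cast_zero, mul_zero]
  simp only [e]
  have e2 := Matrix.det_mul_column (fun a => ((τ a).factorial : F)⁻¹)
    (Matrix.of fun a b => ((τ a).descFactorial (ν b) : F))
  simp only [Matrix.of_apply] at e2
  rw [e2]
  refine mul_ne_zero (prod_ne_zero_iff.mpr fun a _ =>
    inv_ne_zero (Nat.cast_ne_zero.mpr (Nat.factorial_ne_zero _))) ?_
  set v : Fin (Fintype.card σ) → F := fun i => (τ (ψ.symm i) : F) with hv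
  have e3 : (Matrix.of fun a b : σ => ((τ a).descFactorial (ν b) : F)) =
      (Matrix.of fun i j : Fin (Fintype.card σ) =>
        (descPochhammer F j).eval (v i)).submatrix ψ ψ := by
    ext a b
    simp only [Matrix.submatrix_apply, Matrix.of_apply, hv, Equiv.symm_apply_apply]
    rw [descPochhammer_eval_eq_descFactorial]
    rfl
  rw [e3, Matrix.det_submatrix_equiv_self,
    ← Matrix.det_eval_matrixOfPolynomials_eq_det_vandermonde v
      (fun i => descPochhammer F i) (fun i => descPochhammer_natDegree F i)
      (fun i => monic_descPochhammer F i), Matrix.det_vandermonde_ne_zero_iff]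
  intro i j hij
  have : τ (ψ.symm i) = τ (ψ.symm j) := by
    simpa [hv] using hij
  exact ψ.symm.injective (hτ this)

end LowestTerms

/-! ### Nonvanishing of the limiting determinant -/

section Nonvanishing

variable {F : Type*} [Field F] {ℓ : ℕ} {d : Fin ℓ → ℕ} {k : ℕ}

/-- The coefficient vector with ones in the lowest and highest degree at each pole. -/
def sparseCoeff (F : Type*) [Field F] {ℓ : ℕ} {d : Fin ℓ → ℕ} (s : CoeffIdx d) : F :=
  if s.2.val = 0 ∨ s.2.val + 1 = d s.1 then 1 else 0

/-- The index of the lowest coefficient at a pole. -/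
def botIdx (hd : ∀ j, 1 ≤ d j) (j : Fin ℓ) : CoeffIdx d := ⟨j, ⟨0, hd j⟩⟩

/-- The homogeneous deformation of the sparse coefficient vector. -/
def sparseDeform (F : Type*) [Field F] {ℓ : ℕ} {d : Fin ℓ → ℕ} (s : CoeffIdx d) :
    Polynomial (Polynomial F) :=
  Polynomial.C (Polynomial.C (sparseCoeff F s)) * Polynomial.X ^ (s.2.val + 1)

variable (B : BlockShape d k) (P : Fin ℓ → F)

/-- The exponent of the deformation parameter in the contribution of a multi-index. -/
def deformExp (a : Fin k) (y h : ℕ) (ρ : CoeffIdx d → ℕ) : ℕ :=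
  ∑ i, poleWeight ρ i + d (B.pole a) * (B.cut + y - h)

/-- The contribution of a multi-index for the sparse coefficient vector. -/
def sparseTerm (a b : Fin k) (y h : ℕ) (ρ : CoeffIdx d → ℕ) : F :=
  (classData B P (RingHom.id F) (sparseCoeff F)).term B a b y h ρ

theorem sparseCoeff_top (hd : ∀ j, 1 ≤ d j) (j : Fin ℓ) : sparseCoeff F (topIdx hd j) = 1 :=
  if_pos (Or.inr (Nat.sub_add_cancel (hd j)))

/-- Giving the coefficient of the `i`-th power of a parameter weight `i` makes the weight of a
monomial in the coefficients equal to its total pole order over all poles. Lowest terms thereby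
select multi-indices with no superfluous poles. -/
theorem term_sparseDeform (a b : Fin k) (y h : ℕ) (ρ : CoeffIdx d → ℕ) :
    (classData B P ((Polynomial.C).comp Polynomial.C) (sparseDeform F)).term B a b y h ρ =
      Polynomial.C (Polynomial.C (sparseTerm B P a b y h ρ)) *
        Polynomial.X ^ deformExp B a y h ρ := by
  set g : F →+* Polynomial (Polynomial F) := (Polynomial.C).comp Polynomial.C with hg
  have hgC : ∀ x, Polynomial.C (Polynomial.C x) = g x := fun _ => rfl
  have e1 : ∏ s, (classData B P g (sparseDeform F)).invFact (ρ s) *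
      (classData B P g (sparseDeform F)).A s ^ ρ s =
      g (∏ s, (classData B P (RingHom.id F) (sparseCoeff F)).invFact (ρ s) *
        (classData B P (RingHom.id F) (sparseCoeff F)).A s ^ ρ s) *
        Polynomial.X ^ (∑ i, poleWeight ρ i) := by
    have e0 : ∑ i, poleWeight ρ i = ∑ s : CoeffIdx d, (s.2.val + 1) * ρ s := by
      rw [Fintype.sum_sigma]
      rfl
    rw [e0, map_prod, ← prod_pow_eq_pow_sum, ← prod_mul_distrib]
    refine prod_congr rfl fun s _ => ?_
    simp only [classData, sparseDeform, hgC, RingHom.id_apply, map_mul, map_pow, mul_pow, ← pow_mul]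
    ring
  have e2 : (classData B P g (sparseDeform F)).A (B.top a) ^ (B.cut + y - h) =
      g ((classData B P (RingHom.id F) (sparseCoeff F)).A (B.top a) ^ (B.cut + y - h)) *
        Polynomial.X ^ (d (B.pole a) * (B.cut + y - h)) := by
    have e0 : (B.top a).2.val + 1 = d (B.pole a) := Nat.sub_add_cancel (B.pos _)
    simp only [classData, sparseDeform, hgC, map_pow, mul_pow, ← pow_mul, e0]
  have e3 := CoefData.map_locCoeffSub g
    ((classData B P (RingHom.id F) (sparseCoeff F)).lead a)
    ((classData B P (RingHom.id F) (sparseCoeff F)).loc (B.pole a)) (B.pole a) (B.expo b ρ)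
    (d (B.pole a) * h + B.res a + poleShift (B.pole a))
    (d (B.pole a) * y + B.expo b ρ (B.pole a))
  have e4 : (fun n => g ((classData B P (RingHom.id F) (sparseCoeff F)).lead a n)) =
      (classData B P g (sparseDeform F)).lead a := rfl
  have e5 : (fun i => PowerSeries.map g ((classData B P (RingHom.id F) (sparseCoeff F)).loc
      (B.pole a) i)) = (classData B P g (sparseDeform F)).loc (B.pole a) := by
    funext i
    ext n
    simp [classData]
  rw [e4, e5] at e3
  rw [CoefData.term, e1, e2, ← e3, sparseTerm, CoefData.term, deformExp, hgC, pow_add]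
  simp only [map_mul]
  have e6 : (classData B P g (sparseDeform F)).ratio a ((y : ℤ) - h) =
      g ((classData B P (RingHom.id F) (sparseCoeff F)).ratio a ((y : ℤ) - h)) := rfl
  rw [e6]
  ring

/-- The coefficients of lowest order in the deformation parameter. -/
def lowCoef (a b : Fin k) (y : ℕ) : F :=
  ∑ h ∈ range (B.cut + 1), ∑ ρ ∈ piAntidiag (univ.erase (B.top a)) h,
    if deformExp B a y h ρ + weightNum (B.idx b) = d (B.pole a) * B.cut + B.res a then
      sparseTerm B P a b y h ρ else 0

variable {B P}

theorem sum_poleWeight_eq (a : Fin k) (ρ : CoeffIdx d → ℕ) : ∑ i, poleWeight ρ i =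
    poleWeight ρ (B.pole a) + ∑ i ∈ univ.erase (B.pole a), poleWeight ρ i :=
  (add_sum_erase univ _ (mem_univ _)).symm

theorem sparseTerm_ne_zero {a b : Fin k} {y h : ℕ} {ρ : CoeffIdx d → ℕ}
    (h0 : sparseTerm B P a b y h ρ ≠ 0) :
    d (B.pole a) * h + B.res a + poleShift (B.pole a) ≤
      d (B.pole a) * y + B.expo b ρ (B.pole a) ∧
    (∀ s, ρ s ≠ 0 → s.2.val = 0 ∨ s.2.val + 1 = d s.1) ∧
    locCoeff ((classData B P (RingHom.id F) (sparseCoeff F)).lead a)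
      ((classData B P (RingHom.id F) (sparseCoeff F)).loc (B.pole a)) (B.pole a) (B.expo b ρ)
      (d (B.pole a) * y + B.expo b ρ (B.pole a) -
        (d (B.pole a) * h + B.res a + poleShift (B.pole a))) ≠ 0 := by
  unfold sparseTerm CoefData.term at h0
  have h1 := right_ne_zero_of_mul h0
  have h2 := right_ne_zero_of_mul (left_ne_zero_of_mul (left_ne_zero_of_mul h0))
  unfold locCoeffSub at h1
  have hlo : d (B.pole a) * h + B.res a + poleShift (B.pole a) ≤
      d (B.pole a) * y + B.expo b ρ (B.pole a) := by
    by_contra h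
    rw [if_neg h] at h1
    exact h1 rfl
  rw [if_pos hlo] at h1
  refine ⟨hlo, fun s hs => ?_, h1⟩
  have h3 := right_ne_zero_of_mul (prod_ne_zero_iff.mp h2 s (mem_univ s))
  by_contra hcon
  apply h3
  have h4 : (classData B P (RingHom.id F) (sparseCoeff F)).A s = 0 := if_neg hcon
  rw [h4, zero_pow hs]

theorem single_pole_eq (a b : Fin k) :
    (B.pole b = B.pole a ∧ (Pi.single (B.pole b) (B.idx b).1.2 : Fin ℓ → ℕ) (B.pole a) =
      weightNum (B.idx b) + poleShift (B.pole a)) ∨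
    (B.pole b ≠ B.pole a ∧ (Pi.single (B.pole b) (B.idx b).1.2 : Fin ℓ → ℕ) (B.pole a) = 0) := by
  by_cases h : B.pole b = B.pole a
  · refine Or.inl ⟨h, ?_⟩
    rw [← h, Pi.single_eq_same]
    exact (weightNum_add (B.idx b)).symm
  · exact Or.inr ⟨h, Pi.single_eq_of_ne (Ne.symm h) _⟩

/-- A nonzero term has sufficient order at the pole of its row, and the total weight is at least the
order there; the column element supplies at most `ν_b + poleShift` of it. -/
theorem le_deformExp {a b : Fin k} {y h : ℕ} {ρ : CoeffIdx d → ℕ} (hh : h ≤ B.cut)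
    (h0 : sparseTerm B P a b y h ρ ≠ 0) :
    d (B.pole a) * B.cut + B.res a ≤ deformExp B a y h ρ + weightNum (B.idx b) := by
  have h1 := (sparseTerm_ne_zero h0).1
  have h2 := single_pole_eq (B := B) a b
  have h3 : d (B.pole a) * (B.cut + y - h) + d (B.pole a) * h =
      d (B.pole a) * B.cut + d (B.pole a) * y := by
    rw [← mul_add, ← mul_add]; congr 1; omega
  have h4 := sum_poleWeight_eq (B := B) a ρ
  unfold deformExp
  unfold BlockShape.expo at h1
  simp only [Pi.add_apply] at h1
  omega

/-- The multi-indices that contribute to the coefficients of lowest order. -/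
theorem eq_of_deformExp_eq {a b : Fin k} {y h : ℕ} {ρ : CoeffIdx d → ℕ} (hh : h ≤ B.cut)
    (hρ : ρ ∈ piAntidiag (univ.erase (B.top a)) h) (h0 : sparseTerm B P a b y h ρ ≠ 0)
    (heq : deformExp B a y h ρ + weightNum (B.idx b) = d (B.pole a) * B.cut + B.res a) :
    ρ = Pi.single (botIdx B.pos (B.pole a)) h ∧ (d (B.pole a) = 1 → h = 0) ∧
      d (B.pole a) * y + h + weightNum (B.idx b) = d (B.pole a) * h + B.res a ∧
      d (B.pole a) * y + B.expo b ρ (B.pole a) =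
        d (B.pole a) * h + B.res a + poleShift (B.pole a) ∧
      (B.pole b ≠ B.pole a → weightNum (B.idx b) = 0 ∧ poleShift (B.pole a) = 0) := by
  obtain ⟨h1, hc, -⟩ := sparseTerm_ne_zero h0
  have h2 := single_pole_eq (B := B) a b
  have h3 : d (B.pole a) * (B.cut + y - h) + d (B.pole a) * h =
      d (B.pole a) * B.cut + d (B.pole a) * y := by
    rw [← mul_add, ← mul_add]; congr 1; omega
  have h4 := sum_poleWeight_eq (B := B) a ρ
  unfold deformExp at heq
  have hexpo : B.expo b ρ (B.pole a) = poleWeight ρ (B.pole a) +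
    (Pi.single (B.pole b) (B.idx b).1.2 : Fin ℓ → ℕ) (B.pole a) := rfl
  rw [hexpo] at h1 ⊢
  -- Equality leaves no room in `le_deformExp`: the multi-index has no weight at the other poles.
  have hrest : ∑ i ∈ univ.erase (B.pole a), poleWeight ρ i = 0 := by omega
  have hsupp : ∀ s, ρ s ≠ 0 → s = botIdx B.pos (B.pole a) := by
    intro s hs
    have hs1 : s.1 = B.pole a := by
      by_contra hne
      have h5 := (sum_eq_zero_iff.mp hrest) s.1 (mem_erase.mpr ⟨hne, mem_univ _⟩)
      have h6 := (sum_eq_zero_iff.mp h5) s.2 (mem_univ _)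
      rcases Nat.mul_eq_zero.mp h6 with h7 | h7
      · omega
      · exact hs h7
    have hs2 : s ≠ B.top a := (mem_erase.mp ((mem_piAntidiag.mp hρ).2 s hs)).1
    obtain ⟨j, l⟩ := s
    simp only at hs1
    subst hs1
    have h8 : l.val = 0 := by
      rcases hc _ hs with h9 | h9
      · exact h9
      · exfalso
        apply hs2
        simp only at h9
        unfold BlockShape.top topIdx
        congr 1
        exact Fin.ext (by simp only; omega)
    unfold botIdx
    congr 1
    exact Fin.ext h8
  have hρh : ρ = Pi.single (botIdx B.pos (B.pole a)) h := by
    have h5 : ρ = Pi.single (botIdx B.pos (B.pole a)) (ρ (botIdx B.pos (B.pole a))) := by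
      funext s
      by_cases hs : s = botIdx B.pos (B.pole a)
      · rw [hs, Pi.single_eq_same]
      · rw [Pi.single_eq_of_ne hs]
        by_contra hne
        exact hs (hsupp s hne)
    have h6 : ρ (botIdx B.pos (B.pole a)) = h := by
      have h7 := (mem_piAntidiag.mp hρ).1
      by_cases hne : ρ (botIdx B.pos (B.pole a)) = 0
      · rw [← h7, hne]
        symm
        refine sum_eq_zero fun s _ => ?_
        by_contra hs
        rw [← hsupp s hs] at hne
        exact hs hne
      · rw [← h7]
        symm
        refine sum_eq_single _ (fun s _ hs => ?_) fun hs => ?_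
        · by_contra hne
          exact hs (hsupp s hne)
        · by_contra hne
          exact hs ((mem_piAntidiag.mp hρ).2 _ hne)
    rw [h6] at h5
    exact h5
  have hpw : poleWeight ρ (B.pole a) = h := by
    rw [hρh, poleWeight_single]
    simp [botIdx]
  refine ⟨hρh, fun hd1 => ?_, by omega, by omega, fun hne => by omega⟩
  -- For `d = 1` the lowest index is the leading one, where `ρ` vanishes.
  by_contra hne
  have h5 : ρ (botIdx B.pos (B.pole a)) ≠ 0 := by rw [hρh, Pi.single_eq_same]; exact hne
  have h6 := (mem_erase.mp ((mem_piAntidiag.mp hρ).2 _ h5)).1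
  apply h6
  unfold botIdx BlockShape.top topIdx
  congr 1
  exact Fin.ext (by simp only; omega)

/-- If `h = y + g`, the relation says `y + ν - τ = (D - 1) g`; if `y = h + g`, then `D g ≤ τ < D`
forces `g = 0`. When `D = 1` the first case with `g > 0` is excluded by hypothesis. -/
theorem le_add_of_eq {D y h ν τ : ℕ} (hτ : τ < D) (hD : D = 1 → h = 0)
    (he : D * y + h + ν = D * h + τ) : τ ≤ y + ν ∧ (y + ν = τ → h = y) := by
  rcases Nat.lt_or_ge y h with hlt | hge
  · obtain ⟨g, rfl⟩ : ∃ g, h = y + g := ⟨h - y, by omega⟩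
    obtain ⟨E, rfl⟩ : ∃ E, D = E + 1 := ⟨D - 1, by omega⟩
    have h1 : (E + 1) * (y + g) = (E + 1) * y + E * g + g := by ring
    have h2 : E ≠ 0 := fun h => by have := hD (by omega); omega
    have h3 : 1 ≤ E * g := Nat.mul_pos (by omega) (by omega)
    omega
  · obtain ⟨g, rfl⟩ : ∃ g, y = h + g := ⟨y - h, by omega⟩
    have h1 : D * (h + g) = D * h + D * g := by ring
    have h2 : g = 0 := by
      by_contra hg
      have := Nat.le_mul_of_pos_right D (Nat.pos_of_ne_zero hg)
      omega
    subst h2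
    omega

theorem le_of_lowCoef_ne_zero {a b : Fin k} (hres : B.res a < d (B.pole a)) {y : ℕ}
    (h0 : lowCoef B P a b y ≠ 0) : B.res a ≤ y + weightNum (B.idx b) := by
  obtain ⟨h, hh, h1⟩ := exists_ne_zero_of_sum_ne_zero h0
  obtain ⟨ρ, hρ, h2⟩ := exists_ne_zero_of_sum_ne_zero h1
  rw [mem_range] at hh
  split_ifs at h2 with heq
  · obtain ⟨-, h4, h5, -, -⟩ := eq_of_deformExp_eq (by omega) hρ h2 heq
    exact (le_add_of_eq hres h4 h5).1
  · exact absurd rfl h2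

/-- Equality of weights forces the column to have numerator zero and the row to lie at infinity or
at the origin. At infinity the term still vanishes, because the parameter of a finite pole has no
constant term there. At the origin it may survive. -/
theorem lowCoef_of_ne {a b : Fin k} (hab : B.pole b ≠ B.pole a) (ha : (B.pole a).val ≠ 1) (y : ℕ) :
    lowCoef B P a b y = 0 := by
  refine sum_eq_zero fun h hh => sum_eq_zero fun ρ hρ => ?_
  rw [mem_range] at hh
  split_ifs with heq
  · by_contra h2
    obtain ⟨-, -, -, h6, h7⟩ := eq_of_deformExp_eq (by omega) hρ h2 heq
    obtain ⟨hν, hs⟩ := h7 hab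
    have ha0 : (B.pole a).val = 0 := by
      unfold poleShift at hs
      by_contra hne
      rw [if_neg (by omega)] at hs
      exact one_ne_zero hs
    have hb0 : (B.pole b).val ≠ 0 := fun h => hab (Fin.ext (h.trans ha0.symm))
    have hb1 : 1 ≤ (B.idx b).1.2 := by
      rcases (B.idx b).2 with h | h
      · exact h
      · exact absurd h.1 hb0
    obtain ⟨-, -, h8⟩ := sparseTerm_ne_zero h2
    rw [h6, Nat.sub_self] at h8
    unfold locCoeff at h8
    rw [zero_add, sum_range_one, Nat.sub_zero] at h8
    have h9 := right_ne_zero_of_mul h8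
    rw [PowerSeries.coeff_zero_eq_constantCoeff_apply, map_prod] at h9
    have h10 := prod_ne_zero_iff.mp h9 (B.pole b) (mem_erase.mpr ⟨hab, mem_univ _⟩)
    apply h10
    have h11 : B.expo b ρ (B.pole b) ≠ 0 := by
      unfold BlockShape.expo
      simp only [Pi.add_apply, Pi.single_eq_same]
      omega
    rw [map_pow]
    have h12 : PowerSeries.constantCoeff
        ((classData B P (RingHom.id F) (sparseCoeff F)).loc (B.pole a) (B.pole b)) = 0 := by
      simp [classData, locSeries, ha0]
    rw [h12, zero_pow h11]
  · rfl

/-- Only `h = y` with `ρ` concentrated on the lowest index reaches the minimum, and there every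
factor is `1` except the inverse factorial of `ρ`. -/
theorem lowCoef_res_sub (hB : B.IsLarge) {a b : Fin k} (hab : B.pole b = B.pole a)
    (hres : B.res a < d (B.pole a)) (hle : weightNum (B.idx b) ≤ B.res a)
    (hdep : B.res a ≤ B.depth) :
    lowCoef B P a b (B.res a - weightNum (B.idx b)) =
      ((B.res a - weightNum (B.idx b)).factorial : F)⁻¹ := by
  obtain ⟨y, hy⟩ : ∃ y, y = B.res a - weightNum (B.idx b) := ⟨_, rfl⟩
  rw [← hy]
  set ρ₀ : CoeffIdx d → ℕ := Pi.single (botIdx B.pos (B.pole a)) y with hρ₀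
  have hcut : y ≤ B.cut := by
    have h1 := hB.le_cut a b
    have h2 := Nat.le_mul_of_pos_left B.depth (B.pos (B.pole a))
    omega
  have hbd := hB.cut_le_bound
  have hpw : ∀ i, poleWeight ρ₀ i = if B.pole a = i then y else 0 := by
    intro i
    rw [hρ₀, poleWeight_single]
    simp [botIdx]
  have hmem : ρ₀ ∈ piAntidiag (univ.erase (B.top a)) y := by
    rw [mem_piAntidiag]
    by_cases hne : botIdx B.pos (B.pole a) = B.top a
    · have hd1 : d (B.pole a) = 1 := by
        unfold botIdx BlockShape.top topIdx at hne
        have h1 := (Sigma.mk.inj_iff.mp hne).2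
        have h2 := congrArg Fin.val (eq_of_heq h1)
        simp only at h2
        have := B.pos (B.pole a)
        omega
      have hy0 : y = 0 := by omega
      rw [hρ₀, hy0, Pi.single_zero]
      exact ⟨by simp, fun i hi => absurd rfl hi⟩
    · refine ⟨?_, fun s hs => ?_⟩
      · rw [hρ₀]
        rw [sum_eq_single (botIdx B.pos (B.pole a)) (fun s _ hs => Pi.single_eq_of_ne hs _)
          (fun h => absurd (mem_erase.mpr ⟨hne, mem_univ _⟩) h), Pi.single_eq_same]
      · have hs' : s = botIdx B.pos (B.pole a) := by
          by_contra h
          exact hs (Pi.single_eq_of_ne h _)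
        rw [hs']
        exact mem_erase.mpr ⟨hne, mem_univ _⟩
  have hterm : ∀ h ∈ range (B.cut + 1), ∀ ρ ∈ piAntidiag (univ.erase (B.top a)) h,
      (h ≠ y ∨ ρ ≠ ρ₀) →
      (if deformExp B a y h ρ + weightNum (B.idx b) = d (B.pole a) * B.cut + B.res a then
        sparseTerm B P a b y h ρ else 0) = 0 := by
    intro h hh ρ hρ hne
    rw [mem_range] at hh
    split_ifs with heq
    · by_contra h2
      obtain ⟨h3, h4, h5, -, -⟩ := eq_of_deformExp_eq (by omega) hρ h2 heq
      have h6 := (le_add_of_eq hres h4 h5).2 (by omega)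
      rcases hne with h7 | h7
      · exact h7 h6
      · rw [h6] at h3
        exact h7 h3
    · rfl
  unfold lowCoef
  rw [sum_eq_single y (fun h hh hne => sum_eq_zero fun ρ hρ => hterm h hh ρ hρ (Or.inl hne))
    (fun h => absurd (mem_range.mpr (by omega)) h),
    sum_eq_single ρ₀ (fun ρ hρ hne => hterm y (mem_range.mpr (by omega)) ρ hρ (Or.inr hne))
    (fun h => absurd hmem h)]
  have hexp : ∀ i, B.expo b ρ₀ i =
      (if B.pole a = i then y + (B.idx b).1.2 else 0) := by
    intro i
    unfold BlockShape.expo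
    simp only [Pi.add_apply, hpw]
    by_cases h : B.pole a = i
    · rw [if_pos h, if_pos h, hab, h, Pi.single_eq_same]
    · rw [if_neg h, if_neg h, hab, Pi.single_eq_of_ne (Ne.symm h), zero_add]
  have hwn : weightNum (B.idx b) + poleShift (B.pole a) = (B.idx b).1.2 := by
    rw [← hab]; exact weightNum_add (B.idx b)
  rw [if_pos]
  · unfold sparseTerm CoefData.term
    have hloc : locCoeffSub ((classData B P (RingHom.id F) (sparseCoeff F)).lead a)
        ((classData B P (RingHom.id F) (sparseCoeff F)).loc (B.pole a)) (B.pole a)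
        (B.expo b ρ₀) (d (B.pole a) * y + B.res a + poleShift (B.pole a))
        (d (B.pole a) * y + B.expo b ρ₀ (B.pole a)) = 1 := by
      have h1 : d (B.pole a) * y + B.expo b ρ₀ (B.pole a) =
          d (B.pole a) * y + B.res a + poleShift (B.pole a) := by
        rw [hexp, if_pos rfl]
        omega
      rw [h1, locCoeffSub, if_pos le_rfl, Nat.sub_self, locCoeff, zero_add, sum_range_one,
        Nat.sub_zero, prod_eq_one fun i hi => by
          rw [hexp, if_neg (Ne.symm (ne_of_mem_erase hi)), pow_zero]]
      simp [classData]
    have hprod : ∏ s, (classData B P (RingHom.id F) (sparseCoeff F)).invFact (ρ₀ s) *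
        (classData B P (RingHom.id F) (sparseCoeff F)).A s ^ ρ₀ s = (y.factorial : F)⁻¹ := by
      rw [prod_eq_single (botIdx B.pos (B.pole a))]
      · have h1 : (classData B P (RingHom.id F) (sparseCoeff F)).A (botIdx B.pos (B.pole a)) =
            1 := by simp [classData, sparseCoeff, botIdx]
        rw [hρ₀, Pi.single_eq_same, h1, one_pow, mul_one]
        simp only [classData, RingHom.id_apply]
        rw [if_pos (by omega)]
      · intro s _ hs
        rw [hρ₀, Pi.single_eq_of_ne hs, pow_zero]
        simp [classData]
      · exact fun h => absurd (mem_univ _) h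
    have htop : (classData B P (RingHom.id F) (sparseCoeff F)).A (B.top a) = 1 :=
      sparseCoeff_top B.pos (B.pole a)
    have hratio : (classData B P (RingHom.id F) (sparseCoeff F)).ratio a ((y : ℤ) - y) = 1 := by
      simp only [classData, sub_self, RingHom.id_apply]
      rw [if_pos (by omega), shiftFactor_zero]
    rw [hloc, hprod, htop, hratio, one_pow]
    simp
  · unfold deformExp
    simp only [hpw, sum_ite_eq, mem_univ, if_true]
    rw [Nat.add_sub_cancel]
    omega

end Nonvanishing

/-! ### The determinant of lowest terms is nonzero -/

section NonvanishingDet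

variable {F : Type*} [Field F] [CharZero F] {ℓ : ℕ} {d : Fin ℓ → ℕ} {k : ℕ}

/-- The order in which the poles have to be arranged to make the limiting block triangular. -/
def blockLabel {ℓ : ℕ} (j : Fin ℓ) : ℕ := if j.val = 1 then 0 else j.val + 1

theorem blockLabel_injective : Function.Injective (blockLabel (ℓ := ℓ)) := by
  intro i j h
  unfold blockLabel at h
  split_ifs at h <;> exact Fin.ext (by omega)

/-- The basis elements of the block are, at each pole, the first ones. -/
structure BlockShape.IsInitial (B : BlockShape d k) : Prop where
  inj : Function.Injective B.idx
  down : ∀ (a : Fin k) (b : BasisIdx ℓ), b.1.1 = B.pole a → weightNum b ≤ weightNum (B.idx a) →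
    ∃ a', B.idx a' = b

theorem basisIdx_ext {b b' : BasisIdx ℓ} (h1 : b.1.1 = b'.1.1) (h2 : weightNum b = weightNum b') :
    b = b' := by
  have h3 := weightNum_add b
  have h4 := weightNum_add b'
  apply Subtype.ext
  refine Prod.ext h1 ?_
  rw [h1] at h3
  omega

/-- The smallest numerator of a weight at a pole. -/
def minNum {ℓ : ℕ} (j : Fin ℓ) : ℕ := if j.val = 1 ∨ (j.val = 0 ∧ ℓ = 1) then 1 else 0

theorem minNum_le (b : BasisIdx ℓ) : minNum b.1.1 ≤ weightNum b := by
  have h := weightNum_add b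
  have h2 := b.2
  have h3 := b.1.1.2
  unfold minNum
  unfold poleShift at h
  split_ifs at h ⊢ <;> omega

theorem exists_basisIdx_of_minNum_le {j : Fin ℓ} {n : ℕ} (hn : minNum j ≤ n) :
    ∃ b : BasisIdx ℓ, b.1.1 = j ∧ weightNum b = n := by
  have h3 := j.2
  refine ⟨⟨(j, n + poleShift j), ?_⟩, rfl, Nat.add_sub_cancel n (poleShift j)⟩
  unfold minNum at hn
  unfold poleShift
  simp only
  split_ifs at hn ⊢ <;> omega

/-- With the origin placed first the matrix is block triangular by poles. In the block of `j` the
residues are distinct since `u` is invertible modulo `d j`, and the numerators fill an interval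
starting at `minNum j`. Shifting both by `minNum j` leaves the differences unchanged and makes the
interval start at zero, as in `det_inv_factorial_ne_zero`. -/
theorem det_lowest_ne_zero {B : BlockShape d k} (hB : B.IsLarge) (hI : B.IsInitial) {u : ℕ}
    (hu : ∀ j, u.Coprime (d j)) (hres : ∀ a, B.res a = u * weightNum (B.idx a) % d (B.pole a))
    (hdep : ∀ a, B.res a ≤ B.depth) (P : Fin ℓ → F) :
    (Matrix.of fun a b : Fin k => if weightNum (B.idx b) ≤ B.res a then
      lowCoef B P a b (B.res a - weightNum (B.idx b)) else 0).det ≠ 0 := by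
  classical
  have hlt : ∀ a, B.res a < d (B.pole a) := fun a => by
    rw [hres]; exact Nat.mod_lt _ (B.pos _)
  set M : Matrix (Fin k) (Fin k) F := Matrix.of fun a b : Fin k =>
    if weightNum (B.idx b) ≤ B.res a then
      lowCoef B P a b (B.res a - weightNum (B.idx b)) else 0 with hM
  have htri : M.BlockTriangular fun a => blockLabel (B.pole a) := by
    intro a b hab
    simp only at hab
    simp only [hM, Matrix.of_apply]
    split_ifs
    · refine lowCoef_of_ne (fun h => ?_) (fun h => ?_) _
      · rw [h] at hab
        exact lt_irrefl _ hab
      · unfold blockLabel at hab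
        rw [if_pos h] at hab
        omega
    · rfl
  rw [htri.det]
  refine prod_ne_zero_iff.mpr fun v _ => ?_
  have hpole : ∀ a b : {a : Fin k // blockLabel (B.pole a) = v}, B.pole a = B.pole b :=
    fun a b => blockLabel_injective (a.2.trans b.2.symm)
  have hmin : ∀ a : Fin k, minNum (B.pole a) ≤ weightNum (B.idx a) := fun a => minNum_le _
  have hdvd : ∀ (j : Fin ℓ) (n : ℕ), d j ∣ u * n → d j ∣ n := fun j n h =>
    (hu j).symm.dvd_of_dvd_mul_left h
  -- A residue can vanish only if the numerator does, since `d` is prime to `u` and the numerator is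
  -- below `d`.
  have hminr : ∀ a : Fin k, minNum (B.pole a) ≤ B.res a := by
    intro a
    have h1 := hmin a
    have h2 : minNum (B.pole a) ≤ 1 := by unfold minNum; split_ifs <;> omega
    by_contra hcon
    have h3 : B.res a = 0 := by omega
    rw [hres] at h3
    have h4 := Nat.le_of_dvd (by omega) (hdvd _ _ (Nat.dvd_of_mod_eq_zero h3))
    have := hB.weight_lt a
    omega
  have hsub : M.toSquareBlock (fun a => blockLabel (B.pole a)) v =
      Matrix.of fun a b : {a : Fin k // blockLabel (B.pole a) = v} =>
        if weightNum (B.idx b) - minNum (B.pole b) ≤ B.res a - minNum (B.pole a) then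
          (((B.res a - minNum (B.pole a)) - (weightNum (B.idx b) - minNum (B.pole b))).factorial :
            F)⁻¹ else 0 := by
    ext a b
    have hp := hpole b a
    have h1 := hmin b
    have h2 := hminr a
    simp only [Matrix.toSquareBlock_def, Matrix.of_apply, hM]
    rw [hp] at h1 ⊢
    by_cases hle : weightNum (B.idx b) ≤ B.res a
    · rw [if_pos hle, if_pos (by omega), lowCoef_res_sub hB hp (hlt a) hle (hdep a)]
      congr 3
      omega
    · rw [if_neg hle, if_neg (by omega)]
  rw [hsub]
  refine det_inv_factorial_ne_zero
    (τ := fun a : {a : Fin k // blockLabel (B.pole a) = v} => B.res a - minNum (B.pole a))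
    (ν := fun b : {a : Fin k // blockLabel (B.pole a) = v} =>
      weightNum (B.idx b) - minNum (B.pole b)) (fun a b hab => ?_) (fun a b hab => ?_)
    fun a n hn => ?_
  · simp only at hab
    have hp := hpole a b
    have h1 := hminr a
    have h2 := hminr b
    rw [hp] at hab h1
    have h3 : B.res a = B.res b := by omega
    rw [hres, hres, hp] at h3
    have h4 : weightNum (B.idx a) = weightNum (B.idx b) := by
      have h5 : weightNum (B.idx a) ≡ weightNum (B.idx b) [MOD d (B.pole b)] :=
        Nat.ModEq.cancel_left_of_coprime (Nat.Coprime.symm (hu _)) h3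
      have h6 := hB.weight_lt a
      rw [hp] at h6
      exact Nat.ModEq.eq_of_lt_of_lt h5 h6 (hB.weight_lt b)
    exact Subtype.ext (hI.inj (basisIdx_ext hp h4))
  · simp only at hab
    have hp := hpole a b
    have h1 := hmin a
    have h2 := hmin b
    rw [hp] at hab h1
    exact Subtype.ext (hI.inj (basisIdx_ext hp (by omega)))
  · obtain ⟨b, hb1, hb2⟩ := exists_basisIdx_of_minNum_le (j := B.pole a)
      (n := n + minNum (B.pole a)) (Nat.le_add_left _ _)
    have h1 := hmin a
    obtain ⟨a', ha'⟩ := hI.down a b hb1 (by omega)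
    have hp : B.pole a' = B.pole a := by rw [BlockShape.pole, ha', hb1]
    refine ⟨⟨a', by rw [hp]; exact a.2⟩, ?_⟩
    rw [ha', hp]
    omega

/-- Some coefficient of low degree of the limiting determinant is a nonzero polynomial. -/
theorem exists_coeff_detPoly_ne_zero {B : BlockShape d k} (hB : B.IsLarge) (hI : B.IsInitial)
    {u : ℕ} (hu : ∀ j, u.Coprime (d j))
    (hres : ∀ a, B.res a = u * weightNum (B.idx a) % d (B.pole a))
    (hdep : ∑ a, B.res a ≤ B.depth) (P : Fin ℓ → F) :
    ∃ t ≤ B.depth,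
      ((classData B P MvPolynomial.C MvPolynomial.X).detPoly B).coeff t ≠ 0 := by
  by_contra! hcon
  have hdep' : ∀ a, B.res a ≤ B.depth := fun a =>
    (single_le_sum (f := B.res) (fun _ _ => Nat.zero_le _) (mem_univ a)).trans hdep
  have hlt : ∀ a, B.res a < d (B.pole a) := fun a => by
    rw [hres]; exact Nat.mod_lt _ (B.pos _)
  -- Two variables: the outer one scales the coefficients of `f`, the inner one will take the place
  -- of `γ`.
  set g : F →+* Polynomial (Polynomial F) := (Polynomial.C).comp Polynomial.C with hg
  set D := classData B P g (sparseDeform F) with hD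
  have hmap : (classData B P MvPolynomial.C MvPolynomial.X).map
      (MvPolynomial.eval₂Hom g (sparseDeform F)) = D := by
    rw [classData_map, hD]
    congr 1
    · ext x
      simp
    · funext s
      simp
  have hzero : ∀ t ≤ B.depth, (D.detPoly B).coeff t = 0 := by
    intro t ht
    rw [← hmap, CoefData.coeff_detPoly_map, hcon t ht, map_zero]
  -- If all coefficients of degree at most `depth` vanished, the determinant would be divisible by
  -- the power `depth + 1` of the inner variable. This is refuted by computing a term of inner order
  -- at most `∑ res ≤ depth`.
  have hdvd : (Polynomial.C (Polynomial.X : Polynomial F)) ^ (B.depth + 1) ∣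
      (D.detPoly B).eval (Polynomial.C Polynomial.X) := by
    have h1 : Polynomial.X ^ (B.depth + 1) ∣ D.detPoly B := by
      rw [Polynomial.X_pow_dvd_iff]
      exact fun t ht => hzero t (by omega)
    have h2 := map_dvd (Polynomial.evalRingHom
      (Polynomial.C (Polynomial.X : Polynomial F))) h1
    simpa using h2
  set N : Matrix (Fin k) (Fin k) (Polynomial (Polynomial F)) := Matrix.of fun a b =>
    (D.entryPoly B a b).eval (Polynomial.C Polynomial.X) with hN
  have hNdet : (D.detPoly B).eval (Polynomial.C Polynomial.X) = N.det := by
    have h := RingHom.map_det (Polynomial.evalRingHom (Polynomial.C (Polynomial.X : Polynomial F)))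
      (Matrix.of fun a b => D.entryPoly B a b)
    rw [Polynomial.coe_evalRingHom] at h
    rw [CoefData.detPoly, h]
    rfl
  have hNcoeff : ∀ a b n, (N a b).coeff n = ∑ y ∈ range (B.depth + 1), ∑ h ∈ range (B.cut + 1),
      ∑ ρ ∈ piAntidiag (univ.erase (B.top a)) h, if deformExp B a y h ρ = n then
        Polynomial.C (sparseTerm B P a b y h ρ) * Polynomial.X ^ y else 0 := by
    intro a b n
    simp only [hN, Matrix.of_apply, CoefData.entryPoly, Polynomial.eval_finsetSum,
      Polynomial.eval_mul, Polynomial.eval_C, Polynomial.eval_pow, Polynomial.eval_X,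
      Polynomial.finsetSum_coeff, CoefData.coef, sum_mul, hD, hg, term_sparseDeform]
    refine sum_congr rfl fun y _ => sum_congr rfl fun h _ => sum_congr rfl fun ρ _ => ?_
    rw [mul_right_comm, ← map_pow, ← map_mul, Polynomial.coeff_C_mul, Polynomial.coeff_X_pow]
    by_cases h : n = deformExp B a y h ρ
    · rw [if_pos h, if_pos h.symm, mul_one]
    · rw [if_neg h, if_neg (Ne.symm h), mul_zero]
  set α : Fin k → ℕ := fun a => d (B.pole a) * B.cut + B.res a with hα
  set β : Fin k → ℕ := fun b => weightNum (B.idx b) with hβ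
  -- First reduction: lowest order in the scaling variable.
  have hlow := coeff_det_of_le N α β (fun a b n hne => by
    rw [hNcoeff] at hne
    obtain ⟨y, -, h1⟩ := exists_ne_zero_of_sum_ne_zero hne
    obtain ⟨h, hh, h2⟩ := exists_ne_zero_of_sum_ne_zero h1
    obtain ⟨ρ, -, h3⟩ := exists_ne_zero_of_sum_ne_zero h2
    rw [mem_range] at hh
    split_ifs at h3 with he
    · have h4 : sparseTerm B P a b y h ρ ≠ 0 := by
        intro h0
        rw [h0] at h3
        simp at h3
      have := le_deformExp (by omega) h4
      rw [he] at this
      exact this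
    · exact absurd rfl h3)
  set T : Matrix (Fin k) (Fin k) (Polynomial F) :=
    Matrix.of fun a b => if β b ≤ α a then (N a b).coeff (α a - β b) else 0 with hT
  have hTeq : ∀ a b n, (T a b).coeff n =
      if n ∈ range (B.depth + 1) then lowCoef B P a b n else 0 := by
    intro a b n
    have h1 : T a b = ∑ y ∈ range (B.depth + 1),
        Polynomial.C (lowCoef B P a b y) * Polynomial.X ^ y := by
      simp only [hT, Matrix.of_apply]
      split_ifs with hle
      · rw [hNcoeff]
        refine sum_congr rfl fun y _ => ?_
        unfold lowCoef
        rw [map_sum, sum_mul]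
        refine sum_congr rfl fun h _ => ?_
        rw [map_sum, sum_mul]
        refine sum_congr rfl fun ρ _ => ?_
        by_cases he : deformExp B a y h ρ = α a - β b
        · rw [if_pos he, if_pos (by simp only [hα, hβ] at he hle; omega)]
        · rw [if_neg he, if_neg (by simp only [hα, hβ] at he hle; omega), map_zero, zero_mul]
      · symm
        refine sum_eq_zero fun y _ => ?_
        have : lowCoef B P a b y = 0 := by
          refine sum_eq_zero fun h _ => sum_eq_zero fun ρ _ => ?_
          rw [if_neg (by simp only [hα, hβ] at hle; omega)]
        rw [this, map_zero, zero_mul]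
    rw [h1]
    simp only [Polynomial.finsetSum_coeff, Polynomial.coeff_C_mul, Polynomial.coeff_X_pow,
      mul_ite, mul_one, mul_zero]
    rw [sum_ite_eq]
  -- Second reduction: lowest order in the inner variable, which leaves the matrix of inverse
  -- factorials.
  have hT2 := coeff_det_of_le T B.res β (fun a b n hne => by
    rw [hTeq] at hne
    split_ifs at hne
    · exact le_of_lowCoef_ne_zero (hlt a) hne
    · exact absurd rfl hne)
  have hfin := det_lowest_ne_zero hB hI hu hres hdep' P
  apply hfin
  have e1 : (Matrix.of fun a b : Fin k => if weightNum (B.idx b) ≤ B.res a then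
      lowCoef B P a b (B.res a - weightNum (B.idx b)) else 0) =
      Matrix.of fun a b => if β b ≤ B.res a then (T a b).coeff (B.res a - β b) else 0 := by
    ext a b
    simp only [Matrix.of_apply, hβ]
    split_ifs
    · rw [hTeq, if_pos (mem_range.mpr (by have := hdep' a; omega))]
    · rfl
  rw [e1, ← hT2]
  have hd2 : (Polynomial.X : Polynomial F) ^ (B.depth + 1) ∣ T.det := by
    rw [← hlow]
    have h1 : Polynomial.C ((Polynomial.X : Polynomial F) ^ (B.depth + 1)) ∣
        Polynomial.X ^ (∑ b, β b) * N.det := by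
      rw [map_pow, ← hNdet]
      exact Dvd.dvd.mul_left hdvd _
    exact (Polynomial.C_dvd_iff_dvd_coeff _ _).mp h1 _
  exact Polynomial.X_pow_dvd_iff.mp (Dvd.dvd.mul_left hd2 _) _ (by omega)

end NonvanishingDet

/-! ### The Hodge polygon and the weights of the basis -/

section Hodge

variable {ℓ : ℕ} {d : Fin ℓ → ℕ}

theorem length_hodgeSlopes (hℓ : 1 ≤ ℓ) (hd : ∀ j, 1 ≤ d j) :
    (hodgeSlopes d).length = totalDegree d := by
  unfold hodgeSlopes totalDegree
  rw [Multiset.length_sort, Multiset.card_add, Multiset.card_add, Multiset.card_replicate,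
    Multiset.card_replicate, Multiset.card_sum]
  simp only [Multiset.card_map, Finset.card_val, Nat.card_Icc, Nat.add_sub_cancel]
  have h : ∑ j, (d j - 1) + ℓ = ∑ j, d j := by
    have : ∑ j : Fin ℓ, (d j - 1) + ∑ j : Fin ℓ, 1 = ∑ j, d j := by
      rw [← sum_add_distrib]
      exact sum_congr rfl fun j _ => Nat.sub_add_cancel (hd j)
    simpa using this
  omega

theorem hodgeSlopes_mono {i j : ℕ} (hij : i ≤ j) (hj : j < (hodgeSlopes d).length) :
    (hodgeSlopes d).getD i 0 ≤ (hodgeSlopes d).getD j 0 := by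
  rw [List.getD_eq_getElem _ _ (hij.trans_lt hj), List.getD_eq_getElem _ _ hj]
  exact (Multiset.pairwise_sort _ _).rel_get_of_le (a := ⟨i, hij.trans_lt hj⟩) (b := ⟨j, hj⟩) hij

theorem hodgeSlopes_le_one (hd : ∀ j, 1 ≤ d j) {i : ℕ} (hi : i < (hodgeSlopes d).length) :
    (hodgeSlopes d).getD i 0 ≤ 1 := by
  have hmem : (hodgeSlopes d).getD i 0 ∈ hodgeSlopes d := by
    rw [List.getD_eq_getElem _ _ hi]
    exact List.getElem_mem hi
  generalize (hodgeSlopes d).getD i 0 = x at hmem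
  rw [hodgeSlopes, Multiset.mem_sort, Multiset.mem_add, Multiset.mem_add, Multiset.mem_sum] at hmem
  rcases hmem with (h | h) | ⟨j, -, h⟩
  · rw [Multiset.eq_of_mem_replicate h]; norm_num
  · rw [Multiset.eq_of_mem_replicate h]
  · obtain ⟨n, hn, rfl⟩ := Multiset.mem_map.mp h
    have h2 := mem_Icc.mp (mem_val.mp hn)
    have h3 := hd j
    rw [div_le_one (by exact_mod_cast h3)]
    exact_mod_cast (by omega : n ≤ d j)

theorem hodgePolygon_natCast {k : ℕ} (hk : k ≤ (hodgeSlopes d).length) :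
    hodgePolygon d k = ∑ i ∈ range k, (((hodgeSlopes d).getD i 0 : ℚ) : ℝ) := by
  unfold hodgePolygon
  obtain ⟨r, hr⟩ := Nat.exists_eq_add_of_le hk
  rw [hr, sum_range_add]
  have h2 : ∑ i ∈ range r, (((hodgeSlopes d).getD (k + i) 0 : ℚ) : ℝ) *
      max 0 (min 1 ((k : ℝ) - (k + i : ℕ))) = 0 := by
    refine sum_eq_zero fun i _ => ?_
    have : (k : ℝ) - (k + i : ℕ) ≤ 0 := by push_cast; linarith [(Nat.cast_nonneg i : (0 : ℝ) ≤ i)]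
    rw [max_eq_left ((min_le_right _ _).trans this), mul_zero]
  rw [h2, add_zero]
  refine sum_congr rfl fun i hi => ?_
  rw [mem_range] at hi
  have : (1 : ℝ) ≤ (k : ℝ) - i := by
    have : ((i + 1 : ℕ) : ℝ) ≤ k := by exact_mod_cast hi
    push_cast at this
    linarith
  rw [min_eq_left this, max_eq_right zero_le_one, mul_one]

/-- With equal slopes on both sides the function is affine near the integer. A vertex at an integer
therefore requires a strict jump of slopes. -/
theorem differentiableAt_hodgePolygon {m : ℕ} (hm : m + 1 < (hodgeSlopes d).length)
    (heq : (hodgeSlopes d).getD m 0 = (hodgeSlopes d).getD (m + 1) 0) :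
    DifferentiableAt ℝ (hodgePolygon d) ((m + 1 : ℕ) : ℝ) := by
  have hlin : DifferentiableAt ℝ (fun x : ℝ =>
      ∑ i ∈ range m, (((hodgeSlopes d).getD i 0 : ℚ) : ℝ) +
        (((hodgeSlopes d).getD m 0 : ℚ) : ℝ) * (x - m)) ((m + 1 : ℕ) : ℝ) := by fun_prop
  refine hlin.congr_of_eventuallyEq ?_
  have hnb : Set.Ioo (m : ℝ) (m + 2) ∈ nhds (((m + 1 : ℕ)) : ℝ) := by
    apply Ioo_mem_nhds <;> push_cast <;> linarith
  filter_upwards [hnb] with x hx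
  unfold hodgePolygon
  obtain ⟨r, hr⟩ := Nat.exists_eq_add_of_le (show m + 2 ≤ (hodgeSlopes d).length by omega)
  rw [hr, sum_range_add, sum_range_succ, sum_range_succ]
  have h2 : ∑ i ∈ range r, (((hodgeSlopes d).getD (m + 2 + i) 0 : ℚ) : ℝ) *
      max 0 (min 1 (x - (m + 2 + i : ℕ))) = 0 := by
    refine sum_eq_zero fun i _ => ?_
    have : x - (m + 2 + i : ℕ) ≤ 0 := by
      push_cast
      linarith [(Nat.cast_nonneg i : (0 : ℝ) ≤ i), hx.2]
    rw [max_eq_left ((min_le_right _ _).trans this), mul_zero]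
  have h1 : ∑ i ∈ range m, (((hodgeSlopes d).getD i 0 : ℚ) : ℝ) * max 0 (min 1 (x - i)) =
      ∑ i ∈ range m, (((hodgeSlopes d).getD i 0 : ℚ) : ℝ) := by
    refine sum_congr rfl fun i hi => ?_
    rw [mem_range] at hi
    have : (1 : ℝ) ≤ x - i := by
      have : ((i + 1 : ℕ) : ℝ) ≤ m := by exact_mod_cast hi
      push_cast at this
      linarith [hx.1]
    rw [min_eq_left this, max_eq_right zero_le_one, mul_one]
  rw [h1, h2, add_zero, ← heq, add_assoc, ← mul_add]
  congr 2
  have hx1 := hx.1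
  have hx2 := hx.2
  push_cast
  rcases le_total x (m + 1) with h | h
  · rw [min_eq_right (by linarith : x - m ≤ 1), max_eq_right (by linarith : (0 : ℝ) ≤ x - m),
      max_eq_left ((min_le_right _ _).trans (by linarith)), add_zero]
  · rw [min_eq_left (by linarith : (1 : ℝ) ≤ x - m), max_eq_right zero_le_one,
      min_eq_right (by linarith : x - (m + 1) ≤ 1), max_eq_right (by linarith)]
    ring

/-- Exactly one pole has no basis element with numerator zero: the origin, or infinity if it is the
only pole. This matches the `ℓ - 1` slopes equal to `0`. -/
theorem sum_one_sub_minNum (hℓ : 1 ≤ ℓ) : ∑ j : Fin ℓ, (1 - minNum j) = ℓ - 1 := by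
  have h1 : ∑ j : Fin ℓ, minNum j = 1 := by
    by_cases h : ℓ = 1
    · subst h
      simp [minNum]
    · have hlt : 1 < ℓ := by omega
      rw [sum_eq_single ⟨1, hlt⟩]
      · simp [minNum]
      · intro j _ hj
        have : j.val ≠ 1 := fun h => hj (Fin.ext h)
        simp [minNum, this, h]
      · simp
  have h2 : ∑ j : Fin ℓ, (1 - minNum j) + ∑ j : Fin ℓ, minNum j = ℓ := by
    rw [← sum_add_distrib]
    have : ∀ j : Fin ℓ, 1 - minNum j + minNum j = 1 := by
      intro j
      unfold minNum
      split_ifs <;> rfl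
    simp [this]
  omega

/-- Sums over the slopes below `1` are sums over the weights of the basis. -/
theorem sum_map_hodgeSlopes (hℓ : 1 ≤ ℓ) (hd : ∀ j, 1 ≤ d j) (f : ℚ → ℚ) (hf : f 1 = 0) :
    ((hodgeSlopes d).map f).sum =
      ∑ j : Fin ℓ, ∑ n ∈ Ico (minNum j) (d j), f ((n : ℚ) / d j) := by
  have e1 : ((hodgeSlopes d).map f).sum = (((hodgeSlopes d : List ℚ) : Multiset ℚ).map f).sum := by
    rw [Multiset.map_coe, Multiset.sum_coe]
  have e2 : ((hodgeSlopes d : List ℚ) : Multiset ℚ) = _ := Multiset.sort_eq _ _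
  rw [e1, e2, Multiset.map_add, Multiset.map_add, Multiset.sum_add, Multiset.sum_add,
    Multiset.map_replicate, Multiset.map_replicate, Multiset.sum_replicate,
    Multiset.sum_replicate, hf, smul_zero, add_zero]
  have e3 : ((∑ j : Fin ℓ, (Icc 1 (d j - 1)).val.map fun i : ℕ => (i : ℚ) / (d j : ℚ)).map f).sum =
      ∑ j : Fin ℓ, ∑ n ∈ Icc 1 (d j - 1), f ((n : ℚ) / d j) := by
    have h := map_sum (Multiset.sumAddMonoidHom.comp (Multiset.mapAddMonoidHom f))
      (fun j : Fin ℓ => (Icc 1 (d j - 1)).val.map fun i : ℕ => (i : ℚ) / (d j : ℚ)) univ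
    simp only [AddMonoidHom.comp_apply, Multiset.coe_sumAddMonoidHom,
      Multiset.coe_mapAddMonoidHom, Multiset.map_map] at h
    rw [h]
    rfl
  have e4 : (ℓ - 1) • f 0 = ∑ j : Fin ℓ, (1 - minNum j) • f 0 := by
    rw [← sum_one_sub_minNum hℓ, sum_smul]
  rw [e3, e4, ← sum_add_distrib]
  refine sum_congr rfl fun j _ => ?_
  have h1 := hd j
  have h2 : Icc 1 (d j - 1) = Ico 1 (d j) := by
    ext n
    simp only [mem_Icc, mem_Ico]
    omega
  rw [h2]
  have h3 : minNum j = 0 ∨ minNum j = 1 := by unfold minNum; split_ifs <;> simp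
  rcases h3 with h | h
  · rw [h, sum_eq_sum_Ico_succ_bot (show 0 < d j from h1) (fun n : ℕ => f ((n : ℚ) / d j))]
    simp
  · rw [h]
    simp

theorem eq_range_card {A : Finset ℕ} (hA : ∀ m ∈ A, ∀ n ≤ m, n ∈ A) : A = range A.card := by
  refine eq_of_subset_of_card_le (fun m hm => ?_) (by rw [card_range])
  rw [mem_range]
  have h : range (m + 1) ⊆ A := fun n hn => hA m hm n (by rw [mem_range] at hn; omega)
  have := card_le_card h
  rw [card_range] at this
  omega

/-- At a vertex of the Hodge polygon the first basis elements are those of weight below a bound, and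
the ordinate is the sum of their weights. -/
theorem exists_bound_of_isHodgeVertex (hℓ : 1 ≤ ℓ) (hd : ∀ j, 1 ≤ d j) (e : ℕ ≃ BasisIdx ℓ)
    (he : Monotone fun m => basisWeight d (e m)) {k : ℕ} {c₀ : ℝ} (hk : 1 ≤ k)
    (hv : IsHodgeVertex d k c₀) :
    ∃ σ : ℚ, σ ≤ 1 ∧ (∀ m, basisWeight d (e m) < σ ↔ m < k) ∧
      c₀ = ∑ m ∈ range k, ((basisWeight d (e m) : ℚ) : ℝ) := by
  classical
  obtain ⟨-, hv2, hv3, hv4⟩ := hv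
  have hlen := length_hodgeSlopes hℓ hd
  have hklen : k < (hodgeSlopes d).length := by
    rw [hlen]
    exact_mod_cast hv2
  obtain ⟨m, rfl⟩ : ∃ m, k = m + 1 := ⟨k - 1, by omega⟩
  -- The slope just after the vertex, strictly larger than the one before it.
  set σ := (hodgeSlopes d).getD (m + 1) 0 with hσ
  have hσ1 : σ ≤ 1 := hodgeSlopes_le_one hd hklen
  have hlt : (hodgeSlopes d).getD m 0 < σ := by
    refine lt_of_le_of_ne (hodgeSlopes_mono (Nat.le_succ m) hklen) fun heq => ?_
    exact hv4 (differentiableAt_hodgePolygon hklen heq)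
  have hiff : ∀ i < (hodgeSlopes d).length, ((hodgeSlopes d).getD i 0 < σ ↔ i < m + 1) := by
    intro i hi
    constructor
    · intro h
      by_contra! hcon
      exact absurd (hodgeSlopes_mono hcon hi) (not_le.mpr h)
    · intro h
      exact (hodgeSlopes_mono (by omega) (by omega)).trans_lt hlt
  -- sums of the slopes below the bound
  have hsum : ∀ g : ℚ → ℚ, ∑ i ∈ range (m + 1), g ((hodgeSlopes d).getD i 0) =
      ∑ x ∈ (univ.sigma fun j : Fin ℓ => Ico (minNum j) (d j)).filter
        (fun x : Σ _ : Fin ℓ, ℕ => (x.2 : ℚ) / d x.1 < σ), g ((x.2 : ℚ) / d x.1) := by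
    intro g
    have h1 := sum_map_hodgeSlopes hℓ hd (fun x => if x < σ then g x else 0)
      (if_neg (not_lt.mpr hσ1))
    rw [sum_filter, sum_sigma, ← h1, ← Fin.sum_univ_fun_getElem]
    have h2 : ∀ i : Fin (hodgeSlopes d).length, (if (hodgeSlopes d)[i.val] < σ then
        g (hodgeSlopes d)[i.val] else 0) =
        (fun i : ℕ => if i < m + 1 then g ((hodgeSlopes d).getD i 0) else 0) i.val := by
      intro i
      have h3 := hiff i.val i.2
      rw [List.getD_eq_getElem _ _ i.2] at h3
      simp only [h3]
      rw [List.getD_eq_getElem _ _ i.2]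
    rw [sum_congr rfl fun i _ => h2 i,
      Fin.sum_univ_eq_sum_range (fun i : ℕ => if i < m + 1 then g ((hodgeSlopes d).getD i 0) else 0)
        (hodgeSlopes d).length, ← sum_filter]
    refine sum_congr ?_ fun _ _ => rfl
    ext i
    simp only [mem_range, mem_filter]
    omega
  set K := (univ.sigma fun j : Fin ℓ => Ico (minNum j) (d j)).filter
        (fun x : Σ _ : Fin ℓ, ℕ => (x.2 : ℚ) / d x.1 < σ) with hK
  -- The constant test function counts the weights below `σ`.
  have hcard : K.card = m + 1 := by
    have h := hsum fun _ => 1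
    rw [sum_const, sum_const, card_range, nsmul_eq_mul, nsmul_eq_mul, mul_one, mul_one] at h
    exact_mod_cast h.symm
  set κ : ℕ → Σ _ : Fin ℓ, ℕ := fun n => ⟨(e n).1.1, weightNum (e n)⟩ with hκ
  have hκinj : Function.Injective κ := by
    intro n n' h
    simp only [hκ] at h
    obtain ⟨h1, h2⟩ := Sigma.mk.inj_iff.mp h
    exact e.injective (basisIdx_ext h1 (eq_of_heq h2))
  have hκw : ∀ n, ((κ n).2 : ℚ) / d (κ n).1 = basisWeight d (e n) := fun n =>
    (basisWeight_eq d (e n)).symm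
  have hκK : ∀ n, κ n ∈ K ↔ basisWeight d (e n) < σ := by
    intro n
    rw [hK, mem_filter, hκw, and_iff_right_iff_imp]
    intro h
    have h1 := minNum_le (e n)
    have h2 : weightNum (e n) < d (e n).1.1 := by
      have h3 := h.trans_le hσ1
      rw [basisWeight_eq, div_lt_one (by exact_mod_cast hd _)] at h3
      exact_mod_cast h3
    rw [mem_sigma]
    exact ⟨mem_univ _, mem_Ico.mpr ⟨h1, h2⟩⟩
  -- The positions in the enumeration of the elements of weight below `σ`. By monotonicity they are
  -- closed downwards, hence are the first `m + 1` ones whatever the order among equal weights.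
  set A := K.preimage κ hκinj.injOn with hA
  have hAK : A.image κ = K := by
    rw [hA, image_preimage, filter_true_of_mem]
    rintro ⟨j, n⟩ hx
    rw [hK, mem_filter, mem_sigma, mem_Ico] at hx
    obtain ⟨b, hb1, hb2⟩ := exists_basisIdx_of_minNum_le hx.1.2.1
    refine ⟨e.symm b, ?_⟩
    simp only [hκ, Equiv.apply_symm_apply, hb1, hb2]
  have hAcard : A.card = m + 1 := by
    rw [← hcard, ← hAK, card_image_of_injective _ hκinj]
  have hArange : A = range (m + 1) := by
    rw [← hAcard]
    refine eq_range_card fun n hn n' hn' => ?_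
    rw [hA, mem_preimage, hκK] at hn ⊢
    exact (he hn').trans_lt hn
  refine ⟨σ, hσ1, fun n => ?_, ?_⟩
  · rw [← hκK, ← mem_range, ← hArange, hA, mem_preimage]
  -- The identity as test function gives the ordinate.
  · rw [hv3, hodgePolygon_natCast hklen.le]
    have h := hsum fun x => x
    rw [← hAK, sum_image hκinj.injOn, hArange] at h
    simp only [hκw] at h
    exact_mod_cast congrArg (Rat.cast (K := ℝ)) h

end Hodge

/-! ### Teichmüller lifts of embedded algebraic numbers -/

section Lifts

theorem isTeichmullerLift_teichmuller {p : ℕ} [Fact p.Prime] {x : ℂ_[p]}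
    (h : ∃ y, IsTeichmullerLift p x y) : IsTeichmullerLift p x (teichmuller p x) := by
  unfold teichmuller
  rw [dif_pos h]
  exact h.choose_spec

theorem teichmuller_zero (p : ℕ) [hp : Fact p.Prime] : teichmuller p (0 : ℂ_[p]) = 0 := by
  have h : ∃ y, IsTeichmullerLift p (0 : ℂ_[p]) y :=
    ⟨0, ⟨1, le_rfl, zero_pow (pow_ne_zero _ hp.out.ne_zero)⟩, by simp⟩
  obtain ⟨⟨a, ha, h1⟩, h2⟩ := isTeichmullerLift_teichmuller h
  rw [sub_zero] at h2
  by_contra hne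
  have h3 : ‖teichmuller p (0 : ℂ_[p])‖ ^ p ^ a = ‖teichmuller p (0 : ℂ_[p])‖ := by
    rw [← norm_pow, h1]
  exact absurd h3 (pow_lt_self_of_lt_one₀ (norm_pos_iff.mpr hne) h2
    (Nat.one_lt_pow (by omega) hp.out.one_lt)).ne

theorem eventually_mem_frobPairs (α : QBar) : ∀ᶠ p : ℕ in atTop, ∀ (_ : Fact p.Prime)
    (ι : QBar →+* ℂ_[p]), (teichmuller p (ι α), ι α) ∈ frobPairs ℂ_[p] p := by
  obtain ⟨N, hN⟩ := exists_norm_le_one α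
  filter_upwards [eventually_ge_atTop N] with p hp hprime ι
  obtain ⟨h1, a, ha, h2⟩ := hN p hp ℂ_[p] norm_prime_lt_one ι
  obtain ⟨y, hy1, hy2⟩ := exists_teichmuller_point hprime.out norm_prime_lt_one h1 ha h2
  obtain ⟨⟨b, hb, h3⟩, h4⟩ := isTeichmullerLift_teichmuller ⟨y, ⟨a, ha, hy1⟩, hy2⟩
  refine mem_frobPairs.mpr ⟨?_, ⟨b, hb, ?_⟩, h1, h4⟩
  · have := (unitBall ℂ_[p]).add_mem (show teichmuller p (ι α) - ι α ∈ unitBall ℂ_[p] from h4.le)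
      (show ι α ∈ unitBall ℂ_[p] from h1)
    rwa [sub_add_cancel] at this
  · rw [h3, sub_self, norm_zero]
    exact norm_nonneg _

theorem eventually_norm_eq_one {α : QBar} (hα : α ≠ 0) : ∀ᶠ p : ℕ in atTop,
    ∀ (_ : Fact p.Prime) (ι : QBar →+* ℂ_[p]), ‖ι α‖ = 1 := by
  obtain ⟨N, hN⟩ := exists_norm_eq_one hα
  filter_upwards [eventually_ge_atTop N] with p hp hprime ι
  exact hN p hp ℂ_[p] norm_prime_lt_one ι

end Lifts

/-! ### Dense open subsets of the coefficient space -/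

section Zariski

variable {ℓ : ℕ} {d : Fin ℓ → ℕ}

theorem isZariskiOpenOverRat_ne_zero (g : MvPolynomial (CoeffIdx d) ℚ) :
    IsZariskiOpenOverRat d {a | a ∈ coeffSpace d ∧ MvPolynomial.aeval a g ≠ 0} :=
  ⟨{g}, by simp⟩

theorem isZariskiDense_ne_zero (hd : ∀ j, 1 ≤ d j) {g : MvPolynomial (CoeffIdx d) ℚ} (hg : g ≠ 0) :
    IsZariskiDense d {a | a ∈ coeffSpace d ∧ MvPolynomial.aeval a g ≠ 0} := by
  rintro h ⟨a₀, -, ha₀⟩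
  have hh : h ≠ 0 := fun h0 => ha₀ (by rw [h0, map_zero])
  have hg' : MvPolynomial.map (algebraMap ℚ QBar) g ≠ 0 := fun h0 =>
    hg (MvPolynomial.map_injective _ (algebraMap ℚ QBar).injective (by rw [h0, map_zero]))
  -- Including the leading coordinates in the product forces the point found to lie in the
  -- coefficient space.
  have ht : ∏ j : Fin ℓ, (MvPolynomial.X (topIdx hd j) : MvPolynomial (CoeffIdx d) QBar) ≠ 0 :=
    prod_ne_zero_iff.mpr fun j _ => MvPolynomial.X_ne_zero _
  obtain ⟨a, ha⟩ : ∃ a : CoeffIdx d → QBar, MvPolynomial.eval a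
      (h * MvPolynomial.map (algebraMap ℚ QBar) g *
        ∏ j : Fin ℓ, MvPolynomial.X (topIdx hd j)) ≠ 0 := by
    by_contra! hcon
    exact mul_ne_zero (mul_ne_zero hh hg') ht (MvPolynomial.funext fun a => by
      rw [hcon a, map_zero])
  rw [map_mul, map_mul, map_prod] at ha
  refine ⟨a, ⟨fun j i hi h0 => ?_, ?_⟩, left_ne_zero_of_mul (left_ne_zero_of_mul ha)⟩
  · refine right_ne_zero_of_mul ha (prod_eq_zero (mem_univ j) ?_)
    rw [MvPolynomial.eval_X, ← h0]
    congr 1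
    exact Sigma.ext rfl (heq_of_eq (Fin.ext (show d j - 1 = i.val by omega)))
  · have := right_ne_zero_of_mul (left_ne_zero_of_mul ha)
    rwa [MvPolynomial.eval_map, ← MvPolynomial.aeval_def] at this

/-- A nonzero polynomial with algebraic coefficients is nonzero wherever a suitable nonzero
rational polynomial is. -/
theorem exists_rat_polynomial {σ : Type*} {G : MvPolynomial σ QBar} (hG : G ≠ 0) :
    ∃ g : MvPolynomial σ ℚ, g ≠ 0 ∧
      ∀ a : σ → QBar, MvPolynomial.aeval a g ≠ 0 → MvPolynomial.eval a G ≠ 0 := by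
  have : Algebra.IsAlgebraic ℚ QBar := AlgebraicClosure.isAlgebraic ℚ
  obtain ⟨g, hg, q, hq⟩ := MvPolynomial.exists_dvd_map_of_isAlgebraic (R := ℚ) hG
  refine ⟨g, hg, fun a ha h0 => ha ?_⟩
  rw [MvPolynomial.aeval_def, ← MvPolynomial.eval_map, hq, map_mul, h0, zero_mul]

end Zariski

/-! ### The block at a vertex -/

section Block

variable {ℓ : ℕ} {d : Fin ℓ → ℕ}

/-- The shape of the block of the first `k` basis elements for primes congruent to `u`. -/
def initialShape (hd : ∀ j, 1 ≤ d j) (e : ℕ ≃ BasisIdx ℓ) (k u : ℕ) : BlockShape d k :=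
  -- `L` bounds the sum of the residues. None of the bounds depends on `u`, so one threshold for `p`
  -- serves all classes.
  let L := ∑ a : Fin k, d (e a).1.1
  let S := ∑ a : Fin k, (e a).1.2
  let C := (∑ j, d j) * L + S
  { pos := hd
    idx := fun a => e a
    res := fun a => u * weightNum (e a) % d (e a).1.1
    depth := L
    cut := C
    bound := (∑ j, d j) * (L + C) + S + C }

theorem initialShape_isLarge (hd : ∀ j, 1 ≤ d j) (e : ℕ ≃ BasisIdx ℓ) (k u : ℕ)
    (hw : ∀ m < k, weightNum (e m) < d (e m).1.1) : (initialShape hd e k u).IsLarge := by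
  have hdj : ∀ j, d j ≤ ∑ j, d j := fun j =>
    single_le_sum (f := d) (fun _ _ => Nat.zero_le _) (mem_univ j)
  have hS : ∀ b : Fin k, (e b).1.2 ≤ ∑ a : Fin k, (e a).1.2 := fun b =>
    single_le_sum (f := fun a : Fin k => (e a).1.2) (fun _ _ => Nat.zero_le _) (mem_univ b)
  refine ⟨fun a => hw a a.2, fun a b => ?_, fun a b => ?_, Nat.le_add_left _ _⟩
  · exact add_le_add (Nat.mul_le_mul_right _ (hdj _)) (hS b)
  · exact (add_le_add (Nat.mul_le_mul_right _ (hdj _)) (hS b)).trans (Nat.le_add_right _ _)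

theorem initialShape_isInitial (hd : ∀ j, 1 ≤ d j) (e : ℕ ≃ BasisIdx ℓ) (k u : ℕ) {σ : ℚ}
    (hσ : ∀ m, basisWeight d (e m) < σ ↔ m < k) : (initialShape hd e k u).IsInitial := by
  refine ⟨fun a b h => Fin.ext (e.injective h), fun a b h1 h2 => ?_⟩
  have h3 : e.symm b < k := by
    rw [← hσ, Equiv.apply_symm_apply]
    refine lt_of_le_of_lt ?_ ((hσ a).mpr a.2)
    rw [basisWeight_eq, basisWeight_eq, h1]
    exact div_le_div_of_nonneg_right (by exact_mod_cast h2) (Nat.cast_nonneg _)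
  exact ⟨⟨e.symm b, h3⟩, e.apply_symm_apply b⟩

theorem sum_res_le_depth (hd : ∀ j, 1 ≤ d j) (e : ℕ ≃ BasisIdx ℓ) (k u : ℕ) :
    ∑ a, (initialShape hd e k u).res a ≤ (initialShape hd e k u).depth :=
  sum_le_sum fun _ _ => (Nat.mod_lt _ (hd _)).le

/-- `pn/m` exceeds `(p - 1) n/m` by `n/m ∈ [0, 1]`, and the floor loses less than `1`. -/
theorem abs_floor_div_sub_le {p n m : ℕ} (hp : 1 < p) (hm : 0 < m) (hn : n ≤ m) :
    |((p * n / m : ℕ) : ℝ) / ((p : ℝ) - 1) - (n : ℝ) / m| ≤ 1 / ((p : ℝ) - 1) := by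
  have hp0 : (0 : ℝ) < (p : ℝ) - 1 := by
    have : (1 : ℝ) < p := by exact_mod_cast hp
    linarith
  have hm0 : (0 : ℝ) < m := by exact_mod_cast hm
  have h1 : ((p * n / m : ℕ) : ℝ) ≤ (p : ℝ) * (n / m) := by
    have := Nat.cast_div_le (α := ℝ) (m := p * n) (n := m)
    rwa [Nat.cast_mul, mul_div_assoc] at this
  have h2 : (p : ℝ) * (n / m) < ((p * n / m : ℕ) : ℝ) + 1 := by
    have := Nat.lt_div_mul_add (a := p * n) hm
    rw [← mul_div_assoc, div_lt_iff₀ hm0]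
    have h3 : p * n < (p * n / m + 1) * m := by rw [add_mul, one_mul]; exact this
    exact_mod_cast h3
  have h3 : (n : ℝ) / m ≤ 1 := (div_le_one hm0).mpr (by exact_mod_cast hn)
  have h4 : (0 : ℝ) ≤ (n : ℝ) / m := by positivity
  rw [div_sub' hp0.ne', abs_div, abs_of_pos hp0]
  refine div_le_div_of_nonneg_right (abs_le.mpr ⟨?_, ?_⟩) hp0.le <;> nlinarith

end Block

end DworkFamily

end

/-! ### Assembly: the open set and the limit -/

open DworkFamily in
theorem proposition4p5 (ℓ : ℕ) (hℓ : 1 ≤ ℓ) (d : Fin ℓ → ℕ) (hd : ∀ j, 1 ≤ d j)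
    (P : Fin ℓ → QBar) (hP₂ : ∀ j : Fin ℓ, j.val = 1 → P j = 0)
    (hP : ∀ i j : Fin ℓ, i.val ≠ 0 → j.val ≠ 0 → P i = P j → i = j)
    (e : ℕ ≃ BasisIdx ℓ) (he : Monotone fun m => basisWeight d (e m))
    (k : ℕ) (c₀ : ℝ) (hk : 1 ≤ k) (hk' : k + ℓ ≤ totalDegree d) (hv : IsHodgeVertex d k c₀) :
    ∃ U : Set (CoeffIdx d → QBar), IsZariskiOpenOverRat d U ∧ IsZariskiDense d U ∧
      ∀ f ∈ U, ∀ ε : ℝ, 0 < ε → ∃ N : ℕ, ∀ (p : ℕ) [Fact p.Prime], N ≤ p →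
        ∀ (ι : QBar →+* ℂ_[p]) (γ : ℂ_[p]) (δ : Fin ℓ → ℂ_[p]),
          IsArtinHasseRoot p γ → (∀ j, δ j ^ d j = γ) →
          (principalBlock e k (frobeniusMatrixAt d P f ι γ δ)).det ≠ 0 ∧
          |ordp p (principalBlock e k (frobeniusMatrixAt d P f ι γ δ)).det - c₀| < ε := by
  classical
  obtain ⟨σ, hσ1, hσ, hc₀⟩ := exists_bound_of_isHodgeVertex hℓ hd e he hk hv
  have hw : ∀ m < k, weightNum (e m) < d (e m).1.1 := fun m hm => by
    have h := ((hσ m).mpr hm).trans_le hσ1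
    rw [basisWeight_eq, div_lt_one (by exact_mod_cast hd _)] at h
    exact_mod_cast h
  set D := ∏ j, d j with hD
  have hdD : ∀ j, d j ∣ D := fun j => Finset.dvd_prod_of_mem d (Finset.mem_univ j)
  have hD0 : 0 < D := Finset.prod_pos fun j _ => hd j
  -- The depth is the same for all classes, so it can be written for the class of `0`.
  have hlead : ∀ u : ℕ, ∃ t, u.Coprime D → t ≤ (initialShape hd e k 0).depth ∧
      ((classData (initialShape hd e k u) P MvPolynomial.C MvPolynomial.X).detPoly
        (initialShape hd e k u)).coeff t ≠ 0 := fun u => by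
    by_cases hu : u.Coprime D
    · obtain ⟨t, ht⟩ := exists_coeff_detPoly_ne_zero (initialShape_isLarge hd e k u hw)
        (initialShape_isInitial hd e k u hσ) (u := u) (fun j => hu.coprime_dvd_right (hdD j))
        (fun _ => rfl) (sum_res_le_depth hd e k u) P
      exact ⟨t, fun _ => ht⟩
    · exact ⟨0, fun h => absurd h hu⟩
  choose t ht using hlead
  set G : ℕ → MvPolynomial (CoeffIdx d) QBar := fun u =>
    ((classData (initialShape hd e k u) P MvPolynomial.C MvPolynomial.X).detPoly
        (initialShape hd e k u)).coeff (t u) with hG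
  -- One polynomial for all classes prime to `D`; the rational multiple `g` makes the open set
  -- defined over the rationals.
  obtain ⟨g, hg0, hg⟩ := exists_rat_polynomial
    (G := ∏ u ∈ (Finset.range D).filter (Nat.Coprime · D), G u)
    (Finset.prod_ne_zero_iff.mpr fun u hu => (ht u (Finset.mem_filter.mp hu).2).2)
  refine ⟨_, isZariskiOpenOverRat_ne_zero g, isZariskiDense_ne_zero hd hg0, ?_⟩
  rintro f ⟨hf, hfg⟩ ε hε
  have hfG : ∀ u < D, u.Coprime D → MvPolynomial.eval f (G u) ≠ 0 := fun u hu hcop => by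
    have h := hg f hfg
    rw [map_prod, Finset.prod_ne_zero_iff] at h
    exact h u (Finset.mem_filter.mpr ⟨Finset.mem_range.mpr hu, hcop⟩)
  set B := initialShape hd e k 0 with hB
  have e1 : ∀ᶠ p : ℕ in Filter.atTop, ∀ s, ∀ (_ : Fact p.Prime) (ι : QBar →+* ℂ_[p]),
      (teichmuller p (ι (f s)), ι (f s)) ∈ frobPairs ℂ_[p] p :=
    Filter.eventually_all.mpr fun s => eventually_mem_frobPairs _
  have e2 : ∀ᶠ p : ℕ in Filter.atTop, ∀ j, ∀ (_ : Fact p.Prime) (ι : QBar →+* ℂ_[p]),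
      (teichmuller p (ι (P j)), ι (P j)) ∈ frobPairs ℂ_[p] p :=
    Filter.eventually_all.mpr fun j => eventually_mem_frobPairs _
  have e3 : ∀ᶠ p : ℕ in Filter.atTop, ∀ j, ∀ (_ : Fact p.Prime) (ι : QBar →+* ℂ_[p]),
      ‖ι (f (topIdx hd j))‖ = 1 :=
    Filter.eventually_all.mpr fun j => eventually_norm_eq_one
      (hf j _ (Nat.sub_add_cancel (hd j)))
  have e4 : ∀ᶠ p : ℕ in Filter.atTop, ∀ x : Fin ℓ × Fin ℓ, x.1.val ≠ 0 → x.2.val ≠ 0 →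
      x.1 ≠ x.2 → ∀ (_ : Fact p.Prime) (ι : QBar →+* ℂ_[p]), ‖ι (P x.1 - P x.2)‖ = 1 := by
    refine Filter.eventually_all.mpr fun x => ?_
    by_cases h : P x.1 = P x.2
    · exact Filter.Eventually.of_forall fun p h1 h2 h3 => absurd (hP _ _ h1 h2 h) h3
    · filter_upwards [eventually_norm_eq_one (sub_ne_zero.mpr h)] with p hp _ _ _ using hp
  have e5 : ∀ᶠ p : ℕ in Filter.atTop, ∀ u : Fin D, u.val.Coprime D →
      ∀ (_ : Fact p.Prime) (ι : QBar →+* ℂ_[p]), ‖ι (MvPolynomial.eval f (G u))‖ = 1 := by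
    refine Filter.eventually_all.mpr fun u => ?_
    by_cases h : u.val.Coprime D
    · filter_upwards [eventually_norm_eq_one (hfG u u.2 h)] with p hp _ using hp
    · exact Filter.Eventually.of_forall fun p h' => absurd h' h
  have e6 : ∀ᶠ p : ℕ in Filter.atTop, ∀ j, d j * (B.depth + 1) < p :=
    Filter.eventually_all.mpr fun j => Filter.eventually_gt_atTop _
  -- The errors add up to at most `(k + depth)/(p - 1)`: one unit for the floor in each row and at
  -- most `depth` for the extra power of `γ`.
  have e7 : ∀ᶠ p : ℕ in Filter.atTop, ((k : ℝ) + B.depth) / ε < p - 1 := by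
    filter_upwards [tendsto_natCast_atTop_atTop.eventually_gt_atTop
      (((k : ℝ) + B.depth) / ε + 1)] with p hp
    linarith
  obtain ⟨N, hN⟩ := Filter.eventually_atTop.mp (e1.and (e2.and (e3.and (e4.and (e5.and (e6.and
    (e7.and ((Filter.eventually_gt_atTop D).and ((Filter.eventually_gt_atTop B.bound).and
    (Filter.eventually_gt_atTop (2 * B.depth + 3)))))))))))
  refine ⟨N, fun p hprime hNp ι γ δ hγ hδ => ?_⟩
  obtain ⟨h1, h2, h3, h4, h5, h6, h7, h8, h9, h10⟩ := hN p hNp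
  -- A prime larger than `D` is prime to it, so its class is among those covered by `g`.
  have hpcop : (p % D).Coprime D := by
    have h : p.Coprime D :=
      (Nat.Prime.coprime_iff_not_dvd hprime.out).mpr (Nat.not_dvd_of_pos_of_lt hD0 h8)
    unfold Nat.Coprime at h ⊢
    rwa [← Nat.gcd_rec, Nat.gcd_comm]
  have hpos : 0 < ‖γ‖ := norm_pos_iff.mpr (norm_pow_of_isArtinHasseRoot hγ).1
  have hδ0 : ∀ j, δ j ≠ 0 := fun j h => by
    have := hδ j
    rw [h, zero_pow (by have := hd j; omega)] at this
    rw [← this, norm_zero] at hpos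
    exact hpos.false
  have hQ0 : ∀ j : Fin ℓ, j.val = 1 → teichmuller p (ι (P j)) = 0 := fun j hj => by
    rw [hP₂ j hj, map_zero, teichmuller_zero]
  -- The pole with index `1` is the origin, so this is an instance of the distances between poles
  -- being units.
  have hPj : ∀ j : Fin ℓ, 2 ≤ j.val → ‖ι (P j)‖ = 1 := fun j hj => by
    have hlt : 1 < ℓ := by have := j.2; omega
    have h := h4 (j, ⟨1, hlt⟩) (by simp only; omega) one_ne_zero
      (fun h => by have := congrArg Fin.val h; simp only at this; omega) hprime ι
    rwa [hP₂ ⟨1, hlt⟩ rfl, sub_zero] at h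
  obtain ⟨r, hr, hdet⟩ := norm_det_frobeniusMatrix hℓ hγ hδ0 ι (fun s => h1 s hprime ι)
    (fun j _ => h2 j hprime ι)
    (fun i j hi hj hij => by rw [← map_sub]; exact h4 (i, j) hi hj hij hprime ι) hPj hQ0
    (B := initialShape hd e k (p % D)) (initialShape_isLarge hd e k (p % D) hw)
    (fun j => h3 j hprime ι)
    (fun a => ((Nat.mod_modEq p D).of_dvd (hdD _)).mul_right _) h9 h6 h10
    (ht (p % D) hpcop).1 (h5 ⟨p % D, Nat.mod_lt _ hD0⟩ hpcop hprime ι) e (fun _ => rfl)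
  change ‖(principalBlock e k (frobeniusMatrixAt d P f ι γ δ)).det‖ =
    ‖γ‖ ^ (∑ a : Fin k, p * weightNum (e a) / d (e a).1.1 + r) at hdet
  refine ⟨norm_pos_iff.mp (by rw [hdet]; positivity), ?_⟩
  have hp1 : (0 : ℝ) < (p : ℝ) - 1 := by
    have : (1 : ℝ) < p := by exact_mod_cast hprime.out.one_lt
    linarith
  have hc : c₀ = ∑ a : Fin k, (weightNum (e a) : ℝ) / d (e a).1.1 := by
    rw [hc₀, ← Fin.sum_univ_eq_sum_range (fun m => ((basisWeight d (e m) : ℚ) : ℝ)) k]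
    refine Finset.sum_congr rfl fun a _ => ?_
    rw [basisWeight_eq]
    push_cast
    rfl
  have hkey : ordp p (principalBlock e k (frobeniusMatrixAt d P f ι γ δ)).det - c₀ =
      ∑ a : Fin k, (((p * weightNum (e a) / d (e a).1.1 : ℕ) : ℝ) / ((p : ℝ) - 1) -
        (weightNum (e a) : ℝ) / d (e a).1.1) + r / ((p : ℝ) - 1) := by
    rw [ordp_of_norm_eq_pow hγ hdet, hc, Finset.sum_sub_distrib, Nat.cast_add, Nat.cast_sum,
      add_div, Finset.sum_div]
    ring
  have hbound : |∑ a : Fin k, (((p * weightNum (e a) / d (e a).1.1 : ℕ) : ℝ) / ((p : ℝ) - 1) -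
        (weightNum (e a) : ℝ) / d (e a).1.1)| ≤ k / ((p : ℝ) - 1) := by
    refine (Finset.abs_sum_le_sum_abs _ _).trans ?_
    refine (Finset.sum_le_sum fun (a : Fin k) _ =>
      abs_floor_div_sub_le hprime.out.one_lt (hd _) (hw a.val a.isLt).le).trans (le_of_eq ?_)
    rw [Finset.sum_const, Finset.card_univ, Fintype.card_fin, nsmul_eq_mul, mul_one_div]
  rw [hkey]
  refine (abs_add_le _ _).trans_lt ?_
  have hr' : |(r : ℝ) / ((p : ℝ) - 1)| ≤ B.depth / ((p : ℝ) - 1) := by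
    rw [abs_of_nonneg (by positivity)]
    have : (r : ℝ) ≤ B.depth := by exact_mod_cast hr
    exact div_le_div_of_nonneg_right this hp1.le
  refine (add_le_add hbound hr').trans_lt ?_
  rw [← add_div, div_lt_iff₀ hp1, mul_comm, ← div_lt_iff₀ hε]
  exact h7
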